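/- Let $Q_1=\chi_{[0,1)}$ and $Q_{m+1}(t)=\int_{-\infty}^{\infty}Q_m(t-y)Q_1(y)\,dy$ be the B-splines, and for $\phi:\mathbb R\to\mathbb C$ let $V(\phi)$ be the set of all $f\in L^2(\mathbb R)$ with $f(x)=\sum_{k\in\mathbb Z}c_k\phi(x-k)$ for all $x$, for some $(c_k)\in\ell^2(\mathbb Z)$. An $s$-regular stable generator is a $\phi\in C^s(\mathbb R)$ whose integer translates form a Riesz basis of $V(\phi)$ and such that, for some $\epsilon>0$, $\phi^{(i)}(t)=O(|t|^{-1/2-\epsilon})$ as $t\to\pm\infty$ for $0\le i\le s$. For such $\phi$, a set $\{x_n:n\in\mathbb Z\}$ is a complete interpolation set of order $s$ for $V(\phi)$ if (uniqueness) $f\in V(\phi)$ and $f^{(i)}(x_n)=0$ for all $n$ and $0\le i\le s$ imply $f\equiv0$, and (interpolation) for every square summable $(c_{ni})$ there is $f\in V(\phi)$ with $f^{(i)}(x_n)=c_{ni}$ for all $n$ and $0\le i\le s$. Let $\kappa=(Q_4,\tfrac12,2)$. Let $\Psi_\kappa(t)$ be the $2\times2$ matrix with entries $\Psi_\kappa^{ij}(t)=\sum_{k\in\mathbb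 Z}Q_4^{(i)}(\tfrac12+2k-j)e^{2\pi \mathrm i kt}$, $i,j\in\{0,1\}$. For $v\in\mathbb Z$ put $c_{ji}(v)=\int_0^1e^{-2\pi\mathrm i vt}(\Psi_\kappa(t)^{-1})^{ji}\,dt$, and let $$\Theta_{i}(t)=\sum_{v\in\mathbb Z}\sum_{j=0}^{1}c_{ji}(v)\,Q_4(t-2v-j),\qquad (S_W^{\kappa}f)(t)=\sum_{l\in\mathbb Z}\sum_{i=0}^{1}\frac1{W^i}f^{(i)}\Big(\frac{\frac12+2l}{W}\Big)\Theta_i(Wt-2l).$$ Then: 1. With $w=e^{2\pi\mathrm i t}$, $\det\Psi_\kappa(t)=\frac{w}{64}(-3+38w-3w^2)\ne0$ for all real $t$. 2. $Q_4$ is a $1$-regular stable generator, and $\tfrac12+2\mathbb Z$ is a complete interpolation set of order $1$ for $V(Q_4)$. 3. With $r=\frac{19-4\sqrt{22}}{3}\in(0,1)$, for all $v\in\mathbb Z$, $$c_{00}(v)=\tfrac{8r}{3(1-r^2)}\big(5r^{|v+1|}-r^{|v|}\big),\quad c_{10}(v)=\tfrac{8r}{3(1-r^2)}\big(5r^{|v+1|}-r^{|v+2|}\big),$$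 $$c_{01}(v)=-\tfrac{4r}{9(1-r^2)}\big(23r^{|v+1|}+r^{|v|}\big),\quad c_{11}(v)=\tfrac{4r}{9(1-r^2)}\big(23r^{|v+1|}+r^{|v+2|}\big).$$ In particular, for some constant $C$, $|c_{ji}(v)|\le C\,r^{|v|}$ for all $j,i,v$; and $\Theta_0,\Theta_1$ are pointwise the sums of the series above with these coefficients. 4. For every $f\in V(Q_4)$ and every $t\in\mathbb R$, $f(t)=\sum_{l\in\mathbb Z}\big[f(\tfrac12+2l)\Theta_0(t-2l)+f'(\tfrac12+2l)\Theta_1(t-2l)\big]$. 5. For every $W\ge1$ and every polynomial $P$ of degree $\le3$, the series $S_W^\kappa P$ converges pointwise and $S_W^\kappa P=P$. 6. Let $1\le p<\infty$ and $\alpha>0$. Let $\Lambda_2^p$ be the set of bounded measurable $f:\mathbb R\to\mathbb C$ such that, for every sequence $(x_j)_{j\in\mathbb Z}$ with $0<\inf_j(x_j-x_{j-1})\le\sup_j(x_j-x_{j-1})<\infty$, $f$ is differentiable at every $x_j$ and $\sum_j\sum_{i=0}^{1}|f^{(i)}(x_j)|^p(x_j-x_{j-1})<\infty$. Let $\tau_3(g;\delta)_p$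 be the $L^p(\mathbb R)$ norm of $$x\mapsto\sup\Big\{\Big|\sum_{j=0}^3(-1)^{3-j}\tbinom3j g(t+jh)\Big|:\ t,\,t+3h\in[x-\tfrac{3\delta}2,x+\tfrac{3\delta}2]\Big\}.$$ If $f\in\Lambda_2^p$ and $\tau_3(f^{(i)};\delta)_p=O(\delta^\alpha)$ as $\delta\to0+$ for $i=0,1$, then the series $S_W^\kappa f$ converges at every point for every $W\ge1$, $S_W^\kappa f-f\in L^p(\mathbb R)$ for all large $W$, and $$\|S_W^\kappa f-f\|_{L^p(\mathbb R)}=O(W^{-\alpha})\qquad(W\to\infty).$$ -/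

import Mathlib

open MeasureTheory Filter Topology Asymptotics
open scoped ENNReal

noncomputable section

/-- The B-splines: `Q₁` is the indicator of `[0,1)` and `Q_{m+1} = Q_m * Q₁` (convolution).
The index starts at `1`; the value at index `0` is a dummy. -/
def bspline : ℕ → ℝ → ℝ
  | 0 => fun _ => 0
  | 1 => Set.indicator (Set.Ico (0 : ℝ) 1) (fun _ => 1)
  | (m + 2) => fun t =>
      ∫ y : ℝ, bspline (m + 1) (t - y) * Set.indicator (Set.Ico (0 : ℝ) 1) (fun _ => (1 : ℝ)) y

/-- The cubic B-spline `Q₄`, as a complex-valued function on the real line. -/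
def cubicBSpline (t : ℝ) : ℂ := (bspline 4 t : ℂ)

/-! ### Shift-invariant spaces and complete interpolation sets -/

/-- The shift-invariant space `V(φ)`. -/
def shiftInvariantSpace (φ : ℝ → ℂ) : Set (ℝ → ℂ) :=
  {f | MemLp f 2 volume ∧ ∃ c : ℤ → ℂ, Memℓp c 2 ∧
    ∀ x : ℝ, HasSum (fun k : ℤ => c k * φ (x - (k : ℝ))) (f x)}

/-- `φ` is a stable generator: its integer translates form a Riesz basis of `V(φ)`. -/
def IsStableGenerator (φ : ℝ → ℂ) : Prop :=
  MemLp φ 2 volume ∧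
  closure (Submodule.span ℂ {g : Lp ℂ 2 (volume : Measure ℝ) |
      ∃ n : ℤ, g =ᵐ[volume] fun x => φ (x - (n : ℝ))} : Set (Lp ℂ 2 (volume : Measure ℝ))) =
    {g : Lp ℂ 2 (volume : Measure ℝ) | ∃ f ∈ shiftInvariantSpace φ, g =ᵐ[volume] f} ∧
  ∃ A B : ℝ, 0 < A ∧ A ≤ B ∧ ∀ d : ℤ → ℂ, Memℓp d 2 →
    ENNReal.ofReal (A * ∑' n : ℤ, ‖d n‖ ^ 2) ≤
        eLpNorm (fun x : ℝ => ∑' n : ℤ, d n * φ (x - (n : ℝ))) 2 volume ^ 2 ∧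
      eLpNorm (fun x : ℝ => ∑' n : ℤ, d n * φ (x - (n : ℝ))) 2 volume ^ 2 ≤
        ENNReal.ofReal (B * ∑' n : ℤ, ‖d n‖ ^ 2)

/-- `φ` is an `s`-regular stable generator. -/
def IsRegularStableGenerator (s : ℕ) (φ : ℝ → ℂ) : Prop :=
  IsStableGenerator φ ∧ ContDiff ℝ s φ ∧
  ∃ ε : ℝ, 0 < ε ∧ ∀ i ≤ s,
    iteratedDeriv i φ =O[atTop ⊔ atBot] fun t : ℝ => |t| ^ (-(1 / 2 : ℝ) - ε)

/-- `{x n}` is a set of uniqueness of order `s` for `V(φ)`. -/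
def IsUniquenessSet (φ : ℝ → ℂ) (s : ℕ) (x : ℤ → ℝ) : Prop :=
  ∀ f ∈ shiftInvariantSpace φ,
    (∀ n : ℤ, ∀ i : Fin (s + 1), iteratedDeriv i f (x n) = 0) → f = 0

/-- `{x n}` is a set of interpolation of order `s` for `V(φ)`. -/
def IsInterpolationSet (φ : ℝ → ℂ) (s : ℕ) (x : ℤ → ℝ) : Prop :=
  ∀ c : ℤ → Fin (s + 1) → ℂ, Summable (fun n : ℤ => ∑ i, ‖c n i‖ ^ 2) →
    ∃ f ∈ shiftInvariantSpace φ,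
      ∀ n : ℤ, ∀ i : Fin (s + 1), iteratedDeriv i f (x n) = c n i

/-- `{x n}` is a complete interpolation set of order `s` for `V(φ)`; the notion is reserved for
`s`-regular stable generators. -/
def IsCompleteInterpolationSet (φ : ℝ → ℂ) (s : ℕ) (x : ℤ → ℝ) : Prop :=
  IsRegularStableGenerator s φ ∧ IsUniquenessSet φ s x ∧ IsInterpolationSet φ s x

/-! ### The symbol, the reconstruction functions and the sampling operator of `κ = (φ, a, ρ)` -/

/-- The symbol `Ψ_κ(t)`, with entries `∑ₖ φ^{(i)}(a + ρ k - j) e^{2πikt}`. -/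
def symbolMatrix (φ : ℝ → ℂ) (a : ℝ) (ρ : ℕ) (t : ℝ) : Matrix (Fin ρ) (Fin ρ) ℂ :=
  Matrix.of fun i j => ∑' k : ℤ,
    iteratedDeriv i φ (a + (ρ : ℝ) * (k : ℝ) - ((j : ℕ) : ℝ)) *
      Complex.exp (2 * Real.pi * Complex.I * (k : ℂ) * (t : ℂ))

/-- The `v`-th Fourier coefficient of the `(j, i)` entry of `Ψ_κ⁻¹`. -/
def invSymbolCoeff (φ : ℝ → ℂ) (a : ℝ) (ρ : ℕ) (j i : Fin ρ) (v : ℤ) : ℂ :=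
  ∫ t in (0 : ℝ)..1,
    Complex.exp (-(2 * Real.pi * Complex.I * (v : ℂ) * (t : ℂ))) * (symbolMatrix φ a ρ t)⁻¹ j i

/-- The reconstruction function `Θ_{i,κ}`. -/
def reconstructionFun (φ : ℝ → ℂ) (a : ℝ) (ρ : ℕ) (i : Fin ρ) (t : ℝ) : ℂ :=
  ∑' v : ℤ, ∑ j : Fin ρ,
    invSymbolCoeff φ a ρ j i v * φ (t - (ρ : ℝ) * (v : ℝ) - ((j : ℕ) : ℝ))

/-- The `l`-th term of the sampling series of `f` at `t`. -/
def samplingTerm (φ : ℝ → ℂ) (a : ℝ) (ρ : ℕ) (W : ℝ) (f : ℝ → ℂ) (t : ℝ) (l : ℤ) : ℂ :=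
  ∑ i : Fin ρ, (1 / (W : ℂ) ^ (i : ℕ)) *
    iteratedDeriv i f ((a + (ρ : ℝ) * (l : ℝ)) / W) *
      reconstructionFun φ a ρ i (W * t - (ρ : ℝ) * (l : ℝ))

/-- The sampling operator `S_W^κ`. -/
def samplingOperator (φ : ℝ → ℂ) (a : ℝ) (ρ : ℕ) (W : ℝ) (f : ℝ → ℂ) (t : ℝ) : ℂ :=
  ∑' l : ℤ, samplingTerm φ a ρ W f t l

/-- The operators `S_W^κ`, `W ≥ 1`, reproduce all polynomials of degree at most `r`
(the sampling series converging at every point). -/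
def ReproducesPolynomials (φ : ℝ → ℂ) (a : ℝ) (ρ r : ℕ) : Prop :=
  ∀ W : ℝ, 1 ≤ W → ∀ P : Polynomial ℂ, P.natDegree ≤ r → ∀ t : ℝ,
    Summable (samplingTerm φ a ρ W (fun x : ℝ => P.eval (x : ℂ)) t) ∧
      samplingOperator φ a ρ W (fun x : ℝ => P.eval (x : ℂ)) t = P.eval (t : ℂ)

/-! ### The averaged modulus of smoothness and the space `Λ_ρ^p` -/

/-- The local modulus of smoothness `ω_r(f; x; δ)`, with values in `[0, ∞]`. -/
def localModulus (r : ℕ) (f : ℝ → ℂ) (x δ : ℝ) : ℝ≥0∞ :=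
  ⨆ (t : ℝ) (h : ℝ)
    (_ : t ∈ Set.Icc (x - r * δ / 2) (x + r * δ / 2))
    (_ : t + r * h ∈ Set.Icc (x - r * δ / 2) (x + r * δ / 2)),
    ‖((fwdDiff h)^[r] f) t‖ₑ

/-- The `L^p`-averaged modulus of smoothness `τ_r(f; δ)_p`, with values in `[0, ∞]`. -/
def tauModulus (r : ℕ) (f : ℝ → ℂ) (δ p : ℝ) : ℝ≥0∞ :=
  eLpNorm (fun x : ℝ => localModulus r f x δ) (ENNReal.ofReal p) volume

/-- Admissible sequences: consecutive gaps bounded above, and below by a positive constant. -/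
def IsAdmissible (x : ℤ → ℝ) : Prop :=
  ∃ lo hi : ℝ, 0 < lo ∧ ∀ j : ℤ, lo ≤ x j - x (j - 1) ∧ x j - x (j - 1) ≤ hi

/-- The space `Λ_ρ^p`: bounded measurable functions which, for every admissible sequence `x`, are
`ρ - 1` times differentiable at its points, with finite discrete norm
`(∑_j ∑_{i<ρ} |f^{(i)}(x_j)|^p (x_j - x_{j-1}))^{1/p}`. -/
def lambdaSpace (ρ : ℕ) (p : ℝ) : Set (ℝ → ℂ) :=
  {f | Measurable f ∧ (∃ M : ℝ, ∀ t, ‖f t‖ ≤ M) ∧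
    ∀ x : ℤ → ℝ, IsAdmissible x →
      (∀ j : ℤ, ∀ i : ℕ, i + 1 < ρ → DifferentiableAt ℝ (iteratedDeriv i f) (x j)) ∧
      Summable fun j : ℤ =>
        ∑ i : Fin ρ, ‖iteratedDeriv i f (x j)‖ ^ p * (x j - x (j - 1))}

/-- The ratio `r = (19 - 4√22)/3`. -/
def decayRatio : ℝ := (19 - 4 * √22) / 3

end

/-! With w = e^{2πit}, the half-integer values of Q₄ and Q₄' make Ψ an explicit matrix of
polynomials in w, and det Ψ = (w²/64)(-3w⁻¹ + 38 - 3w). The last factor is inverted by the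
absolutely convergent series `greenSymbol`. Its coefficients `greenCoeff v` are a multiple of
r^{|v|}, where r is the root of 3r² - 38r + 3 in (0,1). This gives the nonvanishing of the
determinant, the matrix Ψ⁻¹, and its Fourier coefficients `dualCoeff`.

Read on coefficients, Ψ⁻¹Ψ = 1 says that Q₄(t) and Q₄(t + 1) are rebuilt from their own samples
(`reconstruction_even`, `reconstruction_odd`). Shifting by 2l and summing,
`hasSum_sampling_splineSeries` recovers every series Σ c_k Q₄(· - k) with |c_k| ≤ A·2^{|k|}; this
growth is harmless because 4r < 1. Square summable coefficients give the sampling formula and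
uniqueness. The Marsden coefficients of cubic polynomials, which grow polynomially, give
reproduction at scale one, and dilation gives it for all W. Conversely ΨΨ⁻¹ = 1 solves the
interpolation problem, and the coefficients found are in ℓ² by a discrete Young inequality. The
Riesz bounds are local: four translates are active on a unit cell, and integration against a fixed
cubic over that cell returns one coefficient.

For the order of approximation put F(x) = f(x/W). For t in the k-th cell, subtract the cubic P that
interpolates F at the nodes k, ..., k + 3. Since the operator reproduces P, the error for F is the
error for e = F - P. As e vanishes at four consecutive nodes, four summations by parts with weight
r^{|l-k|} bound its weighted node values by its fourth differences (`geomSum_le_fwdDiff_four`). By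
the mean value inequality these are bounded by third differences of e', which are those of F'. Third
differences of e' also control e' at the nodes (`norm_mul_deriv_le`) and e between them
(`norm_le_of_lattice_bound`). The result, `exists_sampling_error_bound`, bounds the pointwise error
by C Σ_l r^{|l-k|} ω_l with local moduli ω_l of F'. Taking the L^p norm with Young's inequality
yields C τ₃(f'; 66/W)_p. -/

/-! ### The cubic B-spline -/

/-- The truncated power `t₊ⁿ`. -/
noncomputable def truncPow (n : ℕ) (t : ℝ) : ℝ := (max t 0) ^ n

theorem truncPow_of_nonneg {n : ℕ} {t : ℝ} (ht : 0 ≤ t) : truncPow n t = t ^ n := by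
  rw [truncPow, max_eq_left ht]

/-- The exponent is positive because `truncPow 0` is identically one (`0 ^ 0 = 1`), not a step
function. -/
theorem truncPow_of_nonpos {n : ℕ} {t : ℝ} (ht : t ≤ 0) : truncPow (n + 1) t = 0 := by
  rw [truncPow, max_eq_right ht, zero_pow (Nat.succ_ne_zero n)]

theorem continuous_truncPow (n : ℕ) : Continuous (truncPow n) := by
  unfold truncPow; fun_prop

/-- Away from 0 this is the power rule; at 0 the bound |t₊ⁿ⁺²| ≤ |t|ⁿ⁺² = o(t) gives derivative
zero, which is why the exponent starts at 2. -/
theorem hasDerivAt_truncPow (n : ℕ) (t : ℝ) :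
    HasDerivAt (truncPow (n + 2)) ((n + 2) * truncPow (n + 1) t) t := by
  rcases lt_trichotomy t 0 with ht | ht | ht
  · rw [truncPow_of_nonpos ht.le, mul_zero]
    refine (hasDerivAt_const t (0 : ℝ)).congr_of_eventuallyEq ?_
    filter_upwards [gt_mem_nhds ht] with s hs
    exact truncPow_of_nonpos hs.le
  · subst ht
    rw [truncPow_of_nonpos le_rfl, mul_zero]
    rw [hasDerivAt_iff_isLittleO]
    simp only [truncPow_of_nonpos (n := n + 1) le_rfl, sub_zero, smul_eq_mul, mul_zero]
    refine (IsBigO.of_bound 1 ?_ :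
      truncPow (n + 2) =O[𝓝 0] fun x : ℝ => x ^ (n + 2)).trans_isLittleO ?_
    · refine Eventually.of_forall fun x => ?_
      rw [one_mul, truncPow, norm_pow, norm_pow]
      refine pow_le_pow_left₀ (norm_nonneg _) ?_ _
      rw [Real.norm_eq_abs, Real.norm_eq_abs, abs_of_nonneg (le_max_right _ _)]
      exact max_le (le_abs_self x) (abs_nonneg x)
    · exact isLittleO_pow_id (by omega)
  · rw [truncPow_of_nonneg ht.le]
    have := hasDerivAt_pow (n + 2) t
    refine HasDerivAt.congr_of_eventuallyEq (by simpa using this) ?_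
    filter_upwards [lt_mem_nhds ht] with s hs
    exact truncPow_of_nonneg hs.le

theorem integral_truncPow (n : ℕ) (a b : ℝ) :
    ∫ x in a..b, truncPow (n + 1) x = (truncPow (n + 2) b - truncPow (n + 2) a) / (n + 2) := by
  have h0 : ((n : ℝ) + 2) ≠ 0 := by positivity
  have := intervalIntegral.integral_eq_sub_of_hasDerivAt
    (f := fun x => truncPow (n + 2) x / (n + 2)) (f' := truncPow (n + 1)) (a := a) (b := b)
    (fun x _ => by
      have := (hasDerivAt_truncPow n x).div_const ((n : ℝ) + 2)
      rwa [mul_div_cancel_left₀ _ h0] at this)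
    ((continuous_truncPow _).intervalIntegrable _ _)
  rw [this]; ring

theorem bspline_succ (m : ℕ) (t : ℝ) :
    bspline (m + 2) t = ∫ x in (t - 1)..t, bspline (m + 1) x := by
  rw [bspline]
  have : (fun y : ℝ => bspline (m + 1) (t - y) *
      Set.indicator (Set.Ico (0 : ℝ) 1) (fun _ => (1 : ℝ)) y) =
      Set.indicator (Set.Ico (0 : ℝ) 1) (fun y => bspline (m + 1) (t - y)) := by
    ext y
    by_cases hy : y ∈ Set.Ico (0 : ℝ) 1 <;> simp [hy]
  beta_reduce
  rw [this, integral_indicator measurableSet_Ico, integral_Ico_eq_integral_Ioc,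
    ← intervalIntegral.integral_of_le zero_le_one, intervalIntegral.integral_comp_sub_left
      (fun x => bspline (m + 1) x) t, sub_zero]

theorem bspline_two (t : ℝ) :
    bspline 2 t = truncPow 1 t - 2 * truncPow 1 (t - 1) + truncPow 1 (t - 2) := by
  -- The hat function is the length of the overlap of [0, 1) with (t - 1, t].
  have h1 : bspline 2 t = max 0 (min 1 t - max 0 (t - 1)) := by
    rw [bspline_succ 0, intervalIntegral.integral_of_le (by linarith)]
    simp only [bspline]
    rw [integral_indicator measurableSet_Ico, Measure.restrict_restrict measurableSet_Ico,
      integral_const, smul_eq_mul, mul_one, measureReal_restrict_apply_univ,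
      measureReal_congr ((Ico_ae_eq_Ioc (μ := volume) (a := (0 : ℝ)) (b := 1)).inter
        (ae_eq_refl (Set.Ioc (t - 1) t))), Set.Ioc_inter_Ioc, Real.volume_real_Ioc]
    exact max_comm _ _
  rw [h1]
  simp only [truncPow, pow_one]
  rcases le_total t 0 with a | a
  · rw [min_eq_right (by linarith), max_eq_left (by linarith : t - 1 ≤ 0), max_eq_right a,
      max_eq_right (by linarith : t - 1 ≤ 0), max_eq_right (by linarith : t - 2 ≤ 0), max_eq_left]
      <;> linarith
  rcases le_total t 1 with b | b
  · rw [min_eq_right (by linarith), max_eq_left (by linarith : t - 1 ≤ 0), max_eq_left a,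
      max_eq_right (by linarith : t - 1 ≤ 0), max_eq_right (by linarith : t - 2 ≤ 0), max_eq_right]
      <;> linarith
  rcases le_total t 2 with c | c
  · rw [min_eq_left (by linarith), max_eq_right (by linarith : 0 ≤ t - 1), max_eq_left a,
      max_eq_left (by linarith : 0 ≤ t - 1), max_eq_right (by linarith : t - 2 ≤ 0), max_eq_right]
      <;> linarith
  · rw [min_eq_left (by linarith), max_eq_right (by linarith : 0 ≤ t - 1), max_eq_left a,
      max_eq_left (by linarith : 0 ≤ t - 1), max_eq_left (by linarith : 0 ≤ t - 2), max_eq_left]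
      <;> linarith

theorem integral_truncPow_shift (n : ℕ) (t a : ℝ) :
    ∫ x in (t - 1)..t, truncPow (n + 1) (x - a) =
      (truncPow (n + 2) (t - a) - truncPow (n + 2) (t - 1 - a)) / (n + 2) := by
  rw [intervalIntegral.integral_comp_sub_right (fun x => truncPow (n + 1) x) a, integral_truncPow]

theorem bspline_three (t : ℝ) :
    bspline 3 t = (truncPow 2 t - 3 * truncPow 2 (t - 1) + 3 * truncPow 2 (t - 2)
      - truncPow 2 (t - 3)) / 2 := by
  have hc : ∀ a : ℝ, IntervalIntegrable (fun x => truncPow 1 (x - a)) volume (t - 1) t :=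
    fun a => ((continuous_truncPow 1).comp (by fun_prop)).intervalIntegrable _ _
  rw [bspline_succ 1]
  simp only [Nat.reduceAdd, bspline_two]
  have h0 := hc 0
  simp only [sub_zero] at h0
  have i0 := integral_truncPow_shift 0 t 0
  simp only [sub_zero, zero_add] at i0
  rw [intervalIntegral.integral_add (h0.sub ((hc 1).const_mul 2)) (hc 2),
    intervalIntegral.integral_sub h0 ((hc 1).const_mul 2), intervalIntegral.integral_const_mul,
    i0, integral_truncPow_shift 0 t 1, integral_truncPow_shift 0 t 2]
  rw [show t - 1 - 1 = t - 2 by ring, show t - 1 - 2 = t - 3 by ring]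
  norm_num
  ring

theorem bspline_four (t : ℝ) :
    bspline 4 t = (truncPow 3 t - 4 * truncPow 3 (t - 1) + 6 * truncPow 3 (t - 2)
      - 4 * truncPow 3 (t - 3) + truncPow 3 (t - 4)) / 6 := by
  have hc : ∀ a : ℝ, IntervalIntegrable (fun x => truncPow 2 (x - a)) volume (t - 1) t :=
    fun a => ((continuous_truncPow 2).comp (by fun_prop)).intervalIntegrable _ _
  rw [bspline_succ 2]
  simp only [Nat.reduceAdd, bspline_three]
  have h0 := hc 0
  simp only [sub_zero] at h0
  have i0 := integral_truncPow_shift 1 t 0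
  simp only [sub_zero, Nat.reduceAdd] at i0
  rw [intervalIntegral.integral_div, intervalIntegral.integral_sub
      ((h0.sub ((hc 1).const_mul 3)).add ((hc 2).const_mul 3)) (hc 3),
    intervalIntegral.integral_add (h0.sub ((hc 1).const_mul 3)) ((hc 2).const_mul 3),
    intervalIntegral.integral_sub h0 ((hc 1).const_mul 3), intervalIntegral.integral_const_mul,
    intervalIntegral.integral_const_mul,
    i0, integral_truncPow_shift 1 t 1, integral_truncPow_shift 1 t 2, integral_truncPow_shift 1 t 3]
  rw [show t - 1 - 1 = t - 2 by ring, show t - 1 - 2 = t - 3 by ring,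
    show t - 1 - 3 = t - 4 by ring]
  norm_num
  ring

/-- The derivative of the cubic B-spline. -/
noncomputable def cubicBSplineDeriv (t : ℝ) : ℝ :=
  (truncPow 2 t - 4 * truncPow 2 (t - 1) + 6 * truncPow 2 (t - 2)
      - 4 * truncPow 2 (t - 3) + truncPow 2 (t - 4)) / 2

theorem continuous_cubicBSplineDeriv : Continuous cubicBSplineDeriv := by
  have := continuous_truncPow 2
  unfold cubicBSplineDeriv
  fun_prop

theorem hasDerivAt_bspline_four (t : ℝ) : HasDerivAt (bspline 4) (cubicBSplineDeriv t) t := by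
  have h : ∀ a : ℝ, HasDerivAt (fun x => truncPow 3 (x - a)) (3 * truncPow 2 (t - a)) t := by
    intro a
    have := (hasDerivAt_truncPow 1 (t - a)).comp_sub_const t a
    norm_num at this
    exact this
  have h0 := h 0
  simp only [sub_zero] at h0
  have := ((((h0.sub ((h 1).const_mul 4)).add ((h 2).const_mul 6)).sub ((h 3).const_mul 4)).add
    (h 4)).div_const 6
  rw [funext bspline_four]
  refine this.congr_deriv ?_
  rw [cubicBSplineDeriv]
  ring

theorem hasDerivAt_cubicBSpline (t : ℝ) :
    HasDerivAt cubicBSpline (cubicBSplineDeriv t : ℂ) t :=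
  (hasDerivAt_bspline_four t).ofReal_comp

theorem deriv_cubicBSpline : deriv cubicBSpline = fun t => (cubicBSplineDeriv t : ℂ) :=
  funext fun t => (hasDerivAt_cubicBSpline t).deriv

theorem continuous_cubicBSpline : Continuous cubicBSpline :=
  continuous_iff_continuousAt.2 fun t => (hasDerivAt_cubicBSpline t).continuousAt

theorem contDiff_cubicBSpline : ContDiff ℝ 1 cubicBSpline := by
  rw [contDiff_one_iff_deriv]
  refine ⟨fun t => (hasDerivAt_cubicBSpline t).differentiableAt, ?_⟩
  rw [deriv_cubicBSpline]
  exact Complex.continuous_ofReal.comp continuous_cubicBSplineDeriv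

theorem cubicBSpline_of_nonpos {t : ℝ} (ht : t ≤ 0) : cubicBSpline t = 0 := by
  rw [cubicBSpline, bspline_four, truncPow_of_nonpos ht, truncPow_of_nonpos (by linarith),
    truncPow_of_nonpos (by linarith), truncPow_of_nonpos (by linarith),
    truncPow_of_nonpos (by linarith)]
  norm_num

theorem cubicBSpline_of_four_le {t : ℝ} (ht : 4 ≤ t) : cubicBSpline t = 0 := by
  rw [cubicBSpline, bspline_four, truncPow_of_nonneg (by linarith),
    truncPow_of_nonneg (by linarith), truncPow_of_nonneg (by linarith),
    truncPow_of_nonneg (by linarith), truncPow_of_nonneg (by linarith)]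
  rw [Complex.ofReal_eq_zero]
  ring

theorem cubicBSpline_piece_zero {u : ℝ} (h0 : 0 ≤ u) (h1 : u ≤ 1) :
    cubicBSpline u = ((u ^ 3 / 6 : ℝ) : ℂ) := by
  rw [cubicBSpline, bspline_four, truncPow_of_nonneg h0, truncPow_of_nonpos (by linarith),
    truncPow_of_nonpos (by linarith), truncPow_of_nonpos (by linarith),
    truncPow_of_nonpos (by linarith)]
  congr 1; ring

theorem cubicBSpline_piece_one {u : ℝ} (h0 : 0 ≤ u) (h1 : u ≤ 1) :
    cubicBSpline (u + 1) = (((-3 * u ^ 3 + 3 * u ^ 2 + 3 * u + 1) / 6 : ℝ) : ℂ) := by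
  rw [cubicBSpline, bspline_four, truncPow_of_nonneg (by linarith),
    truncPow_of_nonneg (by linarith),
    truncPow_of_nonpos (by linarith), truncPow_of_nonpos (by linarith),
    truncPow_of_nonpos (by linarith)]
  congr 1; ring

theorem cubicBSpline_piece_two {u : ℝ} (h0 : 0 ≤ u) (h1 : u ≤ 1) :
    cubicBSpline (u + 2) = (((3 * u ^ 3 - 6 * u ^ 2 + 4) / 6 : ℝ) : ℂ) := by
  rw [cubicBSpline, bspline_four, truncPow_of_nonneg (by linarith),
    truncPow_of_nonneg (by linarith), truncPow_of_nonneg (by linarith),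
    truncPow_of_nonpos (by linarith), truncPow_of_nonpos (by linarith)]
  congr 1; ring

theorem cubicBSpline_piece_three {u : ℝ} (h0 : 0 ≤ u) (h1 : u ≤ 1) :
    cubicBSpline (u + 3) = (((1 - u) ^ 3 / 6 : ℝ) : ℂ) := by
  rw [cubicBSpline, bspline_four, truncPow_of_nonneg (by linarith),
    truncPow_of_nonneg (by linarith), truncPow_of_nonneg (by linarith),
    truncPow_of_nonneg (by linarith), truncPow_of_nonpos (by linarith)]
  congr 1; ring

theorem norm_cubicBSpline_le_one (t : ℝ) : ‖cubicBSpline t‖ ≤ 1 := by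
  rcases le_total t 0 with h | h
  · simp [cubicBSpline_of_nonpos h]
  rcases le_total 4 t with h' | h'
  · simp [cubicBSpline_of_four_le h']
  have aux : ∀ u : ℝ, 0 ≤ u → u ≤ 1 → ‖cubicBSpline u‖ ≤ 1 ∧ ‖cubicBSpline (u + 1)‖ ≤ 1 ∧
      ‖cubicBSpline (u + 2)‖ ≤ 1 ∧ ‖cubicBSpline (u + 3)‖ ≤ 1 := by
    intro u h0 h1
    have e2 : u ^ 2 ≤ 1 := by nlinarith
    have e3 : u ^ 3 ≤ u ^ 2 := by nlinarith [sq_nonneg u]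
    have e4 : 0 ≤ u ^ 3 := by positivity
    have e5 : 0 ≤ (1 - u) ^ 3 := pow_nonneg (by linarith) 3
    rw [cubicBSpline_piece_zero h0 h1, cubicBSpline_piece_one h0 h1, cubicBSpline_piece_two h0 h1,
      cubicBSpline_piece_three h0 h1]
    simp only [Complex.norm_real, Real.norm_eq_abs, abs_le]
    refine ⟨⟨by linarith, by linarith⟩, ⟨by nlinarith, by nlinarith⟩, ⟨by nlinarith, by nlinarith⟩,
      ⟨by linarith, by nlinarith⟩⟩
  rcases le_total t 1 with h1 | h1
  · exact (aux t h h1).1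
  rcases le_total t 2 with h2 | h2
  · have := (aux (t - 1) (by linarith) (by linarith)).2.1
    rwa [sub_add_cancel] at this
  rcases le_total t 3 with h3 | h3
  · have := (aux (t - 2) (by linarith) (by linarith)).2.2.1
    rwa [sub_add_cancel] at this
  · have := (aux (t - 3) (by linarith) (by linarith)).2.2.2
    rwa [sub_add_cancel] at this

/-- On a cell `[m, m + 1]` only four translates of the cubic B-spline are active. -/
theorem cubicBSpline_sub_eq_zero {m k : ℤ} {x : ℝ} (h0 : (m : ℝ) ≤ x) (h1 : x ≤ m + 1)
    (hk : k ∉ ({m, m - 1, m - 2, m - 3} : Finset ℤ)) : cubicBSpline (x - k) = 0 := by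
  simp only [Finset.mem_insert, Finset.mem_singleton, not_or] at hk
  rcases le_or_gt (m + 1) k with h | h
  · apply cubicBSpline_of_nonpos
    have : (m : ℝ) + 1 ≤ k := by exact_mod_cast h
    linarith
  · apply cubicBSpline_of_four_le
    have : k ≤ m - 4 := by omega
    have : (k : ℝ) ≤ m - 4 := by exact_mod_cast this
    linarith

theorem hasSum_cubicBSpline_cell (c : ℤ → ℂ) {m : ℤ} {x : ℝ} (h0 : (m : ℝ) ≤ x)
    (h1 : x ≤ m + 1) :
    HasSum (fun k : ℤ => c k * cubicBSpline (x - k))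
      (c m * cubicBSpline (x - m) + c (m - 1) * cubicBSpline (x - m + 1) +
        c (m - 2) * cubicBSpline (x - m + 2) + c (m - 3) * cubicBSpline (x - m + 3)) := by
  have := hasSum_sum_of_ne_finset_zero (L := SummationFilter.unconditional ℤ) (f := fun k : ℤ => c k * cubicBSpline (x - k))
    (s := ({m, m - 1, m - 2, m - 3} : Finset ℤ))
    (fun k hk => by rw [cubicBSpline_sub_eq_zero h0 h1 hk, mul_zero])
  rw [Finset.sum_insert (by simp only [Finset.mem_insert, Finset.mem_singleton]; omega),
    Finset.sum_insert (by simp only [Finset.mem_insert, Finset.mem_singleton]; omega),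
    Finset.sum_insert (by simp only [Finset.mem_singleton]; omega), Finset.sum_singleton] at this
  push_cast at this
  convert this using 1
  rw [show x - ((m : ℝ) - 1) = x - m + 1 by ring, show x - ((m : ℝ) - 2) = x - m + 2 by ring,
    show x - ((m : ℝ) - 3) = x - m + 3 by ring]
  ring

theorem summable_cubicBSpline (c : ℤ → ℂ) (x : ℝ) :
    Summable (fun k : ℤ => c k * cubicBSpline (x - k)) :=
  (hasSum_cubicBSpline_cell c (Int.floor_le x) (Int.lt_floor_add_one x).le).summable

theorem cubicBSpline_half : cubicBSpline (1 / 2) = 1 / 48 := by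
  rw [cubicBSpline_piece_zero (by norm_num) (by norm_num)]; push_cast; norm_num

theorem cubicBSpline_three_halves : cubicBSpline (3 / 2) = 23 / 48 := by
  rw [show (3 / 2 : ℝ) = 1 / 2 + 1 by norm_num,
    cubicBSpline_piece_one (by norm_num) (by norm_num)]; push_cast; norm_num

theorem cubicBSpline_five_halves : cubicBSpline (5 / 2) = 23 / 48 := by
  rw [show (5 / 2 : ℝ) = 1 / 2 + 2 by norm_num,
    cubicBSpline_piece_two (by norm_num) (by norm_num)]; push_cast; norm_num

theorem cubicBSpline_seven_halves : cubicBSpline (7 / 2) = 1 / 48 := by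
  rw [show (7 / 2 : ℝ) = 1 / 2 + 3 by norm_num,
    cubicBSpline_piece_three (by norm_num) (by norm_num)]; push_cast; norm_num

theorem cubicBSplineDeriv_half : cubicBSplineDeriv (1 / 2) = 1 / 8 := by
  norm_num [cubicBSplineDeriv, truncPow, max_def]

theorem cubicBSplineDeriv_three_halves : cubicBSplineDeriv (3 / 2) = 5 / 8 := by
  norm_num [cubicBSplineDeriv, truncPow, max_def]

theorem cubicBSplineDeriv_five_halves : cubicBSplineDeriv (5 / 2) = -5 / 8 := by
  norm_num [cubicBSplineDeriv, truncPow, max_def]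

theorem cubicBSplineDeriv_seven_halves : cubicBSplineDeriv (7 / 2) = -1 / 8 := by
  norm_num [cubicBSplineDeriv, truncPow, max_def]

theorem cubicBSplineDeriv_of_nonpos {t : ℝ} (ht : t ≤ 0) : cubicBSplineDeriv t = 0 := by
  rw [cubicBSplineDeriv, truncPow_of_nonpos ht, truncPow_of_nonpos (by linarith),
    truncPow_of_nonpos (by linarith), truncPow_of_nonpos (by linarith),
    truncPow_of_nonpos (by linarith)]
  norm_num

theorem cubicBSplineDeriv_of_four_le {t : ℝ} (ht : 4 ≤ t) : cubicBSplineDeriv t = 0 := by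
  rw [cubicBSplineDeriv, truncPow_of_nonneg (by linarith),
    truncPow_of_nonneg (by linarith), truncPow_of_nonneg (by linarith),
    truncPow_of_nonneg (by linarith), truncPow_of_nonneg (by linarith)]
  ring

/-! ### The symbol and its inverse -/

theorem decayRatio_pos : 0 < decayRatio := by
  have h : √22 < 19 / 4 := by rw [Real.sqrt_lt' (by norm_num)]; norm_num
  unfold decayRatio; linarith

/-- The margin matters: 4r < 1 is needed when coefficients growing like 4^{|l|} are summed against
r^{|l|}. -/
theorem decayRatio_lt : decayRatio < 1 / 12 := by
  have h : 75 / 16 < √22 := by rw [Real.lt_sqrt (by norm_num)]; norm_num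
  unfold decayRatio; linarith

theorem decayRatio_equation : 3 * decayRatio ^ 2 - 38 * decayRatio + 3 = 0 := by
  have h : √22 ^ 2 = 22 := Real.sq_sqrt (by norm_num)
  unfold decayRatio; linear_combination (16 / 3) * h

/-- The fundamental solution of `-3 g (v + 1) + 38 g v - 3 g (v - 1) = δ₀ v`. -/
noncomputable def greenCoeff (v : ℤ) : ℝ :=
  decayRatio / (3 * (1 - decayRatio ^ 2)) * decayRatio ^ v.natAbs

theorem one_sub_decayRatio_sq_pos : 0 < 1 - decayRatio ^ 2 := by
  nlinarith [decayRatio_pos, decayRatio_lt]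

/-- For v ≠ 0 the three indices have absolute values n, n + 1, n + 2 in some order, and the
quadratic equation of r annihilates the combination. At v = 0 the corner of r^{|v|} gives a nonzero
value, normalised to one by the prefactor. -/
theorem greenCoeff_recurrence (v : ℤ) :
    -3 * greenCoeff (v + 1) + 38 * greenCoeff v - 3 * greenCoeff (v - 1) =
      if v = 0 then 1 else 0 := by
  have h1 := one_sub_decayRatio_sq_pos.ne'
  have h2 := decayRatio_equation
  unfold greenCoeff
  split_ifs with hv
  · subst hv
    simp only [zero_add, zero_sub, Int.natAbs_neg, Int.natAbs_one, Int.natAbs_zero, pow_one,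
      pow_zero]
    field_simp
    linear_combination -h2
  · rcases lt_or_gt_of_ne hv with hv | hv
    · obtain ⟨n, rfl⟩ : ∃ n : ℕ, v = -((n : ℤ) + 1) := ⟨(-v - 1).toNat, by omega⟩
      rw [show (-((n : ℤ) + 1) + 1).natAbs = n by omega,
        show (-((n : ℤ) + 1)).natAbs = n + 1 by omega,
        show (-((n : ℤ) + 1) - 1).natAbs = n + 2 by omega]
      linear_combination -(decayRatio / (3 * (1 - decayRatio ^ 2)) * decayRatio ^ n) * h2
    · obtain ⟨n, rfl⟩ : ∃ n : ℕ, v = (n : ℤ) + 1 := ⟨(v - 1).toNat, by omega⟩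
      rw [show ((n : ℤ) + 1 + 1).natAbs = n + 2 by omega,
        show ((n : ℤ) + 1).natAbs = n + 1 by omega,
        show ((n : ℤ) + 1 - 1).natAbs = n by omega]
      linear_combination -(decayRatio / (3 * (1 - decayRatio ^ 2)) * decayRatio ^ n) * h2

theorem greenCoeff_nonneg (v : ℤ) : 0 ≤ greenCoeff v :=
  mul_nonneg (div_nonneg decayRatio_pos.le (by linarith [one_sub_decayRatio_sq_pos]))
    (pow_nonneg decayRatio_pos.le _)

theorem summable_pow_natAbs {q : ℝ} (h0 : 0 ≤ q) (h1 : q < 1) :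
    Summable fun v : ℤ => q ^ v.natAbs := by
  rw [summable_int_iff_summable_nat_and_neg]
  simpa using summable_geometric_of_lt_one h0 h1

theorem summable_greenCoeff : Summable greenCoeff :=
  (summable_pow_natAbs decayRatio_pos.le (by linarith [decayRatio_lt])).mul_left _

/-! ### Characters and the Fourier series that inverts the determinant factor. -/

/-- The character `t ↦ e^{2πikt}`. -/
noncomputable def expChar (k : ℤ) (t : ℝ) : ℂ :=
  Complex.exp (2 * Real.pi * Complex.I * (k : ℂ) * (t : ℂ))

theorem expChar_eq_zpow (k : ℤ) (t : ℝ) : expChar k t = expChar 1 t ^ k := by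
  rw [expChar, expChar, ← Complex.exp_int_mul]; congr 1; push_cast; ring

theorem expChar_add (k l : ℤ) (t : ℝ) : expChar (k + l) t = expChar k t * expChar l t := by
  rw [expChar, expChar, expChar, ← Complex.exp_add]; congr 1; push_cast; ring

theorem norm_expChar (k : ℤ) (t : ℝ) : ‖expChar k t‖ = 1 := by
  rw [expChar, show 2 * Real.pi * Complex.I * (k : ℂ) * (t : ℂ) =
    ((2 * Real.pi * k * t : ℝ) : ℂ) * Complex.I by push_cast; ring]
  exact Complex.norm_exp_ofReal_mul_I _

theorem continuous_expChar (k : ℤ) : Continuous (expChar k) := by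
  unfold expChar; fun_prop

theorem expChar_apply_ne_zero (k : ℤ) (t : ℝ) : expChar k t ≠ 0 := Complex.exp_ne_zero _

theorem expChar_zero (t : ℝ) : expChar 0 t = 1 := by simp [expChar]

theorem integral_expChar (k : ℤ) :
    ∫ t in (0 : ℝ)..1, expChar k t = if k = 0 then 1 else 0 := by
  split_ifs with hk
  · subst hk; simp [expChar_zero]
  · have hc : 2 * Real.pi * Complex.I * (k : ℂ) ≠ 0 := by
      simp [Real.pi_ne_zero, Complex.I_ne_zero, hk]
    simp only [expChar]
    rw [integral_exp_mul_complex hc]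
    have := Complex.exp_int_mul_two_pi_mul_I k
    rw [Complex.ofReal_one, mul_one, mul_comm, this]
    simp

/-- The periodic function with Fourier coefficients `greenCoeff`. -/
noncomputable def greenSymbol (t : ℝ) : ℂ := ∑' v : ℤ, (greenCoeff v : ℂ) * expChar v t

theorem norm_greenCoeff_mul_expChar (v : ℤ) (t : ℝ) :
    ‖(greenCoeff v : ℂ) * expChar v t‖ = greenCoeff v := by
  rw [norm_mul, norm_expChar, mul_one, Complex.norm_real, Real.norm_of_nonneg (greenCoeff_nonneg v)]

theorem hasSum_greenSymbol (t : ℝ) :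
    HasSum (fun v : ℤ => (greenCoeff v : ℂ) * expChar v t) (greenSymbol t) :=
  (Summable.of_norm_bounded summable_greenCoeff
    fun v => (norm_greenCoeff_mul_expChar v t).le).hasSum

theorem continuous_greenSymbol : Continuous greenSymbol :=
  continuous_tsum (fun v => continuous_const.mul (continuous_expChar v)) summable_greenCoeff
    fun v t => (norm_greenCoeff_mul_expChar v t).le

/-- Multiplication by w^{±1} shifts Fourier coefficients, so the product has coefficients given by
the recurrence, that is δ₀. -/
theorem greenSymbol_equation (t : ℝ) :
    (-3 * (expChar 1 t)⁻¹ + 38 - 3 * expChar 1 t) * greenSymbol t = 1 := by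
  have hw := expChar_apply_ne_zero 1 t
  have key : ∀ k : ℤ, HasSum (fun v : ℤ => (greenCoeff (v + k) : ℂ) * expChar v t)
      (expChar (-k) t * greenSymbol t) := by
    intro k
    have h := ((Equiv.addRight k).hasSum_iff.2 (hasSum_greenSymbol t)).mul_left (expChar (-k) t)
    refine (congrArg (fun f => HasSum f _) (funext fun v => ?_)).mp h
    change expChar (-k) t * ((greenCoeff (v + k) : ℂ) * expChar (v + k) t) = _
    rw [show expChar v t = expChar (-k) t * expChar (v + k) t by rw [← expChar_add]; congr 1; ring]
    ring
  have h := (((key 1).mul_left (-3)).add ((key 0).mul_left 38)).sub ((key (-1)).mul_left 3)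
  have h2 : HasSum (fun v : ℤ => if v = 0 then (1 : ℂ) else 0) 1 := hasSum_ite_eq 0 1
  have h3 : (fun v : ℤ => if v = 0 then (1 : ℂ) else 0) = fun v =>
      -3 * ((greenCoeff (v + 1) : ℂ) * expChar v t) + 38 * ((greenCoeff (v + 0) : ℂ) * expChar v t)
        - 3 * ((greenCoeff (v + -1) : ℂ) * expChar v t) := by
    ext v
    have := congrArg (fun x : ℝ => (x : ℂ)) (greenCoeff_recurrence v)
    rw [apply_ite (fun x : ℝ => (x : ℂ))] at this
    simp only [Complex.ofReal_sub, Complex.ofReal_add, Complex.ofReal_mul, Complex.ofReal_neg,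
      Complex.ofReal_ofNat, Complex.ofReal_one, Complex.ofReal_zero] at this
    rw [add_zero, ← sub_eq_add_neg]
    have e : (if v = 0 then (1 : ℂ) else 0) = (if v = 0 then (1 : ℂ) else 0) * expChar v t := by
      split_ifs with hv
      · rw [hv, expChar_zero, one_mul]
      · rw [zero_mul]
    rw [e, ← this]
    ring
  rw [h3] at h2
  have := h.unique h2
  rw [expChar_eq_zpow (-1), expChar_eq_zpow (-0), expChar_eq_zpow (- -1)] at this
  simp only [neg_zero, zpow_zero, neg_neg, zpow_one, zpow_neg, one_mul] at this
  rw [← this]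
  ring

/-- Absolute summability of `greenCoeff` permits termwise integration; orthogonality of characters
leaves one term. -/
theorem integral_expChar_mul_greenSymbol (v : ℤ) :
    ∫ t in (0 : ℝ)..1, expChar (-v) t * greenSymbol t = greenCoeff v := by
  have hs := intervalIntegral.hasSum_intervalIntegral_of_summable_norm (a := 0) (b := 1)
    (f := fun n : ℤ => (⟨fun t : ℝ => expChar (-v) t * ((greenCoeff n : ℂ) * expChar n t),
      (continuous_expChar _).mul (continuous_const.mul (continuous_expChar n))⟩ : C(ℝ, ℂ))) (by
    refine Summable.of_nonneg_of_le (fun _ => norm_nonneg _) (fun n => ?_) summable_greenCoeff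
    rw [ContinuousMap.norm_le _ (greenCoeff_nonneg n)]
    intro x
    simp only [ContinuousMap.restrict_apply, ContinuousMap.coe_mk]
    rw [norm_mul, norm_expChar, one_mul, norm_greenCoeff_mul_expChar])
  have h1 : ∀ n : ℤ, ∫ t in (0 : ℝ)..1, expChar (-v) t * ((greenCoeff n : ℂ) * expChar n t) =
      if n = v then (greenCoeff v : ℂ) else 0 := by
    intro n
    have : ∀ t : ℝ, expChar (-v) t * ((greenCoeff n : ℂ) * expChar n t) =
        greenCoeff n * expChar (n - v) t := by
      intro t
      rw [sub_eq_add_neg, expChar_add]; ring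
    simp only [this]
    rw [intervalIntegral.integral_const_mul, integral_expChar]
    by_cases h : n = v
    · simp [h]
    · simp [h, sub_eq_zero]
  simp only [ContinuousMap.coe_mk, h1] at hs
  have h2 : ∀ t : ℝ, ∑' n : ℤ, expChar (-v) t * ((greenCoeff n : ℂ) * expChar n t) =
      expChar (-v) t * greenSymbol t := fun t => tsum_mul_left
  simp only [h2] at hs
  exact hs.unique (hasSum_ite_eq v _)

theorem symbolMatrix_cubicBSpline (t : ℝ) :
    symbolMatrix cubicBSpline (1 / 2) 2 t =
      !![(1 + 23 * expChar 1 t) / 48, (23 * expChar 1 t + expChar 1 t ^ 2) / 48;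
         (1 - 5 * expChar 1 t) / 8, (5 * expChar 1 t - expChar 1 t ^ 2) / 8] := by
  -- The support (0, 4) contains 1/2 + 2k exactly for k = 0, 1, and 1/2 + 2k - 1 exactly for k = 1,
  -- 2, so each entry has two terms.
  have z0 : ∀ k : ℤ, k ∉ ({0, 1} : Finset ℤ) →
      (1 / 2 + 2 * (k : ℝ) ≤ 0 ∨ 4 ≤ 1 / 2 + 2 * (k : ℝ)) := by
    intro k hk
    simp only [Finset.mem_insert, Finset.mem_singleton, not_or] at hk
    rcases lt_or_ge k 0 with h | h
    · left
      have : (k : ℝ) ≤ -1 := by exact_mod_cast (by omega : k ≤ -1)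
      linarith
    · right
      have : (2 : ℝ) ≤ k := by exact_mod_cast (by omega : 2 ≤ k)
      linarith
  have z1 : ∀ k : ℤ, k ∉ ({1, 2} : Finset ℤ) →
      (1 / 2 + 2 * (k : ℝ) - 1 ≤ 0 ∨ 4 ≤ 1 / 2 + 2 * (k : ℝ) - 1) := by
    intro k hk
    simp only [Finset.mem_insert, Finset.mem_singleton, not_or] at hk
    rcases lt_or_ge k 1 with h | h
    · left
      have : (k : ℝ) ≤ 0 := by exact_mod_cast (by omega : k ≤ 0)
      linarith
    · right
      have : (3 : ℝ) ≤ k := by exact_mod_cast (by omega : 3 ≤ k)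
      linarith
  have q : ∀ x : ℝ, x ≤ 0 ∨ 4 ≤ x → cubicBSpline x = 0 := fun x hx =>
    hx.elim cubicBSpline_of_nonpos cubicBSpline_of_four_le
  have q' : ∀ x : ℝ, x ≤ 0 ∨ 4 ≤ x → cubicBSplineDeriv x = 0 := fun x hx =>
    hx.elim cubicBSplineDeriv_of_nonpos cubicBSplineDeriv_of_four_le
  have e2 : expChar 2 t = expChar 1 t ^ 2 := by rw [expChar_eq_zpow]; norm_cast
  have a0 : ∑' k : ℤ, cubicBSpline (1 / 2 + 2 * (k : ℝ)) * expChar k t =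
      (1 + 23 * expChar 1 t) / 48 := by
    rw [tsum_eq_sum (s := ({0, 1} : Finset ℤ)) (fun k hk => by rw [q _ (z0 k hk), zero_mul]),
      Finset.sum_pair (by norm_num)]
    norm_num [cubicBSpline_half, cubicBSpline_five_halves, expChar_zero]
    ring
  have a1 : ∑' k : ℤ, cubicBSpline (1 / 2 + 2 * (k : ℝ) - 1) * expChar k t =
      (23 * expChar 1 t + expChar 1 t ^ 2) / 48 := by
    rw [tsum_eq_sum (s := ({1, 2} : Finset ℤ)) (fun k hk => by rw [q _ (z1 k hk), zero_mul]),
      Finset.sum_pair (by norm_num)]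
    norm_num
    rw [cubicBSpline_three_halves, cubicBSpline_seven_halves, e2]; ring
  have b0 : ∑' k : ℤ, (cubicBSplineDeriv (1 / 2 + 2 * (k : ℝ)) : ℂ) * expChar k t =
      (1 - 5 * expChar 1 t) / 8 := by
    rw [tsum_eq_sum (s := ({0, 1} : Finset ℤ)) (fun k hk => by rw [q' _ (z0 k hk)]; simp),
      Finset.sum_pair (by norm_num)]
    norm_num [expChar_zero]
    norm_num [cubicBSplineDeriv_five_halves, cubicBSplineDeriv_half]; ring
  have b1 : ∑' k : ℤ, (cubicBSplineDeriv (1 / 2 + 2 * (k : ℝ) - 1) : ℂ) * expChar k t =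
      (5 * expChar 1 t - expChar 1 t ^ 2) / 8 := by
    rw [tsum_eq_sum (s := ({1, 2} : Finset ℤ)) (fun k hk => by rw [q' _ (z1 k hk)]; simp),
      Finset.sum_pair (by norm_num)]
    norm_num
    norm_num [cubicBSplineDeriv_three_halves, cubicBSplineDeriv_seven_halves, e2]; ring
  ext i j
  fin_cases i <;> fin_cases j
  · simpa [symbolMatrix, expChar] using a0
  · simpa [symbolMatrix, expChar] using a1
  · simpa [symbolMatrix, expChar, iteratedDeriv_one, deriv_cubicBSpline] using b0
  · simpa [symbolMatrix, expChar, iteratedDeriv_one, deriv_cubicBSpline] using b1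

theorem det_symbolMatrix (t : ℝ) :
    (symbolMatrix cubicBSpline (1 / 2) 2 t).det =
      expChar 1 t / 64 * (-3 + 38 * expChar 1 t - 3 * expChar 1 t ^ 2) := by
  rw [symbolMatrix_cubicBSpline, Matrix.det_fin_two_of]; ring

/-- A zero of the quadratic factor would contradict `greenSymbol_equation`, where that factor times
w⁻¹ has an explicit inverse. -/
theorem det_symbolMatrix_ne_zero (t : ℝ) :
    (symbolMatrix cubicBSpline (1 / 2) 2 t).det ≠ 0 := by
  have hw := expChar_apply_ne_zero 1 t
  have h := greenSymbol_equation t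
  rw [det_symbolMatrix]
  refine mul_ne_zero (div_ne_zero hw (by norm_num)) fun h0 => ?_
  have : (-3 * (expChar 1 t)⁻¹ + 38 - 3 * expChar 1 t) =
      (expChar 1 t)⁻¹ * (-3 + 38 * expChar 1 t - 3 * expChar 1 t ^ 2) := by
    field_simp
  rw [this, h0, mul_zero, zero_mul] at h
  exact zero_ne_one h

/-- This is the adjugate divided by the determinant, with 1/det = 64 w⁻² G for G = `greenSymbol`;
the powers w⁻¹, w⁻² become index shifts in `dualCoeff`. -/
theorem inv_symbolMatrix (t : ℝ) :
    (symbolMatrix cubicBSpline (1 / 2) 2 t)⁻¹ =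
      !![8 * (5 * expChar (-1) t - 1) * greenSymbol t,
          -(4 / 3) * (23 * expChar (-1) t + 1) * greenSymbol t;
         8 * (5 * expChar (-1) t - expChar (-2) t) * greenSymbol t,
          4 / 3 * (23 * expChar (-1) t + expChar (-2) t) * greenSymbol t] := by
  apply Matrix.inv_eq_left_inv
  have hw := expChar_apply_ne_zero 1 t
  have h := greenSymbol_equation t
  have e1 : expChar (-1) t = (expChar 1 t)⁻¹ := by rw [expChar_eq_zpow]; simp
  have e2 : expChar (-2) t = (expChar 1 t)⁻¹ ^ 2 := by
    rw [expChar_eq_zpow]; simp only [zpow_neg, inv_pow]; norm_cast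
  rw [symbolMatrix_cubicBSpline, e1, e2, Matrix.mul_fin_two, Matrix.one_fin_two]
  have hi : (expChar 1 t)⁻¹ * expChar 1 t = 1 := inv_mul_cancel₀ hw
  generalize (expChar 1 t)⁻¹ = u at *
  generalize expChar 1 t = w at *
  generalize greenSymbol t = G at *
  congr 1
  ext i j
  fin_cases i <;> fin_cases j <;> simp
  · linear_combination h + (38 + 1 / 3) * G * hi
  · linear_combination 14 / 3 * G * w * hi
  · linear_combination -(14 / 3) * u * G * hi
  · linear_combination h + (38 - 3 * u - 3 * w - 1 / 3 * u * w) * G * hi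

/-- The Fourier coefficients of the inverse symbol. -/
noncomputable def dualCoeff (j i : Fin 2) (v : ℤ) : ℝ :=
  !![8 * (5 * greenCoeff (v + 1) - greenCoeff v),
      -(4 / 3) * (23 * greenCoeff (v + 1) + greenCoeff v);
     8 * (5 * greenCoeff (v + 1) - greenCoeff (v + 2)),
      4 / 3 * (23 * greenCoeff (v + 1) + greenCoeff (v + 2))] j i

theorem integral_expChar_shift (a b c : ℂ) (k l v : ℤ) :
    ∫ t in (0 : ℝ)..1, expChar (-v) t * (c * (a * expChar (-k) t + b * expChar (-l) t) *
      greenSymbol t) = c * (a * greenCoeff (v + k) + b * greenCoeff (v + l)) := by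
  have hI : ∀ m : ℤ, IntervalIntegrable (fun t => expChar (-m) t * greenSymbol t) volume 0 1 :=
    fun m => ((continuous_expChar _).mul continuous_greenSymbol).intervalIntegrable _ _
  have : ∀ t, expChar (-v) t * (c * (a * expChar (-k) t + b * expChar (-l) t) * greenSymbol t) =
      c * a * (expChar (-(v + k)) t * greenSymbol t) +
        c * b * (expChar (-(v + l)) t * greenSymbol t) := by
    intro t
    rw [neg_add, neg_add, expChar_add, expChar_add]; ring
  simp only [this]
  rw [intervalIntegral.integral_add ((hI _).const_mul _) ((hI _).const_mul _),
    intervalIntegral.integral_const_mul, intervalIntegral.integral_const_mul,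
    integral_expChar_mul_greenSymbol, integral_expChar_mul_greenSymbol]
  ring

theorem invSymbolCoeff_eq (j i : Fin 2) (v : ℤ) :
    invSymbolCoeff cubicBSpline (1 / 2) 2 j i v = dualCoeff j i v := by
  have hexp : ∀ t : ℝ, Complex.exp (-(2 * Real.pi * Complex.I * (v : ℂ) * (t : ℂ))) =
      expChar (-v) t := by
    intro t; rw [expChar]; congr 1; push_cast; ring
  unfold invSymbolCoeff
  simp only [hexp, inv_symbolMatrix]
  fin_cases j <;> fin_cases i
  · have := integral_expChar_shift 5 (-1) 8 1 0 v
    simp only [neg_zero, expChar_zero, add_zero] at this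
    simpa [dualCoeff, sub_eq_add_neg] using this
  · have := integral_expChar_shift 23 1 (-(4 / 3)) 1 0 v
    simp only [neg_zero, expChar_zero, add_zero] at this
    simpa [dualCoeff] using this
  · have := integral_expChar_shift 5 (-1) 8 1 2 v
    simpa [dualCoeff, sub_eq_add_neg] using this
  · have := integral_expChar_shift 23 1 (4 / 3) 1 2 v
    simpa [dualCoeff] using this

theorem dualCoeff_zero_zero (v : ℤ) : dualCoeff 0 0 v =
    8 * decayRatio / (3 * (1 - decayRatio ^ 2)) *
      (5 * decayRatio ^ (v + 1).natAbs - decayRatio ^ v.natAbs) := by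
  simp [dualCoeff, greenCoeff]; ring

theorem dualCoeff_one_zero (v : ℤ) : dualCoeff 1 0 v =
    8 * decayRatio / (3 * (1 - decayRatio ^ 2)) *
      (5 * decayRatio ^ (v + 1).natAbs - decayRatio ^ (v + 2).natAbs) := by
  simp [dualCoeff, greenCoeff]; ring

theorem dualCoeff_zero_one (v : ℤ) : dualCoeff 0 1 v =
    -(4 * decayRatio / (9 * (1 - decayRatio ^ 2))) *
      (23 * decayRatio ^ (v + 1).natAbs + decayRatio ^ v.natAbs) := by
  have := one_sub_decayRatio_sq_pos.ne'
  simp [dualCoeff, greenCoeff]; field_simp; ring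

theorem dualCoeff_one_one (v : ℤ) : dualCoeff 1 1 v =
    4 * decayRatio / (9 * (1 - decayRatio ^ 2)) *
      (23 * decayRatio ^ (v + 1).natAbs + decayRatio ^ (v + 2).natAbs) := by
  have := one_sub_decayRatio_sq_pos.ne'
  simp [dualCoeff, greenCoeff]; field_simp; ring

/-- This is the triangle inequality |v| ≤ |v + k| + |k| in the exponent. -/
theorem pow_natAbs_add_le {q : ℝ} (h0 : 0 < q) (h1 : q ≤ 1) (v k : ℤ) :
    q ^ (v + k).natAbs ≤ (q ^ k.natAbs)⁻¹ * q ^ v.natAbs := by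
  rw [inv_mul_eq_div, le_div_iff₀ (by positivity), ← pow_add]
  exact pow_le_pow_of_le_one h0.le h1 (by omega)

theorem exists_norm_dualCoeff_le :
    ∃ C : ℝ, 0 < C ∧ ∀ j i : Fin 2, ∀ v : ℤ, ‖dualCoeff j i v‖ ≤ C * decayRatio ^ v.natAbs := by
  have hr := decayRatio_pos
  have hr1 : decayRatio ≤ 1 := by linarith [decayRatio_lt]
  set K := decayRatio / (3 * (1 - decayRatio ^ 2)) with hK
  have hK0 : 0 < K := div_pos hr (by linarith [one_sub_decayRatio_sq_pos])
  have hg : ∀ v k : ℤ, 0 ≤ k → k ≤ 2 →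
      greenCoeff (v + k) ≤ K * (decayRatio ^ 2)⁻¹ * decayRatio ^ v.natAbs := by
    intro v k hk hk2
    rw [greenCoeff, mul_assoc]
    refine mul_le_mul_of_nonneg_left ?_ hK0.le
    refine (pow_natAbs_add_le hr hr1 v k).trans ?_
    refine mul_le_mul_of_nonneg_right ?_ (by positivity)
    exact inv_anti₀ (by positivity) (pow_le_pow_of_le_one hr.le hr1 (by omega))
  -- Here 48 = 8·(5 + 1) covers the value entries and exceeds (4/3)·(23 + 1) = 32 for the derivative
  -- entries.
  refine ⟨48 * (K * (decayRatio ^ 2)⁻¹), by positivity, fun j i v => ?_⟩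
  have h0 := hg v 0 le_rfl (by norm_num)
  have h1 := hg v 1 (by norm_num) (by norm_num)
  have h2 := hg v 2 (by norm_num) (by norm_num)
  have p0 := greenCoeff_nonneg v
  have p1 := greenCoeff_nonneg (v + 1)
  have p2 := greenCoeff_nonneg (v + 2)
  rw [add_zero] at h0
  rw [mul_assoc]
  set B := K * (decayRatio ^ 2)⁻¹ * decayRatio ^ v.natAbs
  rw [Real.norm_eq_abs, abs_le]
  fin_cases j <;> fin_cases i <;> simp [dualCoeff] <;> constructor <;> linarith

theorem reconstructionFun_eq_tsum (i : Fin 2) (t : ℝ) :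
    reconstructionFun cubicBSpline (1 / 2) 2 i t =
      ∑' v : ℤ, ((dualCoeff 0 i v : ℂ) * cubicBSpline (t - 2 * (v : ℝ)) +
        (dualCoeff 1 i v : ℂ) * cubicBSpline (t - 2 * (v : ℝ) - 1)) := by
  unfold reconstructionFun
  simp only [Fin.sum_univ_two, invSymbolCoeff_eq]
  simp

theorem summable_cubicBSpline_even (a : ℤ → ℂ) (t : ℝ) :
    Summable fun v : ℤ => a v * cubicBSpline (t - 2 * (v : ℝ)) := by
  have h := (summable_cubicBSpline (fun k => a (k / 2)) t).comp_injective
    (i := fun v : ℤ => 2 * v) (fun x y h => by simpa using h)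
  refine h.congr fun v => ?_
  simp [Function.comp]

theorem hasSum_reconstructionFun (i : Fin 2) (t : ℝ) :
    HasSum (fun v : ℤ => (dualCoeff 0 i v : ℂ) * cubicBSpline (t - 2 * (v : ℝ)) +
        (dualCoeff 1 i v : ℂ) * cubicBSpline (t - 2 * (v : ℝ) - 1))
      (reconstructionFun cubicBSpline (1 / 2) 2 i t) := by
  rw [reconstructionFun_eq_tsum]
  have h2 := summable_cubicBSpline_even (fun v => (dualCoeff 1 i v : ℂ)) (t - 1)
  refine ((summable_cubicBSpline_even (fun v => (dualCoeff 0 i v : ℂ)) t).add ?_).hasSum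
  refine h2.congr fun v => ?_
  rw [show t - 1 - 2 * (v : ℝ) = t - 2 * v - 1 by ring]

/-! ### The sampling formula for cubic spline series -/

/-- The reconstruction functions of the Hermite sampling series with `Q₄`. -/
local notation "Θ" => reconstructionFun cubicBSpline (1 / 2) 2

/-- On the m-th sampling cell only v = m - 2, ..., m + 1 contribute, with two terms each (hence the
factor 8), and all those coefficients are of size r^{|m|} up to a constant. -/
theorem exists_norm_reconstructionFun_le :
    ∃ C : ℝ, 0 < C ∧ ∀ (i : Fin 2) (m : ℤ) (t : ℝ), 1 / 2 + 2 * (m : ℝ) ≤ t →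
      t ≤ 1 / 2 + 2 * (m : ℝ) + 2 → ‖Θ i t‖ ≤ C * decayRatio ^ m.natAbs := by
  obtain ⟨C, hC, hb⟩ := exists_norm_dualCoeff_le
  have hr := decayRatio_pos
  have hr1 : decayRatio ≤ 1 := by linarith [decayRatio_lt]
  refine ⟨8 * (C * (decayRatio ^ 2)⁻¹), by positivity, fun i m t h0 h1 => ?_⟩
  rw [reconstructionFun_eq_tsum, tsum_eq_sum (s := Finset.Icc (m - 2) (m + 1)) ?_]
  · refine (norm_sum_le _ _).trans ((Finset.sum_le_card_nsmul _ _
      (2 * (C * (decayRatio ^ 2)⁻¹ * decayRatio ^ m.natAbs)) fun v hv => ?_).trans ?_)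
    · have hv' : decayRatio ^ v.natAbs ≤ (decayRatio ^ 2)⁻¹ * decayRatio ^ m.natAbs := by
        rw [Finset.mem_Icc] at hv
        have := pow_natAbs_add_le hr hr1 m (v - m)
        rw [add_sub_cancel] at this
        refine this.trans (mul_le_mul_of_nonneg_right ?_ (by positivity))
        exact inv_anti₀ (by positivity) (pow_le_pow_of_le_one hr.le hr1 (by omega))
      have hj : ∀ (j : Fin 2) (s : ℝ), ‖(dualCoeff j i v : ℂ) * cubicBSpline s‖ ≤
          C * (decayRatio ^ 2)⁻¹ * decayRatio ^ m.natAbs := by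
        intro j s
        rw [norm_mul, Complex.norm_real, mul_assoc]
        calc ‖dualCoeff j i v‖ * ‖cubicBSpline s‖ ≤ ‖dualCoeff j i v‖ * 1 :=
              mul_le_mul_of_nonneg_left (norm_cubicBSpline_le_one s) (norm_nonneg _)
          _ ≤ C * decayRatio ^ v.natAbs := by rw [mul_one]; exact hb j i v
          _ ≤ _ := mul_le_mul_of_nonneg_left hv' hC.le
      refine (norm_add_le _ _).trans ?_
      linarith [hj 0 (t - 2 * v), hj 1 (t - 2 * v - 1)]
    · rw [Int.card_Icc, show (m + 1 + 1 - (m - 2)).toNat = 4 by omega]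
      rw [nsmul_eq_mul]; push_cast; apply le_of_eq; ring
  · intro v hv
    rw [Finset.mem_Icc, not_and_or, not_le, not_le] at hv
    rcases hv with hv | hv
    · have : (v : ℝ) ≤ m - 3 := by exact_mod_cast (by omega : v ≤ m - 3)
      rw [cubicBSpline_of_four_le (by linarith), cubicBSpline_of_four_le (by linarith)]
      simp
    · have : (m : ℝ) + 2 ≤ v := by exact_mod_cast (by omega : m + 2 ≤ v)
      rw [cubicBSpline_of_nonpos (by linarith), cubicBSpline_of_nonpos (by linarith)]
      simp

theorem hasSum_reconstructionFun_sub_two (i : Fin 2) (t : ℝ) :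
    HasSum (fun v : ℤ => (dualCoeff 0 i (v - 1) : ℂ) * cubicBSpline (t - 2 * (v : ℝ)) +
        (dualCoeff 1 i (v - 1) : ℂ) * cubicBSpline (t - 2 * (v : ℝ) - 1))
      (Θ i (t - 2)) := by
  have h := (Equiv.subRight (1 : ℤ)).hasSum_iff.2 (hasSum_reconstructionFun i (t - 2))
  refine (congrArg (fun f => HasSum f _) (funext fun v => ?_)).mp h
  simp only [Function.comp, Equiv.subRight_apply]
  push_cast
  rw [show t - 2 - 2 * ((v : ℝ) - 1) = t - 2 * v by ring]

theorem greenCoeff_recurrence_complex (v : ℤ) :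
    -3 * (greenCoeff (v + 1) : ℂ) + 38 * greenCoeff v - 3 * greenCoeff (v - 1) =
      if v = 0 then 1 else 0 := by
  have := congrArg (fun x : ℝ => (x : ℂ)) (greenCoeff_recurrence v)
  rw [apply_ite (fun x : ℝ => (x : ℂ))] at this
  simpa using this

/-- The sampling formula for Q₄ itself: the numbers are the values and derivatives of Q₄ at 1/2 and
5/2, the only nodes in its support. Comparing coefficients of Q₄(t - 2v) and Q₄(t - 2v - 1) reduces
it to the recurrence of `greenCoeff`, a form of Ψ⁻¹Ψ = 1. -/
theorem reconstruction_even (t : ℝ) :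
    1 / 48 * Θ 0 t + 1 / 8 * Θ 1 t + 23 / 48 * Θ 0 (t - 2) - 5 / 8 * Θ 1 (t - 2) =
      cubicBSpline t := by
  have h := ((((hasSum_reconstructionFun 0 t).mul_left (1 / 48)).add
    ((hasSum_reconstructionFun 1 t).mul_left (1 / 8))).add
    ((hasSum_reconstructionFun_sub_two 0 t).mul_left (23 / 48))).sub
    ((hasSum_reconstructionFun_sub_two 1 t).mul_left (5 / 8))
  refine h.unique ?_
  refine (congrArg (fun f => HasSum f _) (funext fun v => ?_)).mp
    (hasSum_ite_eq (0 : ℤ) (cubicBSpline t))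
  have hg := greenCoeff_recurrence_complex v
  have e : (if v = 0 then cubicBSpline t else 0) =
      (if v = 0 then (1 : ℂ) else 0) * cubicBSpline (t - 2 * (v : ℝ)) := by
    split_ifs with hv
    · simp [hv]
    · simp
  rw [e, ← hg]
  simp [dualCoeff]
  rw [show v - 1 + 2 = v + 1 by ring]
  ring

/-- The same for Q₄(· + 1), whose samples are those of Q₄ at 3/2 and 7/2. This function is the odd
translate with v = -1, whence the shifted recurrence. -/
theorem reconstruction_odd (t : ℝ) :
    23 / 48 * Θ 0 t + 5 / 8 * Θ 1 t + 1 / 48 * Θ 0 (t - 2) - 1 / 8 * Θ 1 (t - 2) =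
      cubicBSpline (t + 1) := by
  have h := ((((hasSum_reconstructionFun 0 t).mul_left (23 / 48)).add
    ((hasSum_reconstructionFun 1 t).mul_left (5 / 8))).add
    ((hasSum_reconstructionFun_sub_two 0 t).mul_left (1 / 48))).sub
    ((hasSum_reconstructionFun_sub_two 1 t).mul_left (1 / 8))
  refine h.unique ?_
  refine (congrArg (fun f => HasSum f _) (funext fun v => ?_)).mp
    (hasSum_ite_eq (-1 : ℤ) (cubicBSpline (t + 1)))
  have hg := greenCoeff_recurrence_complex (v + 1)
  have e : (if v = -1 then cubicBSpline (t + 1) else 0) =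
      (if v + 1 = 0 then (1 : ℂ) else 0) * cubicBSpline (t - 2 * (v : ℝ) - 1) := by
    by_cases hv : v = -1
    · subst hv
      simp only [if_true, neg_add_cancel, one_mul]
      congr 1; push_cast; ring
    · rw [if_neg hv, if_neg (by omega), zero_mul]
  rw [e, ← hg]
  simp [dualCoeff]
  rw [show v - 1 + 2 = v + 1 by ring, show v + 1 + 1 = v + 2 by ring]
  ring

/-- The spline series `∑ c_k Q₄(· - k)`. -/
noncomputable def splineSeries (c : ℤ → ℂ) (x : ℝ) : ℂ := ∑' k : ℤ, c k * cubicBSpline (x - k)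

theorem hasSum_splineSeries (c : ℤ → ℂ) (x : ℝ) :
    HasSum (fun k : ℤ => c k * cubicBSpline (x - k)) (splineSeries c x) :=
  (summable_cubicBSpline c x).hasSum

theorem splineSeries_cell (c : ℤ → ℂ) {m : ℤ} {x : ℝ} (h0 : (m : ℝ) ≤ x) (h1 : x ≤ m + 1) :
    splineSeries c x = c m * cubicBSpline (x - m) + c (m - 1) * cubicBSpline (x - m + 1) +
        c (m - 2) * cubicBSpline (x - m + 2) + c (m - 3) * cubicBSpline (x - m + 3) :=
  (hasSum_cubicBSpline_cell c h0 h1).tsum_eq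

theorem splineSeries_sample (c : ℤ → ℂ) (l : ℤ) :
    splineSeries c (1 / 2 + 2 * (l : ℝ)) = 1 / 48 * c (2 * l) + 23 / 48 * c (2 * l - 1) +
      23 / 48 * c (2 * l - 2) + 1 / 48 * c (2 * l - 3) := by
  rw [splineSeries_cell c (m := 2 * l) (by push_cast; linarith) (by push_cast; linarith)]
  push_cast
  rw [show 1 / 2 + 2 * (l : ℝ) - 2 * l = 1 / 2 by ring, cubicBSpline_half,
    show (1 / 2 + 1 : ℝ) = 3 / 2 by norm_num, show (1 / 2 + 2 : ℝ) = 5 / 2 by norm_num,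
    show (1 / 2 + 3 : ℝ) = 7 / 2 by norm_num, cubicBSpline_three_halves, cubicBSpline_five_halves,
    cubicBSpline_seven_halves]
  ring

theorem hasDerivAt_splineSeries_sample (c : ℤ → ℂ) (l : ℤ) :
    HasDerivAt (splineSeries c) (1 / 8 * c (2 * l) + 5 / 8 * c (2 * l - 1) -
      5 / 8 * c (2 * l - 2) - 1 / 8 * c (2 * l - 3)) (1 / 2 + 2 * (l : ℝ)) := by
  -- The node is interior to the cell [2l, 2l + 1], so near it the series is a fixed sum of four
  -- terms and can be differentiated termwise.
  have ev : splineSeries c =ᶠ[𝓝 (1 / 2 + 2 * (l : ℝ))] fun x =>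
      c (2 * l) * cubicBSpline (x - 2 * l) + c (2 * l - 1) * cubicBSpline (x - 2 * l + 1) +
        c (2 * l - 2) * cubicBSpline (x - 2 * l + 2) +
        c (2 * l - 3) * cubicBSpline (x - 2 * l + 3) := by
    filter_upwards [Icc_mem_nhds (show 2 * (l : ℝ) < 1 / 2 + 2 * (l : ℝ) by linarith)
      (show 1 / 2 + 2 * (l : ℝ) < 2 * l + 1 by linarith)] with x hx
    have := splineSeries_cell c (m := 2 * l) (x := x) (by push_cast; exact hx.1)
      (by push_cast; exact hx.2)
    push_cast at this
    exact this
  have d : ∀ a : ℝ, HasDerivAt (fun x : ℝ => cubicBSpline (x - 2 * l + a))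
      (cubicBSplineDeriv (1 / 2 + a) : ℂ) (1 / 2 + 2 * (l : ℝ)) := by
    intro a
    have h := hasDerivAt_cubicBSpline (1 / 2 + 2 * (l : ℝ) + (a - 2 * l))
    have h2 := h.comp_add_const _ (a - 2 * (l : ℝ))
    rw [show 1 / 2 + 2 * (l : ℝ) + (a - 2 * l) = 1 / 2 + a by ring] at h2
    refine h2.congr_of_eventuallyEq (Eventually.of_forall fun x => ?_)
    simp only
    congr 1; ring
  have d0 := d 0
  simp only [add_zero] at d0
  refine HasDerivAt.congr_of_eventuallyEq ?_ ev
  refine ((((d0.const_mul _).add ((d 1).const_mul _)).add ((d 2).const_mul _)).add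
    ((d 3).const_mul _)).congr_deriv ?_
  rw [show (1 / 2 + 1 : ℝ) = 3 / 2 by norm_num, show (1 / 2 + 2 : ℝ) = 5 / 2 by norm_num,
    show (1 / 2 + 3 : ℝ) = 7 / 2 by norm_num, cubicBSplineDeriv_half,
    cubicBSplineDeriv_three_halves, cubicBSplineDeriv_five_halves, cubicBSplineDeriv_seven_halves]
  push_cast
  ring

theorem exists_cell (t : ℝ) : ∃ m : ℤ, 1 / 2 + 2 * (m : ℝ) ≤ t ∧ t < 1 / 2 + 2 * (m : ℝ) + 2 := by
  refine ⟨⌊(t - 1 / 2) / 2⌋, ?_, ?_⟩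
  · linarith [Int.floor_le ((t - 1 / 2) / 2)]
  · linarith [Int.lt_floor_add_one ((t - 1 / 2) / 2)]

/-- Along the sampling lattice the reconstruction functions decay geometrically. -/
theorem exists_norm_reconstructionFun_sub_le (t : ℝ) :
    ∃ C : ℝ, 0 ≤ C ∧ ∀ (i : Fin 2) (l : ℤ), ‖Θ i (t - 2 * (l : ℝ))‖ ≤
      C * decayRatio ^ l.natAbs := by
  obtain ⟨C, hC, hb⟩ := exists_norm_reconstructionFun_le
  obtain ⟨m, hm0, hm1⟩ := exists_cell t
  have hr := decayRatio_pos
  refine ⟨C * (decayRatio ^ m.natAbs)⁻¹, by positivity, fun i l => ?_⟩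
  refine (hb i (m - l) _ (by push_cast; linarith) (by push_cast; linarith)).trans ?_
  rw [mul_assoc]
  refine mul_le_mul_of_nonneg_left ?_ hC.le
  have := pow_natAbs_add_le hr (by linarith [decayRatio_lt]) (-l) m
  rwa [Int.natAbs_neg, neg_add_eq_sub] at this

theorem summable_mul_reconstructionFun {a : ℤ → ℂ} {A : ℝ}
    (ha : ∀ l : ℤ, ‖a l‖ ≤ A * 4 ^ l.natAbs) (i : Fin 2) (t : ℝ) :
    Summable fun l : ℤ => a l * Θ i (t - 2 * (l : ℝ)) := by
  obtain ⟨C, hC, hb⟩ := exists_norm_reconstructionFun_sub_le t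
  have hr := decayRatio_pos
  have h := (summable_pow_natAbs (q := 4 * decayRatio) (by positivity)
    (by linarith [decayRatio_lt])).mul_left (A * C)
  refine Summable.of_norm_bounded h fun l => ?_
  rw [norm_mul, mul_pow]
  calc ‖a l‖ * ‖Θ i (t - 2 * (l : ℝ))‖ ≤
        (A * 4 ^ l.natAbs) * (C * decayRatio ^ l.natAbs) :=
        mul_le_mul (ha l) (hb i l) (norm_nonneg _) ((norm_nonneg _).trans (ha l))
    _ = _ := by ring

theorem HasSum.int_even_add_odd {M : Type*} [AddCommMonoid M] [TopologicalSpace M]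
    [ContinuousAdd M] {f : ℤ → M} {a b : M} (ha : HasSum (fun l : ℤ => f (2 * l)) a)
    (hb : HasSum (fun l : ℤ => f (2 * l - 1)) b) : HasSum f (a + b) := by
  have h0 : HasSum (fun k : ℤ => if Even k then f k else 0) a := by
    rw [← Function.Injective.hasSum_iff (g := fun l : ℤ => 2 * l)
      (fun x y h => by simpa using h)]
    · simpa [Function.comp_def] using ha
    · intro k hk
      rw [if_neg]
      rintro ⟨j, rfl⟩
      exact hk ⟨j, by simp only; ring⟩
  have h1 : HasSum (fun k : ℤ => if Even k then 0 else f k) b := by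
    rw [← Function.Injective.hasSum_iff (g := fun l : ℤ => 2 * l - 1)
      (fun x y h => by simpa using h)]
    · have : ∀ l : ℤ, ¬ Even (2 * l - 1) := fun l => by
        rw [Int.not_even_iff_odd]; exact ⟨l - 1, by ring⟩
      simpa [Function.comp_def, this] using hb
    · intro k hk
      rw [if_pos]
      by_contra h
      rw [Int.not_even_iff_odd] at h
      obtain ⟨j, rfl⟩ := h
      exact hk ⟨j + 1, by simp only; ring⟩
  refine (congrArg (fun f => HasSum f _) (funext fun k => ?_)).mp (h0.add h1)
  split_ifs <;> simp

/-- Exponential growth is allowed so that one statement serves both ℓ² coefficients and coefficients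
of polynomials. The samples involve c(2l - b) with b = 0, ..., 3, of size 4^{|l|} at most up to a
constant, against reconstruction functions of size r^{|l|}. -/
theorem hasSum_sampling_splineSeries {c : ℤ → ℂ} {A : ℝ} (hc : ∀ k : ℤ, ‖c k‖ ≤ A * 2 ^ k.natAbs)
    (t : ℝ) :
    HasSum (fun l : ℤ => splineSeries c (1 / 2 + 2 * (l : ℝ)) * Θ 0 (t - 2 * (l : ℝ)) +
      deriv (splineSeries c) (1 / 2 + 2 * (l : ℝ)) * Θ 1 (t - 2 * (l : ℝ))) (splineSeries c t) := by
  have hA : 0 ≤ A := by simpa using (norm_nonneg _).trans (hc 0)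
  have hs : ∀ (b : ℤ) (i : Fin 2), Summable fun l : ℤ => c (2 * l - b) * Θ i (t - 2 * (l : ℝ)) := by
    intro b i
    refine summable_mul_reconstructionFun (A := A * 2 ^ b.natAbs) (fun l => ?_) i t
    refine (hc _).trans ?_
    rw [mul_assoc]
    refine mul_le_mul_of_nonneg_left ?_ hA
    rw [show (4 : ℝ) = 2 ^ 2 by norm_num, ← pow_mul, ← pow_add]
    exact pow_le_pow_right₀ (by norm_num) (by omega)
  have hH : ∀ (b : ℤ) (p q : ℂ), Summable fun l : ℤ =>
      c (2 * l - b) * (p * Θ 0 (t - 2 * (l : ℝ)) + q * Θ 1 (t - 2 * (l : ℝ))) := by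
    intro b p q
    refine (((hs b 0).mul_left p).add ((hs b 1).mul_left q)).congr fun l => ?_
    ring
  have shift : ∀ {g : ℤ → ℂ} {s : ℂ}, HasSum g s → HasSum (fun l => g (l + 1)) s := fun h =>
    (Equiv.addRight (1 : ℤ)).hasSum_iff.2 h
  -- The four pairs are (Q₄, Q₄') at 1/2, 3/2, 5/2, 7/2. Shifting l by one in the last two aligns
  -- equal coefficients, so the b = 0, 2 parts form Q₄(t - 2l) and the b = 1, 3 parts form Q₄(t - 2l
  -- + 1).
  obtain ⟨s0, h0⟩ := hH 0 (1 / 48) (1 / 8)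
  obtain ⟨s1, h1⟩ := hH 1 (23 / 48) (5 / 8)
  obtain ⟨s2, h2⟩ := hH 2 (23 / 48) (-(5 / 8))
  obtain ⟨s3, h3⟩ := hH 3 (1 / 48) (-(1 / 8))
  have hE := h0.add (shift h2)
  have hO := h1.add (shift h3)
  have hE' : HasSum (fun l : ℤ => c (2 * l) * cubicBSpline (t - ((2 * l : ℤ) : ℝ)))
      (s0 + s2) := by
    refine (congrArg (fun f => HasSum f _) (funext fun l => ?_)).mp hE
    push_cast
    rw [← reconstruction_even, show 2 * (l + 1) - 2 = 2 * l by ring, sub_zero,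
      show t - 2 * ((l : ℝ) + 1) = t - 2 * l - 2 by ring]
    ring
  have hO' : HasSum (fun l : ℤ => c (2 * l - 1) * cubicBSpline (t - ((2 * l - 1 : ℤ) : ℝ)))
      (s1 + s3) := by
    refine (congrArg (fun f => HasSum f _) (funext fun l => ?_)).mp hO
    push_cast
    rw [show t - (2 * (l : ℝ) - 1) = t - 2 * l + 1 by ring,
      ← reconstruction_odd, show 2 * (l + 1) - 3 = 2 * l - 1 by ring,
      show t - 2 * ((l : ℝ) + 1) = t - 2 * l - 2 by ring]
    ring
  have hu := (HasSum.int_even_add_odd (f := fun k : ℤ => c k * cubicBSpline (t - k))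
    hE' hO').unique (hasSum_splineSeries c t)
  rw [← hu]
  have hall := ((h0.add h2).add (h1.add h3))
  refine (congrArg₂ (fun f s => HasSum f s) (funext fun l => ?_) (by ring)).mp hall
  rw [splineSeries_sample, (hasDerivAt_splineSeries_sample c l).deriv, sub_zero]
  ring

/-! ### Reproduction of cubic polynomials -/

theorem eval_eq_of_natDegree_le_three {P : Polynomial ℂ} (hP : P.natDegree ≤ 3) (x : ℂ) :
    P.eval x = P.coeff 0 + P.coeff 1 * x + P.coeff 2 * x ^ 2 + P.coeff 3 * x ^ 3 := by
  rw [Polynomial.eval_eq_sum_range' (by omega : P.natDegree < 4)]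
  simp [Finset.sum_range_succ]

/-- The B-spline coefficients of a cubic polynomial. -/
noncomputable def marsdenCoeff (P : Polynomial ℂ) (k : ℤ) : ℂ :=
  P.coeff 0 + P.coeff 1 * ((k : ℂ) + 2) + P.coeff 2 * (((k : ℂ) + 2) ^ 2 - 1 / 3) +
    P.coeff 3 * (((k : ℂ) + 2) ^ 3 - ((k : ℂ) + 2))

/-- Marsden's identity, centred at the midpoint k + 2 of the support of Q₄(· - k); the correction
1/3 is the variance of the density Q₄. On each cell it is a polynomial identity in the fractional
part. -/
theorem splineSeries_marsdenCoeff {P : Polynomial ℂ} (hP : P.natDegree ≤ 3) (x : ℝ) :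
    splineSeries (marsdenCoeff P) x = P.eval (x : ℂ) := by
  have h0 := Int.floor_le x
  have h1 := (Int.lt_floor_add_one x).le
  rw [splineSeries_cell _ h0 h1, eval_eq_of_natDegree_le_three hP]
  obtain ⟨u, hu⟩ : ∃ u : ℝ, u = x - ⌊x⌋ := ⟨_, rfl⟩
  have hx : (x : ℂ) = (⌊x⌋ : ℂ) + u := by rw [hu]; push_cast; ring
  rw [← hu, cubicBSpline_piece_zero (by linarith) (by linarith),
    cubicBSpline_piece_one (by linarith) (by linarith),
    cubicBSpline_piece_two (by linarith) (by linarith),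
    cubicBSpline_piece_three (by linarith) (by linarith), hx]
  simp only [marsdenCoeff]
  push_cast
  ring

theorem add_two_cube_le (n : ℕ) : ((n : ℝ) + 2) ^ 3 ≤ 27 * 2 ^ n := by
  rcases lt_or_ge n 2 with h | h
  · interval_cases n <;> norm_num
  induction n, h using Nat.le_induction with
  | base => norm_num
  | succ n hn ih =>
    have h2 : (2 : ℝ) ≤ n := by exact_mod_cast hn
    rw [pow_succ (2 : ℝ)]
    push_cast
    nlinarith [mul_nonneg (sub_nonneg.2 h2) (sq_nonneg (n : ℝ)), sq_nonneg ((n : ℝ) - 2)]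

theorem exists_norm_marsdenCoeff_le (P : Polynomial ℂ) :
    ∃ A : ℝ, ∀ k : ℤ, ‖marsdenCoeff P k‖ ≤ A * 2 ^ k.natAbs := by
  refine ⟨(‖P.coeff 0‖ + ‖P.coeff 1‖ + 2 * ‖P.coeff 2‖ + 2 * ‖P.coeff 3‖) * 27, fun k => ?_⟩
  set y : ℝ := (k.natAbs : ℝ) + 2
  have hy : 2 ≤ y := by simp [y]
  have hk : ‖(k : ℂ) + 2‖ ≤ y := by
    refine (norm_add_le _ _).trans ?_
    rw [Complex.norm_intCast]
    simp [y]
  have e1 : y ≤ y ^ 3 := by nlinarith [sq_nonneg y]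
  have e2 : y ^ 2 ≤ y ^ 3 := by nlinarith [sq_nonneg y]
  have e0 : 1 ≤ y ^ 3 := by linarith
  have n2 : ‖((k : ℂ) + 2) ^ 2 - 1 / 3‖ ≤ 2 * y ^ 3 := by
    refine (norm_sub_le _ _).trans ?_
    rw [norm_pow]
    have := pow_le_pow_left₀ (norm_nonneg _) hk 2
    norm_num
    linarith
  have n3 : ‖((k : ℂ) + 2) ^ 3 - ((k : ℂ) + 2)‖ ≤ 2 * y ^ 3 := by
    refine (norm_sub_le _ _).trans ?_
    rw [norm_pow]
    have := pow_le_pow_left₀ (norm_nonneg _) hk 3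
    linarith
  have hb : ‖marsdenCoeff P k‖ ≤ ‖P.coeff 0‖ * y ^ 3 + ‖P.coeff 1‖ * y ^ 3 +
      ‖P.coeff 2‖ * (2 * y ^ 3) + ‖P.coeff 3‖ * (2 * y ^ 3) := by
    unfold marsdenCoeff
    refine norm_add_le_of_le (norm_add_le_of_le (norm_add_le_of_le ?_ ?_) ?_) ?_
    · exact le_mul_of_one_le_right (norm_nonneg _) e0
    · rw [norm_mul]; exact mul_le_mul_of_nonneg_left (hk.trans e1) (norm_nonneg _)
    · rw [norm_mul]; exact mul_le_mul_of_nonneg_left n2 (norm_nonneg _)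
    · rw [norm_mul]; exact mul_le_mul_of_nonneg_left n3 (norm_nonneg _)
  refine hb.trans ?_
  have := mul_le_mul_of_nonneg_left (add_two_cube_le k.natAbs)
    (by positivity : 0 ≤ ‖P.coeff 0‖ + ‖P.coeff 1‖ + 2 * ‖P.coeff 2‖ + 2 * ‖P.coeff 3‖)
  change _ * y ^ 3 ≤ _ at this
  linarith

/-- The term of the Hermite sampling series at scale one. -/
noncomputable def hermiteTerm (F : ℝ → ℂ) (t : ℝ) (l : ℤ) : ℂ :=
  F (1 / 2 + 2 * (l : ℝ)) * Θ 0 (t - 2 * (l : ℝ)) +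
    deriv F (1 / 2 + 2 * (l : ℝ)) * Θ 1 (t - 2 * (l : ℝ))

theorem hasSum_hermiteTerm_polynomial {P : Polynomial ℂ} (hP : P.natDegree ≤ 3) (t : ℝ) :
    HasSum (hermiteTerm (fun x : ℝ => P.eval (x : ℂ)) t) (P.eval (t : ℂ)) := by
  obtain ⟨A, hA⟩ := exists_norm_marsdenCoeff_le P
  have h := hasSum_sampling_splineSeries hA t
  rwa [funext (splineSeries_marsdenCoeff hP)] at h

/-- The factor W^{-i} is the chain rule for f(W⁻¹ ·), so every scale reduces to scale one. -/
theorem samplingTerm_eq_hermiteTerm (W : ℝ) (f : ℝ → ℂ) (t : ℝ) (l : ℤ) :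
    samplingTerm cubicBSpline (1 / 2) 2 W f t l =
      hermiteTerm (fun x => f (W⁻¹ * x)) (W * t) l := by
  unfold samplingTerm hermiteTerm
  rw [Fin.sum_univ_two, deriv_comp_mul_left]
  simp only [Fin.val_zero, Fin.val_one, iteratedDeriv_zero, iteratedDeriv_one, pow_zero, pow_one,
    div_one, one_mul, Nat.cast_ofNat]
  rw [div_eq_inv_mul (1 / 2 + 2 * (l : ℝ)) W, Complex.real_smul, Complex.ofReal_inv, one_div (W : ℂ)]

theorem reproducesPolynomials_cubicBSpline : ReproducesPolynomials cubicBSpline (1 / 2) 2 3 := by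
  intro W hW P hP t
  have hW0 : (W : ℂ) ≠ 0 := by exact_mod_cast (by linarith : W ≠ 0)
  have hd : (P.comp (Polynomial.C ((W : ℂ)⁻¹) * Polynomial.X)).natDegree ≤ 3 := by
    refine Polynomial.natDegree_comp_le.trans ?_
    have := (Polynomial.natDegree_C_mul_le ((W : ℂ)⁻¹) Polynomial.X).trans
      Polynomial.natDegree_X_le
    calc P.natDegree * _ ≤ 3 * 1 := Nat.mul_le_mul hP this
      _ = 3 := rfl
  have h := hasSum_hermiteTerm_polynomial hd (W * t)
  have e1 : (fun x : ℝ => (P.comp (Polynomial.C ((W : ℂ)⁻¹) * Polynomial.X)).eval (x : ℂ)) =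
      fun x : ℝ => P.eval ((W⁻¹ * x : ℝ) : ℂ) := by
    ext x; simp
  have e2 : (P.comp (Polynomial.C ((W : ℂ)⁻¹) * Polynomial.X)).eval ((W * t : ℝ) : ℂ) =
      P.eval (t : ℂ) := by
    simp [hW0]
  rw [e1, e2] at h
  have h' : HasSum (samplingTerm cubicBSpline (1 / 2) 2 W (fun x : ℝ => P.eval (x : ℂ)) t)
      (P.eval (t : ℂ)) := by
    rwa [funext fun l => samplingTerm_eq_hermiteTerm W (fun x : ℝ => P.eval (x : ℂ)) t l]
  exact ⟨h'.summable, h'.tsum_eq⟩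

/-! ### The sampling formula on `V(Q₄)` -/

theorem exists_norm_le_of_memℓp_two {c : ℤ → ℂ} (hc : Memℓp c 2) :
    ∃ A : ℝ, ∀ k : ℤ, ‖c k‖ ≤ A * 2 ^ k.natAbs := by
  obtain ⟨A, hA⟩ := (memℓp_infty_iff.1 (hc.of_exponent_ge le_top))
  have hA' : ∀ k, ‖c k‖ ≤ A := fun k => hA ⟨k, rfl⟩
  refine ⟨A, fun k => (hA' k).trans ?_⟩
  exact le_mul_of_one_le_right ((norm_nonneg _).trans (hA' 0)) (one_le_pow₀ (by norm_num))

theorem eq_splineSeries_of_hasSum {f : ℝ → ℂ} {c : ℤ → ℂ}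
    (h : ∀ x : ℝ, HasSum (fun k : ℤ => c k * cubicBSpline (x - (k : ℝ))) (f x)) :
    f = splineSeries c :=
  funext fun x => (h x).unique (hasSum_splineSeries c x)

theorem hasSum_hermiteTerm_of_mem {f : ℝ → ℂ} (hf : f ∈ shiftInvariantSpace cubicBSpline)
    (t : ℝ) : HasSum (hermiteTerm f t) (f t) := by
  obtain ⟨-, c, hc, h⟩ := hf
  obtain ⟨A, hA⟩ := exists_norm_le_of_memℓp_two hc
  rw [eq_splineSeries_of_hasSum h]
  exact hasSum_sampling_splineSeries hA t

theorem isUniquenessSet_cubicBSpline :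
    IsUniquenessSet cubicBSpline 1 (fun l : ℤ => 1 / 2 + 2 * (l : ℝ)) := by
  intro f hf h0
  ext t
  have h := hasSum_hermiteTerm_of_mem hf t
  have hz : hermiteTerm f t = fun _ => 0 := by
    ext l
    have a := h0 l 0
    have b := h0 l 1
    simp only [Fin.val_zero, Fin.val_one, iteratedDeriv_zero, iteratedDeriv_one] at a b
    rw [hermiteTerm, a, b]; ring
  rw [hz] at h
  exact h.unique hasSum_zero

/-! ### A discrete convolution inequality -/

/-- Convolution with the two-sided geometric weight `q^{|n|}`. -/
noncomputable def geomConv (q : ℝ≥0∞) (v : ℤ → ℝ≥0∞) (n : ℤ) : ℝ≥0∞ :=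
  ∑' j : ℤ, q ^ (n - j).natAbs * v j

/-- The mass of the two-sided geometric weight. -/
noncomputable def geomMass (q : ℝ≥0∞) : ℝ≥0∞ := ∑' n : ℤ, q ^ n.natAbs

theorem tsum_pow_natAbs_sub_left (q : ℝ≥0∞) (j : ℤ) :
    ∑' n : ℤ, q ^ (n - j).natAbs = geomMass q :=
  (Equiv.subRight j).tsum_eq fun n : ℤ => q ^ n.natAbs

theorem tsum_pow_natAbs_sub_right (q : ℝ≥0∞) (n : ℤ) :
    ∑' j : ℤ, q ^ (n - j).natAbs = geomMass q :=
  (Equiv.subLeft n).tsum_eq fun n : ℤ => q ^ n.natAbs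

theorem geomMass_ofReal_ne_top {q : ℝ} (h0 : 0 ≤ q) (h1 : q < 1) :
    geomMass (ENNReal.ofReal q) ≠ ⊤ := by
  have h := (summable_pow_natAbs h0 h1).tsum_ofReal_ne_top
  simpa only [geomMass, ENNReal.ofReal_pow h0] using h

theorem tsum_geomConv (q : ℝ≥0∞) (v : ℤ → ℝ≥0∞) :
    ∑' n, geomConv q v n = geomMass q * ∑' j, v j := by
  simp only [geomConv]
  rw [ENNReal.tsum_comm]
  simp only [ENNReal.tsum_mul_right, tsum_pow_natAbs_sub_left, ENNReal.tsum_mul_left]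

/-- Weighted Hölder with respect to the weights q^{|n-j|}; summing over n gives the ℓ^p Young
inequality with constant the mass of the kernel. -/
theorem geomConv_rpow_le (q : ℝ≥0∞) (v : ℤ → ℝ≥0∞) {p : ℝ} (hp : 1 ≤ p) (n : ℤ) :
    geomConv q v n ^ p ≤ geomMass q ^ (p - 1) * geomConv q (fun j => v j ^ p) n := by
  have hp0 : 0 < p := by linarith
  have h : geomConv q v n ≤
      geomMass q ^ (1 - p⁻¹) * geomConv q (fun j => v j ^ p) n ^ p⁻¹ := by
    rw [geomConv, ENNReal.tsum_eq_iSup_sum]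
    refine iSup_le fun s => (ENNReal.inner_le_weight_mul_Lp_of_nonneg s hp
      (fun j => q ^ (n - j).natAbs) v).trans ?_
    refine mul_le_mul' (ENNReal.rpow_le_rpow ?_ ?_) (ENNReal.rpow_le_rpow ?_ ?_)
    · rw [← tsum_pow_natAbs_sub_right q n]; exact ENNReal.sum_le_tsum s
    · rw [sub_nonneg]; exact inv_le_one_of_one_le₀ hp
    · exact ENNReal.sum_le_tsum s
    · positivity
  calc geomConv q v n ^ p ≤
        (geomMass q ^ (1 - p⁻¹) * geomConv q (fun j => v j ^ p) n ^ p⁻¹) ^ p :=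
        ENNReal.rpow_le_rpow h hp0.le
    _ = _ := by
        rw [ENNReal.mul_rpow_of_nonneg _ _ hp0.le, ← ENNReal.rpow_mul, ← ENNReal.rpow_mul,
          inv_mul_cancel₀ hp0.ne', ENNReal.rpow_one, sub_mul, one_mul, inv_mul_cancel₀ hp0.ne']

theorem tsum_geomConv_rpow_le (q : ℝ≥0∞) (v : ℤ → ℝ≥0∞) {p : ℝ} (hp : 1 ≤ p) :
    ∑' n, geomConv q v n ^ p ≤ geomMass q ^ (p - 1) * (geomMass q * ∑' j, v j ^ p) := by
  rw [← tsum_geomConv, ← ENNReal.tsum_mul_left]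
  exact ENNReal.tsum_le_tsum fun n => geomConv_rpow_le q v hp n

/-! ### The Riesz basis property -/

theorem lintegral_eq_tsum_Ico (a : ℝ) {p : ℝ} (hp : 0 < p) (g : ℝ → ℝ≥0∞) :
    ∫⁻ x, g x = ∑' n : ℤ, ∫⁻ x in Set.Ico (a + n * p) (a + (n + 1) * p), g x := by
  have h1 := iUnion_Ico_add_zsmul hp a
  have h2 := Set.pairwise_disjoint_Ico_add_zsmul a p
  simp only [zsmul_eq_mul, Int.cast_add, Int.cast_one] at h1 h2
  rw [← lintegral_iUnion (fun n => measurableSet_Ico) h2, h1, Measure.restrict_univ]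

theorem ENNReal.rpow_half_sq (a : ℝ≥0∞) : (a ^ (1 / 2 : ℝ)) ^ 2 = a := by
  rw [← ENNReal.rpow_natCast, ← ENNReal.rpow_mul]
  norm_num

theorem eLpNorm_two_sq (f : ℝ → ℂ) (μ : Measure ℝ) :
    eLpNorm f 2 μ ^ 2 = ∫⁻ x, ‖f x‖ₑ ^ 2 ∂μ := by
  rw [eLpNorm_eq_lintegral_rpow_enorm_toReal two_ne_zero ENNReal.ofNat_ne_top]
  simp only [ENNReal.toReal_ofNat, ENNReal.rpow_ofNat]
  exact ENNReal.rpow_half_sq _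

theorem enorm_sq_eq (z : ℂ) : ‖z‖ₑ ^ 2 = ENNReal.ofReal (‖z‖ ^ 2) := by
  rw [ENNReal.ofReal_pow (norm_nonneg _), ofReal_norm]

theorem tsum_enorm_sq {d : ℤ → ℂ} (hd : Memℓp d 2) :
    ∑' n, ‖d n‖ₑ ^ 2 = ENNReal.ofReal (∑' n, ‖d n‖ ^ 2) := by
  have h := hd.summable (by norm_num)
  simp only [ENNReal.toReal_ofNat, Real.rpow_ofNat] at h
  simp only [enorm_sq_eq]
  rw [ENNReal.ofReal_tsum_of_nonneg (fun n => by positivity) h]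

theorem memℓp_two_iff {d : ℤ → ℂ} : Memℓp d 2 ↔ ∑' n, ‖d n‖ₑ ^ 2 ≠ ⊤ := by
  constructor
  · intro h; rw [tsum_enorm_sq h]; exact ENNReal.ofReal_ne_top
  · intro h
    refine memℓp_gen ?_
    simp only [enorm_sq_eq] at h
    simp only [ENNReal.toReal_ofNat, Real.rpow_ofNat]
    have := ENNReal.summable_toReal h
    refine this.congr fun n => ?_
    exact ENNReal.toReal_ofReal (by positivity)

theorem measurable_tsum_int {f : ℤ → ℝ → ℂ} (hf : ∀ k, Measurable (f k))
    (hs : ∀ x, Summable fun k => f k x) : Measurable fun x => ∑' k, f k x :=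
  measurable_of_tendsto_metrizable' (atTop : Filter (Finset ℤ))
    (f := fun (s : Finset ℤ) x => ∑ k ∈ s, f k x)
    (fun s => Finset.measurable_sum s fun _ _ => hf _)
    (tendsto_pi_nhds.2 fun x => (hs x).hasSum)

theorem measurable_cubicBSpline : Measurable cubicBSpline :=
  continuous_cubicBSpline.measurable

theorem measurable_splineSeries (c : ℤ → ℂ) : Measurable (splineSeries c) :=
  measurable_tsum_int
    (fun _ => (measurable_cubicBSpline.comp (measurable_id.sub_const _)).const_mul _)
    (summable_cubicBSpline c)

theorem norm_splineSeries_cell_le (c : ℤ → ℂ) {m : ℤ} {x : ℝ} (h0 : (m : ℝ) ≤ x)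
    (h1 : x ≤ m + 1) :
    ‖splineSeries c x‖ ≤ ‖c m‖ + ‖c (m - 1)‖ + ‖c (m - 2)‖ + ‖c (m - 3)‖ := by
  rw [splineSeries_cell c h0 h1]
  have h : ∀ (z : ℂ) (s : ℝ), ‖z * cubicBSpline s‖ ≤ ‖z‖ := fun z s => by
    rw [norm_mul]
    exact mul_le_of_le_one_right (norm_nonneg _) (norm_cubicBSpline_le_one s)
  exact norm_add_le_of_le (norm_add_le_of_le (norm_add_le_of_le (h _ _) (h _ _)) (h _ _)) (h _ _)

/-- On a unit cell four coefficients are active and |Q₄| ≤ 1, so Cauchy-Schwarz costs a factor 4;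
each coefficient is active on four cells, which costs another 4. -/
theorem lintegral_splineSeries_sq_le (c : ℤ → ℂ) :
    ∫⁻ x, ‖splineSeries c x‖ₑ ^ 2 ≤ 16 * ∑' n, ‖c n‖ₑ ^ 2 := by
  rw [lintegral_eq_tsum_Ico 0 one_pos]
  have hcell : ∀ m : ℤ, ∫⁻ x in Set.Ico (0 + (m : ℝ) * 1) (0 + (m + 1) * 1),
      ‖splineSeries c x‖ₑ ^ 2 ≤
      4 * (‖c m‖ₑ ^ 2 + ‖c (m - 1)‖ₑ ^ 2 + ‖c (m - 2)‖ₑ ^ 2 + ‖c (m - 3)‖ₑ ^ 2) := by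
    intro m
    refine (setLIntegral_mono' (g := fun _ => 4 * (‖c m‖ₑ ^ 2 + ‖c (m - 1)‖ₑ ^ 2 +
      ‖c (m - 2)‖ₑ ^ 2 + ‖c (m - 3)‖ₑ ^ 2)) measurableSet_Ico fun x hx => ?_).trans ?_
    · simp only [mul_one, zero_add, Set.mem_Ico] at hx
      have h := norm_splineSeries_cell_le c hx.1 hx.2.le
      simp only [enorm_sq_eq]
      rw [← ENNReal.ofReal_add (by positivity) (by positivity),
        ← ENNReal.ofReal_add (by positivity) (by positivity),
        ← ENNReal.ofReal_add (by positivity) (by positivity),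
        ← ENNReal.ofReal_ofNat, ← ENNReal.ofReal_mul (by norm_num)]
      refine ENNReal.ofReal_le_ofReal ((pow_le_pow_left₀ (norm_nonneg _) h 2).trans ?_)
      generalize ‖c m‖ = a
      generalize ‖c (m - 1)‖ = b
      generalize ‖c (m - 2)‖ = d
      generalize ‖c (m - 3)‖ = e
      nlinarith [sq_nonneg (a - b), sq_nonneg (a - d), sq_nonneg (a - e), sq_nonneg (b - d),
        sq_nonneg (b - e), sq_nonneg (d - e)]
    · rw [setLIntegral_const, Real.volume_Ico]
      simp
  refine (ENNReal.tsum_le_tsum hcell).trans ?_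
  have hs : ∀ k : ℤ, ∑' m : ℤ, ‖c (m - k)‖ₑ ^ 2 = ∑' m : ℤ, ‖c m‖ₑ ^ 2 := fun k =>
    (Equiv.subRight k).tsum_eq fun m => ‖c m‖ₑ ^ 2
  rw [ENNReal.tsum_mul_left, ENNReal.tsum_add, ENNReal.tsum_add, ENNReal.tsum_add, hs, hs, hs]
  apply le_of_eq; ring

/-! ### The lower Riesz bound by a local dual functional. -/

theorem integral_sum_mul_pow (n : ℕ) (a : ℕ → ℂ) :
    ∫ u in (0 : ℝ)..1, ∑ i ∈ Finset.range n, a i * (u : ℂ) ^ i =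
      ∑ i ∈ Finset.range n, a i / (i + 1) := by
  rw [intervalIntegral.integral_finsetSum
    (fun i _ => Continuous.intervalIntegrable (by fun_prop) _ _)]
  refine Finset.sum_congr rfl fun i _ => ?_
  rw [intervalIntegral.integral_const_mul]
  have : ∫ u in (0 : ℝ)..1, (u : ℂ) ^ i = ((∫ u in (0 : ℝ)..1, u ^ i : ℝ) : ℂ) := by
    rw [← intervalIntegral.integral_ofReal]; simp
  rw [this, integral_pow]
  simp [div_eq_mul_inv]

theorem integral_cubic_mul_cubic (a b c d p q r s : ℂ) :
    ∫ u in (0 : ℝ)..1, (a + b * u + c * u ^ 2 + d * u ^ 3) * (p + q * u + r * u ^ 2 + s * u ^ 3) =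
      a * p + (a * q + b * p) / 2 + (a * r + b * q + c * p) / 3 +
      (a * s + b * r + c * q + d * p) / 4 + (b * s + c * r + d * q) / 5 + (c * s + d * r) / 6 +
      d * s / 7 := by
  have h := integral_sum_mul_pow 7 (fun
    | 0 => a * p
    | 1 => a * q + b * p
    | 2 => a * r + b * q + c * p
    | 3 => a * s + b * r + c * q + d * p
    | 4 => b * s + c * r + d * q
    | 5 => c * s + d * r
    | _ => d * s)
  simp only [Finset.sum_range_succ, Finset.sum_range_zero, zero_add, pow_zero, mul_one, pow_one,
    Nat.cast_zero, Nat.cast_one, Nat.cast_ofNat, div_one] at h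
  norm_num at h
  rw [← h]
  refine intervalIntegral.integral_congr fun u _ => ?_
  ring

/-- The polynomial dual on `[0, 1]` to the first piece of the cubic B-spline. -/
noncomputable def dualPoly (u : ℝ) : ℂ := -184 + 2460 * u - 6600 * u ^ 2 + 4620 * u ^ 3

/-- `dualPoly` is the cubic whose integral over [0, 1] against u³/6 is one and against the other
three pieces of Q₄ is zero, so one cell determines c m. -/
theorem coeff_eq_integral (c : ℤ → ℂ) (m : ℤ) :
    c m = ∫ x in (m : ℝ)..(m + 1), dualPoly (x - m) * splineSeries c x := by
  obtain ⟨G, hG⟩ : ∃ G : ℝ → ℂ, G = fun u : ℝ =>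
      (-184 + 2460 * u + (-6600) * u ^ 2 + 4620 * u ^ 3) *
        ((c (m - 1) + 4 * c (m - 2) + c (m - 3)) / 6 + (c (m - 1) - c (m - 3)) / 2 * u +
          (c (m - 1) - 2 * c (m - 2) + c (m - 3)) / 2 * u ^ 2 +
          (c m - 3 * c (m - 1) + 3 * c (m - 2) - c (m - 3)) / 6 * u ^ 3) := ⟨_, rfl⟩
  have h1 : ∫ x in (m : ℝ)..(m + 1), dualPoly (x - m) * splineSeries c x =
      ∫ x in (m : ℝ)..(m + 1), G (x - m) := by
    refine intervalIntegral.integral_congr fun x hx => ?_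
    rw [Set.uIcc_of_le (by linarith)] at hx
    simp only [dualPoly, hG]
    rw [splineSeries_cell c hx.1 hx.2, cubicBSpline_piece_zero (by linarith [hx.1])
      (by linarith [hx.2]), cubicBSpline_piece_one (by linarith [hx.1]) (by linarith [hx.2]),
      cubicBSpline_piece_two (by linarith [hx.1]) (by linarith [hx.2]),
      cubicBSpline_piece_three (by linarith [hx.1]) (by linarith [hx.2])]
    push_cast
    ring
  rw [h1, intervalIntegral.integral_comp_sub_right G (m : ℝ), hG, sub_self, add_sub_cancel_left,
    integral_cubic_mul_cubic]
  ring

theorem norm_dualPoly_le {u : ℝ} (h0 : 0 ≤ u) (h1 : u ≤ 1) : ‖dualPoly u‖ ≤ 14000 := by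
  have : dualPoly u = ((-184 + 2460 * u - 6600 * u ^ 2 + 4620 * u ^ 3 : ℝ) : ℂ) := by
    rw [dualPoly]; push_cast; ring
  rw [this, Complex.norm_real, Real.norm_eq_abs, abs_le]
  have e2 : u ^ 2 ≤ 1 := by nlinarith
  have e3 : u ^ 3 ≤ 1 := pow_le_one₀ h0 h1
  have e4 : 0 ≤ u ^ 3 := by positivity
  have e5 : 0 ≤ u ^ 2 := by positivity
  constructor <;> linarith

/-- Cauchy-Schwarz on an interval of length one, applied to the local formula for c m. -/
theorem enorm_coeff_sq_le (c : ℤ → ℂ) (m : ℤ) :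
    ‖c m‖ₑ ^ 2 ≤ 14000 ^ 2 * ∫⁻ x in Set.Ico (m : ℝ) (m + 1), ‖splineSeries c x‖ₑ ^ 2 := by
  have hle : (m : ℝ) ≤ m + 1 := by linarith
  have hF := (measurable_splineSeries c).enorm
  have h1 : ‖c m‖ₑ ≤ 14000 * ∫⁻ x in Set.Ico (m : ℝ) (m + 1), ‖splineSeries c x‖ₑ := by
    conv_lhs => rw [coeff_eq_integral c m]
    rw [intervalIntegral.integral_of_le hle, ← integral_Ico_eq_integral_Ioc,
      ← lintegral_const_mul _ hF]
    refine (enorm_integral_le_lintegral_enorm _).trans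
      (setLIntegral_mono' measurableSet_Ico fun x hx => ?_)
    rw [enorm_mul]
    refine mul_le_mul_left ?_ _
    rw [← ofReal_norm, ← ENNReal.ofReal_ofNat]
    exact ENNReal.ofReal_le_ofReal (norm_dualPoly_le (by linarith [hx.1]) (by linarith [hx.2]))
  have h2 : (∫⁻ x in Set.Ico (m : ℝ) (m + 1), ‖splineSeries c x‖ₑ) ^ 2 ≤
      ∫⁻ x in Set.Ico (m : ℝ) (m + 1), ‖splineSeries c x‖ₑ ^ 2 := by
    have := ENNReal.lintegral_mul_le_Lp_mul_Lq (volume.restrict (Set.Ico (m : ℝ) (m + 1)))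
      Real.HolderConjugate.two_two hF.aemeasurable (aemeasurable_const (b := (1 : ℝ≥0∞)))
    simp only [Pi.mul_apply, mul_one, lintegral_const, Measure.restrict_apply_univ,
      Real.volume_Ico, add_sub_cancel_left, ENNReal.ofReal_one, ENNReal.rpow_ofNat, one_pow,
      ENNReal.one_rpow] at this
    exact (pow_le_pow_left' this 2).trans_eq (ENNReal.rpow_half_sq _)
  calc ‖c m‖ₑ ^ 2 ≤ (14000 * ∫⁻ x in Set.Ico (m : ℝ) (m + 1), ‖splineSeries c x‖ₑ) ^ 2 :=
        pow_le_pow_left' h1 2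
    _ ≤ _ := by rw [mul_pow]; exact mul_le_mul_right h2 _

theorem tsum_enorm_sq_le_lintegral (c : ℤ → ℂ) :
    ∑' n, ‖c n‖ₑ ^ 2 ≤ 14000 ^ 2 * ∫⁻ x, ‖splineSeries c x‖ₑ ^ 2 := by
  rw [lintegral_eq_tsum_Ico 0 one_pos, ← ENNReal.tsum_mul_left]
  refine ENNReal.tsum_le_tsum fun m => (enorm_coeff_sq_le c m).trans_eq ?_
  simp

theorem aestronglyMeasurable_splineSeries (c : ℤ → ℂ) :
    AEStronglyMeasurable (splineSeries c) volume :=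
  (measurable_splineSeries c).aestronglyMeasurable

theorem memLp_splineSeries {c : ℤ → ℂ} (hc : Memℓp c 2) : MemLp (splineSeries c) 2 volume := by
  refine ⟨aestronglyMeasurable_splineSeries c, ?_⟩
  have h : eLpNorm (splineSeries c) 2 volume ^ 2 < ⊤ := by
    rw [eLpNorm_two_sq]
    exact (lintegral_splineSeries_sq_le c).trans_lt
      (ENNReal.mul_lt_top (by norm_num) (memℓp_two_iff.1 hc).lt_top)
  exact (ENNReal.pow_lt_top_iff.1 h).resolve_right two_ne_zero

theorem splineSeries_mem {c : ℤ → ℂ} (hc : Memℓp c 2) :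
    splineSeries c ∈ shiftInvariantSpace cubicBSpline :=
  ⟨memLp_splineSeries hc, c, hc, hasSum_splineSeries c⟩

theorem riesz_bounds_cubicBSpline {d : ℤ → ℂ} (hd : Memℓp d 2) :
    ENNReal.ofReal ((14000 ^ 2 : ℝ)⁻¹ * ∑' n : ℤ, ‖d n‖ ^ 2) ≤
        eLpNorm (splineSeries d) 2 volume ^ 2 ∧
      eLpNorm (splineSeries d) 2 volume ^ 2 ≤ ENNReal.ofReal (16 * ∑' n : ℤ, ‖d n‖ ^ 2) := by
  rw [ENNReal.ofReal_mul (by positivity), ENNReal.ofReal_mul (by positivity),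
    ← tsum_enorm_sq hd, eLpNorm_two_sq]
  constructor
  · rw [ENNReal.ofReal_inv_of_pos (by positivity), ENNReal.inv_mul_le_iff (by simp) (by simp)]
    refine (tsum_enorm_sq_le_lintegral d).trans_eq ?_
    rw [ENNReal.ofReal_pow (by norm_num), ENNReal.ofReal_ofNat]
  · rw [ENNReal.ofReal_ofNat]
    exact lintegral_splineSeries_sq_le d

/-! ### The synthesis operator and the closed span of the translates. -/

theorem splineSeries_add (c d : ℤ → ℂ) : splineSeries (c + d) = splineSeries c + splineSeries d := by
  ext x
  have h := (hasSum_splineSeries c x).add (hasSum_splineSeries d x)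
  refine (hasSum_splineSeries (c + d) x).unique ?_
  simpa only [Pi.add_apply, add_mul] using h

theorem splineSeries_smul (a : ℂ) (c : ℤ → ℂ) : splineSeries (a • c) = a • splineSeries c := by
  ext x
  have h := (hasSum_splineSeries c x).mul_left a
  refine (hasSum_splineSeries (a • c) x).unique ?_
  simpa only [Pi.smul_apply, smul_eq_mul, mul_assoc] using h

theorem splineSeries_single (n : ℤ) :
    splineSeries (Pi.single n 1) = fun x => cubicBSpline (x - n) := by
  ext x
  refine (hasSum_splineSeries _ x).unique ?_
  refine (congrArg (fun f => HasSum f _) (funext fun k => ?_)).mp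
    (hasSum_ite_eq n (cubicBSpline (x - n)))
  by_cases h : k = n
  · subst h; simp
  · simp [h]

/-- The synthesis operator `ℓ² → L²` of the cubic B-spline. -/
noncomputable def synthesis : lp (fun _ : ℤ => ℂ) 2 →ₗ[ℂ] Lp ℂ 2 (volume : Measure ℝ) where
  toFun c := (memLp_splineSeries (lp.memℓp c)).toLp _
  map_add' c d := by
    rw [← MemLp.toLp_add]
    congr 1
    exact splineSeries_add c d
  map_smul' a c := by
    rw [RingHom.id_apply, ← MemLp.toLp_const_smul]
    congr 1
    exact splineSeries_smul a c

theorem synthesis_ae (c : lp (fun _ : ℤ => ℂ) 2) :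
    synthesis c =ᵐ[volume] splineSeries c :=
  (memLp_splineSeries (lp.memℓp c)).coeFn_toLp

theorem enorm_synthesis (c : lp (fun _ : ℤ => ℂ) 2) :
    ENNReal.ofReal (‖synthesis c‖ ^ 2) = eLpNorm (splineSeries c) 2 volume ^ 2 := by
  rw [ENNReal.ofReal_pow (norm_nonneg _)]
  congr 1
  exact (congrArg ENNReal.ofReal (Lp.norm_toLp _ (memLp_splineSeries (lp.memℓp c)))).trans
    (ENNReal.ofReal_toReal (memLp_splineSeries (lp.memℓp c)).eLpNorm_ne_top)

theorem lp_two_norm_sq (c : lp (fun _ : ℤ => ℂ) 2) : ‖c‖ ^ 2 = ∑' n, ‖c n‖ ^ 2 := by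
  have := lp.norm_rpow_eq_tsum (p := 2) (by norm_num) c
  simpa using this

theorem norm_synthesis_le (c : lp (fun _ : ℤ => ℂ) 2) : ‖synthesis c‖ ≤ 4 * ‖c‖ := by
  have h := (riesz_bounds_cubicBSpline (lp.memℓp c)).2
  rw [← enorm_synthesis, ENNReal.ofReal_le_ofReal_iff (by positivity), ← lp_two_norm_sq] at h
  refine le_of_sq_le_sq ?_ (by positivity)
  linarith [mul_pow 4 ‖c‖ 2]

theorem norm_le_norm_synthesis (c : lp (fun _ : ℤ => ℂ) 2) : ‖c‖ ≤ 14000 * ‖synthesis c‖ := by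
  have h := (riesz_bounds_cubicBSpline (lp.memℓp c)).1
  rw [← enorm_synthesis, ENNReal.ofReal_le_ofReal_iff (by positivity), ← lp_two_norm_sq] at h
  refine le_of_sq_le_sq ?_ (by positivity)
  linarith [mul_pow 14000 ‖synthesis c‖ 2]

/-- The synthesis operator as a bounded operator. -/
noncomputable def synthesisCLM : lp (fun _ : ℤ => ℂ) 2 →L[ℂ] Lp ℂ 2 (volume : Measure ℝ) :=
  synthesis.mkContinuous 4 norm_synthesis_le

/-- The lower Riesz bound makes the operator antilipschitz on a complete space. -/
theorem isClosed_range_synthesis : IsClosed (Set.range synthesisCLM) := by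
  have h : AntilipschitzWith 14000 synthesisCLM :=
    synthesisCLM.antilipschitz_of_bound fun c => norm_le_norm_synthesis c
  exact h.isClosed_range synthesisCLM.uniformContinuous

theorem range_synthesis : Set.range synthesisCLM =
    {g : Lp ℂ 2 (volume : Measure ℝ) |
      ∃ f ∈ shiftInvariantSpace cubicBSpline, g =ᵐ[volume] f} := by
  ext g
  constructor
  · rintro ⟨c, rfl⟩
    exact ⟨_, splineSeries_mem (lp.memℓp c), synthesis_ae c⟩
  · rintro ⟨f, ⟨-, c, hc, h⟩, hg⟩
    refine ⟨⟨c, hc⟩, Lp.ext ?_⟩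
    rw [eq_splineSeries_of_hasSum h] at hg
    exact (synthesis_ae ⟨c, hc⟩).trans hg.symm

/-- Unit vectors are mapped to translates, and finitely supported sequences approximate every
element of ℓ²; the reverse inclusion is closedness of the range. -/
theorem closure_span_translates :
    closure (Submodule.span ℂ {g : Lp ℂ 2 (volume : Measure ℝ) |
      ∃ n : ℤ, g =ᵐ[volume] fun x => cubicBSpline (x - (n : ℝ))} :
        Set (Lp ℂ 2 (volume : Measure ℝ))) = Set.range synthesisCLM := by
  set S := {g : Lp ℂ 2 (volume : Measure ℝ) |
      ∃ n : ℤ, g =ᵐ[volume] fun x => cubicBSpline (x - (n : ℝ))}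
  have hsingle : ∀ n : ℤ, (synthesisCLM (lp.single 2 n (1 : ℂ)) : ℝ → ℂ) =ᵐ[volume]
      fun x => cubicBSpline (x - (n : ℝ)) := by
    intro n
    rw [← splineSeries_single]
    have := synthesis_ae (lp.single 2 n (1 : ℂ))
    rwa [lp.coeFn_single] at this
  apply Set.Subset.antisymm
  · refine closure_minimal ?_ isClosed_range_synthesis
    have : Submodule.span ℂ S ≤ LinearMap.range synthesisCLM.toLinearMap := by
      rw [Submodule.span_le]
      rintro g ⟨n, hg⟩
      exact ⟨lp.single 2 n (1 : ℂ), Lp.ext ((hsingle n).trans hg.symm)⟩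
    exact this
  · rintro _ ⟨c, rfl⟩
    have h := synthesisCLM.hasSum (lp.hasSum_single (p := 2) (by norm_num) c)
    refine isClosed_closure.mem_of_tendsto h (Eventually.of_forall fun s => subset_closure ?_)
    refine Submodule.sum_mem _ fun n _ => ?_
    have e : lp.single 2 n (c n) = c n • (lp.single 2 n (1 : ℂ) : lp (fun _ : ℤ => ℂ) 2) := by
      rw [← lp.single_smul, smul_eq_mul, mul_one]
    rw [e, map_smul]
    exact Submodule.smul_mem _ _ (Submodule.subset_span ⟨n, hsingle n⟩)

theorem hasCompactSupport_cubicBSpline : HasCompactSupport cubicBSpline := by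
  refine HasCompactSupport.intro (isCompact_Icc (a := (0 : ℝ)) (b := 4)) fun x hx => ?_
  rw [Set.mem_Icc, not_and_or, not_le, not_le] at hx
  rcases hx with hx | hx
  · exact cubicBSpline_of_nonpos hx.le
  · exact cubicBSpline_of_four_le hx.le

theorem isStableGenerator_cubicBSpline : IsStableGenerator cubicBSpline :=
  ⟨continuous_cubicBSpline.memLp_of_hasCompactSupport hasCompactSupport_cubicBSpline,
    closure_span_translates.trans range_synthesis, (14000 ^ 2)⁻¹, 16, by norm_num, by norm_num,
    fun _ hd => riesz_bounds_cubicBSpline hd⟩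

theorem isRegularStableGenerator_cubicBSpline : IsRegularStableGenerator 1 cubicBSpline := by
  refine ⟨isStableGenerator_cubicBSpline, contDiff_cubicBSpline, 1, one_pos, fun i hi => ?_⟩
  have hz : iteratedDeriv i cubicBSpline =ᶠ[atTop ⊔ atBot] fun _ => (0 : ℂ) := by
    have h : ∀ x : ℝ, x ≤ 0 ∨ 4 ≤ x → iteratedDeriv i cubicBSpline x = 0 := by
      intro x hx
      interval_cases i
      · rw [iteratedDeriv_zero]
        exact hx.elim cubicBSpline_of_nonpos cubicBSpline_of_four_le
      · rw [iteratedDeriv_one, deriv_cubicBSpline]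
        simp only
        rw [hx.elim cubicBSplineDeriv_of_nonpos cubicBSplineDeriv_of_four_le, Complex.ofReal_zero]
    rw [EventuallyEq, eventually_sup]
    exact ⟨(eventually_ge_atTop 4).mono fun x hx => h x (Or.inr hx),
      (eventually_le_atBot 0).mono fun x hx => h x (Or.inl hx)⟩
  exact hz.trans_isBigO (isBigO_zero _ _)

/-! ### Interpolation -/

/-- First row of ΨΨ⁻¹ = 1 on Fourier coefficients: the values of Θ₀ and Θ₁ at the node 1/2 + 2k are
δ₀(k) and 0. The companion `dualCoeff_sample_one` is the second row, for the derivatives. -/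
theorem dualCoeff_sample_zero (k : ℤ) :
    (1 / 48 * dualCoeff 0 0 k + 23 / 48 * dualCoeff 1 0 (k - 1) + 23 / 48 * dualCoeff 0 0 (k - 1) +
      1 / 48 * dualCoeff 1 0 (k - 2) = if k = 0 then 1 else 0) ∧
    1 / 48 * dualCoeff 0 1 k + 23 / 48 * dualCoeff 1 1 (k - 1) + 23 / 48 * dualCoeff 0 1 (k - 1) +
      1 / 48 * dualCoeff 1 1 (k - 2) = 0 := by
  have e1 : k - 1 + 2 = k + 1 := by ring
  have e2 : k - 2 + 1 = k - 1 := by ring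
  rw [← greenCoeff_recurrence k]
  constructor
  · simp [dualCoeff, e1, e2]; ring
  · simp [dualCoeff, e1, e2]; ring

theorem dualCoeff_sample_one (k : ℤ) :
    (1 / 8 * dualCoeff 0 0 k + 5 / 8 * dualCoeff 1 0 (k - 1) - 5 / 8 * dualCoeff 0 0 (k - 1) -
      1 / 8 * dualCoeff 1 0 (k - 2) = 0) ∧
    1 / 8 * dualCoeff 0 1 k + 5 / 8 * dualCoeff 1 1 (k - 1) - 5 / 8 * dualCoeff 0 1 (k - 1) -
      1 / 8 * dualCoeff 1 1 (k - 2) = if k = 0 then 1 else 0 := by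
  have e1 : k - 1 + 2 = k + 1 := by ring
  have e2 : k - 2 + 1 = k - 1 := by ring
  rw [← greenCoeff_recurrence k]
  constructor
  · simp [dualCoeff, e1, e2]; ring
  · simp [dualCoeff, e1, e2]; ring

/-- The `j`-th polyphase component of the coefficients of the spline interpolating the data `a`. -/
noncomputable def interpCoeff (a : ℤ → Fin 2 → ℂ) (j : Fin 2) (v : ℤ) : ℂ :=
  ∑' l : ℤ, ((dualCoeff j 0 (v - l) : ℂ) * a l 0 + (dualCoeff j 1 (v - l) : ℂ) * a l 1)

theorem exists_enorm_interpCoeff_le : ∃ C : ℝ, ∀ (a : ℤ → Fin 2 → ℂ) (j : Fin 2) (v l : ℤ),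
    ‖(dualCoeff j 0 (v - l) : ℂ) * a l 0 + (dualCoeff j 1 (v - l) : ℂ) * a l 1‖ₑ ≤
      ENNReal.ofReal C * (ENNReal.ofReal decayRatio ^ (v - l).natAbs * (‖a l 0‖ₑ + ‖a l 1‖ₑ)) := by
  obtain ⟨C, hC, hb⟩ := exists_norm_dualCoeff_le
  refine ⟨C, fun a j v l => ?_⟩
  have h : ∀ i : Fin 2, ‖(dualCoeff j i (v - l) : ℂ)‖ₑ ≤
      ENNReal.ofReal C * ENNReal.ofReal decayRatio ^ (v - l).natAbs := by
    intro i
    rw [← ENNReal.ofReal_pow decayRatio_pos.le, ← ENNReal.ofReal_mul hC.le, ← ofReal_norm,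
      Complex.norm_real]
    exact ENNReal.ofReal_le_ofReal (hb j i _)
  refine (enorm_add_le _ _).trans ?_
  rw [enorm_mul, enorm_mul, ← mul_assoc, mul_add]
  exact add_le_add (mul_le_mul_left (h 0) _) (mul_le_mul_left (h 1) _)

theorem tsum_data_sq_ne_top {a : ℤ → Fin 2 → ℂ} (ha : Summable fun n : ℤ => ∑ i, ‖a n i‖ ^ 2) :
    ∑' l, (‖a l 0‖ₑ + ‖a l 1‖ₑ) ^ 2 ≠ ⊤ := by
  have h := (ha.mul_left 2).tsum_ofReal_ne_top
  refine ne_top_of_le_ne_top h (ENNReal.tsum_le_tsum fun l => ?_)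
  rw [← ofReal_norm, ← ofReal_norm, ← ENNReal.ofReal_add (norm_nonneg _) (norm_nonneg _),
    ← ENNReal.ofReal_pow (by positivity), Fin.sum_univ_two]
  refine ENNReal.ofReal_le_ofReal ?_
  nlinarith [sq_nonneg (‖a l 0‖ - ‖a l 1‖)]

/-- Young's inequality with p = 2; it gives both convergence of the series `interpCoeff` and its
membership in ℓ². -/
theorem tsum_geomConv_data_ne_top
    {a : ℤ → Fin 2 → ℂ} (ha : Summable fun n : ℤ => ∑ i, ‖a n i‖ ^ 2) :
    ∑' v, geomConv (ENNReal.ofReal decayRatio) (fun l => ‖a l 0‖ₑ + ‖a l 1‖ₑ) v ^ 2 ≠ ⊤ := by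
  have h := tsum_geomConv_rpow_le (ENNReal.ofReal decayRatio)
    (fun l => ‖a l 0‖ₑ + ‖a l 1‖ₑ) (p := 2) (by norm_num)
  have hm := geomMass_ofReal_ne_top decayRatio_pos.le (by linarith [decayRatio_lt])
  simp only [ENNReal.rpow_ofNat] at h
  refine ne_top_of_le_ne_top ?_ h
  exact ENNReal.mul_ne_top (ENNReal.rpow_ne_top_of_nonneg (by norm_num) hm)
    (ENNReal.mul_ne_top hm (tsum_data_sq_ne_top ha))

theorem summable_interpCoeff {a : ℤ → Fin 2 → ℂ} (ha : Summable fun n : ℤ => ∑ i, ‖a n i‖ ^ 2)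
    (j : Fin 2) (v : ℤ) : Summable fun l : ℤ =>
    (dualCoeff j 0 (v - l) : ℂ) * a l 0 + (dualCoeff j 1 (v - l) : ℂ) * a l 1 := by
  obtain ⟨C, hC⟩ := exists_enorm_interpCoeff_le
  have h1 : geomConv (ENNReal.ofReal decayRatio) (fun l => ‖a l 0‖ₑ + ‖a l 1‖ₑ) v ≠ ⊤ := fun h =>
    ENNReal.ne_top_of_tsum_ne_top (tsum_geomConv_data_ne_top ha) v (by simp [h])
  have h2 : ∑' l : ℤ, ‖(dualCoeff j 0 (v - l) : ℂ) * a l 0 +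
      (dualCoeff j 1 (v - l) : ℂ) * a l 1‖ₑ ≠ ⊤ := by
    refine ne_top_of_le_ne_top ?_ (ENNReal.tsum_le_tsum fun l => hC a j v l)
    rw [ENNReal.tsum_mul_left]
    exact ENNReal.mul_ne_top ENNReal.ofReal_ne_top h1
  exact Summable.of_enorm h2

theorem tsum_enorm_interpCoeff_ne_top
    {a : ℤ → Fin 2 → ℂ} (ha : Summable fun n : ℤ => ∑ i, ‖a n i‖ ^ 2) (j : Fin 2) :
    ∑' v, ‖interpCoeff a j v‖ₑ ^ 2 ≠ ⊤ := by
  obtain ⟨C, hC⟩ := exists_enorm_interpCoeff_le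
  have h : ∀ v, ‖interpCoeff a j v‖ₑ ^ 2 ≤ ENNReal.ofReal C ^ 2 *
      geomConv (ENNReal.ofReal decayRatio) (fun l => ‖a l 0‖ₑ + ‖a l 1‖ₑ) v ^ 2 := by
    intro v
    rw [← mul_pow, geomConv, ← ENNReal.tsum_mul_left]
    exact pow_le_pow_left' ((enorm_tsum_le_tsum_enorm).trans
      (ENNReal.tsum_le_tsum fun l => hC a j v l)) 2
  refine ne_top_of_le_ne_top ?_ (ENNReal.tsum_le_tsum h)
  rw [ENNReal.tsum_mul_left]
  exact ENNReal.mul_ne_top (by simp) (tsum_geomConv_data_ne_top ha)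

theorem exists_interpolating_spline
    {a : ℤ → Fin 2 → ℂ} (ha : Summable fun n : ℤ => ∑ i, ‖a n i‖ ^ 2) :
    ∃ f ∈ shiftInvariantSpace cubicBSpline,
    ∀ n : ℤ, f (1 / 2 + 2 * (n : ℝ)) = a n 0 ∧ deriv f (1 / 2 + 2 * (n : ℝ)) = a n 1 := by
  -- Floor division sends 2v and 2v + 1 to v, so the two polyphase components are interleaved; in
  -- terms of 2v - 1 the odd one has index v - 1.
  obtain ⟨d, hd⟩ : ∃ d : ℤ → ℂ, d = fun n =>
    if Even n then interpCoeff a 0 (n / 2) else interpCoeff a 1 (n / 2) := ⟨_, rfl⟩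
  have d0 : ∀ v, d (2 * v) = interpCoeff a 0 v := fun v => by
    rw [hd]; simp
  have d1 : ∀ v, d (2 * v - 1) = interpCoeff a 1 (v - 1) := fun v => by
    have : ¬ Even (2 * v - 1) := by rw [Int.not_even_iff_odd]; exact ⟨v - 1, by ring⟩
    rw [hd]
    simp only [this, if_false]
    congr 1; omega
  have hmem : Memℓp d 2 := by
    rw [memℓp_two_iff]
    have h0 : HasSum (fun l : ℤ => ‖d (2 * l)‖ₑ ^ 2) (∑' v, ‖interpCoeff a 0 v‖ₑ ^ 2) := by
      simp only [d0]; exact ENNReal.summable.hasSum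
    have h1 : HasSum (fun l : ℤ => ‖d (2 * l - 1)‖ₑ ^ 2) (∑' v, ‖interpCoeff a 1 v‖ₑ ^ 2) := by
      simp only [d1]
      exact (Equiv.subRight (1 : ℤ)).hasSum_iff.2
        (ENNReal.summable (f := fun v => ‖interpCoeff a 1 v‖ₑ ^ 2)).hasSum
    rw [(HasSum.int_even_add_odd (f := fun n => ‖d n‖ₑ ^ 2) h0 h1).tsum_eq]
    exact ENNReal.add_ne_top.2
      ⟨tsum_enorm_interpCoeff_ne_top ha 0, tsum_enorm_interpCoeff_ne_top ha 1⟩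
  have hs := fun j v => (summable_interpCoeff ha j v).hasSum
  refine ⟨splineSeries d, splineSeries_mem hmem, fun n => ⟨?_, ?_⟩⟩
  · rw [splineSeries_sample, show 2 * n - 2 = 2 * (n - 1) by ring,
      show 2 * n - 3 = 2 * (n - 1) - 1 by ring, d0, d0, d1, d1,
      show n - 1 - 1 = n - 2 by ring]
    have h := ((((hs 0 n).mul_left (1 / 48)).add ((hs 1 (n - 1)).mul_left (23 / 48))).add
      ((hs 0 (n - 1)).mul_left (23 / 48))).add ((hs 1 (n - 2)).mul_left (1 / 48))
    refine h.unique ?_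
    refine (congrArg (fun f => HasSum f _) (funext fun l => ?_)).mp (hasSum_ite_eq n (a n 0))
    have e1 : n - 1 - l = n - l - 1 := by ring
    have e2 : n - 2 - l = n - l - 2 := by ring
    have p := congrArg (fun x : ℝ => (x : ℂ)) (dualCoeff_sample_zero (n - l)).1
    have q := congrArg (fun x : ℝ => (x : ℂ)) (dualCoeff_sample_zero (n - l)).2
    rw [apply_ite (fun x : ℝ => (x : ℂ))] at p
    push_cast at p q
    rw [e1, e2]
    have e : (if l = n then a n 0 else 0) = (if n - l = 0 then (1 : ℂ) else 0) * a l 0 := by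
      by_cases hl : l = n
      · subst hl; simp
      · rw [if_neg hl, if_neg (by omega), zero_mul]
    rw [e, ← p]
    linear_combination -a l 1 * q
  · rw [(hasDerivAt_splineSeries_sample d n).deriv, show 2 * n - 2 = 2 * (n - 1) by ring,
      show 2 * n - 3 = 2 * (n - 1) - 1 by ring, d0, d0, d1, d1,
      show n - 1 - 1 = n - 2 by ring]
    have h := ((((hs 0 n).mul_left (1 / 8)).add ((hs 1 (n - 1)).mul_left (5 / 8))).sub
      ((hs 0 (n - 1)).mul_left (5 / 8))).sub ((hs 1 (n - 2)).mul_left (1 / 8))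
    refine h.unique ?_
    refine (congrArg (fun f => HasSum f _) (funext fun l => ?_)).mp (hasSum_ite_eq n (a n 1))
    have e1 : n - 1 - l = n - l - 1 := by ring
    have e2 : n - 2 - l = n - l - 2 := by ring
    have p := congrArg (fun x : ℝ => (x : ℂ)) (dualCoeff_sample_one (n - l)).1
    have q := congrArg (fun x : ℝ => (x : ℂ)) (dualCoeff_sample_one (n - l)).2
    rw [apply_ite (fun x : ℝ => (x : ℂ))] at q
    push_cast at p q
    rw [e1, e2]
    have e : (if l = n then a n 1 else 0) = (if n - l = 0 then (1 : ℂ) else 0) * a l 1 := by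
      by_cases hl : l = n
      · subst hl; simp
      · rw [if_neg hl, if_neg (by omega), zero_mul]
    rw [e, ← q]
    linear_combination -a l 0 * p

theorem isCompleteInterpolationSet_cubicBSpline :
    IsCompleteInterpolationSet cubicBSpline 1 (fun l : ℤ => 1 / 2 + 2 * (l : ℝ)) := by
  refine ⟨isRegularStableGenerator_cubicBSpline, isUniquenessSet_cubicBSpline, fun a ha => ?_⟩
  obtain ⟨f, hf, h⟩ := exists_interpolating_spline ha
  refine ⟨f, hf, fun n i => ?_⟩
  fin_cases i
  · simpa using (h n).1
  · simpa [iteratedDeriv_one] using (h n).2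

/-! ### Weighted summation by parts -/

/-- The sum of `‖c n‖` with the geometric weight `q^{|n - k|}`. -/
noncomputable def geomSum (q : ℝ≥0∞) (k : ℤ) (v : ℤ → ℝ≥0∞) : ℝ≥0∞ :=
  ∑' n : ℤ, q ^ (n - k).natAbs * v n

theorem enorm_sub_le_sum_fwdDiff (c : ℤ → ℂ) (a : ℤ) (n : ℕ) :
    ‖c (a + n) - c a‖ₑ ≤ ∑ j ∈ Finset.range n, ‖fwdDiff 1 c (a + j)‖ₑ := by
  induction n with
  | zero => simp
  | succ n ih =>
    rw [Finset.sum_range_succ]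
    refine le_trans ?_ (add_le_add_left ih _)
    refine le_trans (le_of_eq ?_) (enorm_add_le _ _)
    congr 1
    rw [fwdDiff]
    push_cast
    rw [← add_assoc]
    ring

theorem sum_range_add_le_tsum (g : ℤ → ℝ≥0∞) (a : ℤ) (m : ℕ) :
    ∑ j ∈ Finset.range m, g (a + j) ≤ ∑' n, g n := by
  rw [← Finset.sum_image (f := g) (g := fun j : ℕ => a + (j : ℤ))
    (fun x _ y _ h => by simpa using h)]
  exact ENNReal.sum_le_tsum _

/-- Since c vanishes at k, its value at n is, up to sign, a sum of differences along the path
between k and n. For j on that path |n - j| + |j - k| = |n - k|, so the weight factors exactly into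
a kernel and a weight at j. -/
theorem pow_mul_enorm_le_geomConv (q : ℝ≥0∞) {k : ℤ} {c : ℤ → ℂ} (hc : c k = 0) (n : ℤ) :
    q ^ (n - k).natAbs * ‖c n‖ₑ ≤
      geomConv q (fun j => q ^ (j - k).natAbs * ‖fwdDiff 1 c j‖ₑ) n := by
  rcases le_total k n with h | h
  · obtain ⟨m, rfl⟩ : ∃ m : ℕ, n = k + m := ⟨(n - k).toNat, by omega⟩
    have h1 := enorm_sub_le_sum_fwdDiff c k m
    rw [hc, sub_zero] at h1
    refine (mul_le_mul_right h1 _).trans ?_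
    rw [Finset.mul_sum, geomConv]
    refine le_trans ?_ (sum_range_add_le_tsum (fun j => q ^ ((k + (m : ℤ)) - j).natAbs *
      (q ^ (j - k).natAbs * ‖fwdDiff 1 c j‖ₑ)) k m)
    refine Finset.sum_le_sum fun j hj => ?_
    rw [← mul_assoc, ← pow_add]
    rw [Finset.mem_range] at hj
    rw [show (k + (m : ℤ) - (k + j)).natAbs + (k + (j : ℤ) - k).natAbs =
      (k + (m : ℤ) - k).natAbs by omega]
  · obtain ⟨m, rfl⟩ : ∃ m : ℕ, k = n + m := ⟨(k - n).toNat, by omega⟩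
    have h1 := enorm_sub_le_sum_fwdDiff c n m
    rw [hc, zero_sub, enorm_neg] at h1
    refine (mul_le_mul_right h1 _).trans ?_
    rw [Finset.mul_sum, geomConv]
    refine le_trans ?_ (sum_range_add_le_tsum (fun j => q ^ (n - j).natAbs *
      (q ^ (j - (n + (m : ℤ))).natAbs * ‖fwdDiff 1 c j‖ₑ)) n m)
    refine Finset.sum_le_sum fun j hj => ?_
    rw [← mul_assoc, ← pow_add]
    rw [Finset.mem_range] at hj
    rw [show (n - (n + (j : ℤ))).natAbs + (n + (j : ℤ) - (n + m)).natAbs =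
      (n - (n + (m : ℤ))).natAbs by omega]

theorem geomSum_le_fwdDiff (q : ℝ≥0∞) {k : ℤ} {c : ℤ → ℂ} (hc : c k = 0) :
    geomSum q k (fun n => ‖c n‖ₑ) ≤ geomMass q * geomSum q k (fun n => ‖fwdDiff 1 c n‖ₑ) := by
  refine (ENNReal.tsum_le_tsum fun n => pow_mul_enorm_le_geomConv q hc n).trans_eq ?_
  rw [tsum_geomConv, geomSum]

/-- Four consecutive zeros make c and its first three differences vanish at k, so the one-step
estimate iterates four times. -/
theorem geomSum_le_fwdDiff_four (q : ℝ≥0∞) {k : ℤ} {c : ℤ → ℂ} (h0 : c k = 0)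
    (h1 : c (k + 1) = 0) (h2 : c (k + 2) = 0) (h3 : c (k + 3) = 0) :
    geomSum q k (fun n => ‖c n‖ₑ) ≤ geomMass q ^ 4 * geomSum q k
      (fun n => ‖c (n + 4) - 4 * c (n + 3) + 6 * c (n + 2) - 4 * c (n + 1) + c n‖ₑ) := by
  have a1 : k + 1 + 1 = k + 2 := by ring
  have a2 : k + 2 + 1 = k + 3 := by ring
  have e1 := geomSum_le_fwdDiff q h0
  have e2 := geomSum_le_fwdDiff q (k := k) (c := fwdDiff 1 c) (by simp [fwdDiff, h0, h1])
  have e3 := geomSum_le_fwdDiff q (k := k) (c := fwdDiff 1 (fwdDiff 1 c))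
    (by simp [fwdDiff, h0, h1, h2, a1])
  have e4 := geomSum_le_fwdDiff q (k := k) (c := fwdDiff 1 (fwdDiff 1 (fwdDiff 1 c)))
    (by simp [fwdDiff, h0, h1, h2, h3, a1, a2])
  have e5 : fwdDiff 1 (fwdDiff 1 (fwdDiff 1 (fwdDiff 1 c))) = fun n : ℤ =>
      c (n + 4) - 4 * c (n + 3) + 6 * c (n + 2) - 4 * c (n + 1) + c n := by
    ext n
    simp only [fwdDiff]
    rw [show n + 1 + 1 = n + 2 by ring, show n + 2 + 1 = n + 3 by ring,
      show n + 3 + 1 = n + 4 by ring]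
    ring
  rw [e5] at e4
  exact (e1.trans (mul_le_mul_right (e2.trans (mul_le_mul_right (e3.trans
    (mul_le_mul_right e4 _)) _)) _)).trans_eq (by ring)

/-! ### Local estimates by third differences of the derivative -/

/-- The third forward difference. -/
def thirdDiff (g : ℝ → ℂ) (y u : ℝ) : ℂ :=
  g (y + 3 * u) - 3 * g (y + 2 * u) + 3 * g (y + u) - g y

theorem HasDerivAt.comp_affine {e e' : ℝ → ℂ} (he : ∀ x, HasDerivAt e (e' x) x) (y h s : ℝ) :
    HasDerivAt (fun s : ℝ => e (y + s * h)) (h * e' (y + s * h)) s := by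
  have h1 : HasDerivAt (fun s : ℝ => y + s * h) h s := by
    simpa using ((hasDerivAt_id s).mul_const h).const_add y
  have := (he (y + s * h)).scomp s h1
  simpa only [Complex.real_smul, Function.comp_def] using this

/-- The auxiliary function of s below has derivative h times the third difference of e' at x with
step sh: the weights 1/3, 3/2, 3 cancel the chain rule factors 3, 2, 1. The mean value inequality on
[0, 1] suffices, with no continuity of e'. -/
theorem norm_mul_deriv_le {e e' : ℝ → ℂ} (he : ∀ x, HasDerivAt e (e' x) x) {x h ω : ℝ}
    (hω : ∀ s ∈ Set.Icc (0 : ℝ) 1, ‖thirdDiff e' x (s * h)‖ ≤ ω) :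
    |h| * ‖e' x‖ ≤ 1 / 3 * ‖e (x + 3 * h)‖ + 3 / 2 * ‖e (x + 2 * h)‖ + 3 * ‖e (x + h)‖ +
      11 / 6 * ‖e x‖ + ω * |h| := by
  have hd : ∀ s : ℝ, HasDerivAt (fun s : ℝ => (1 / 3 : ℂ) * e (x + s * (3 * h)) -
      3 / 2 * e (x + s * (2 * h)) + 3 * e (x + s * h) - s * (h * e' x))
      (h * thirdDiff e' x (s * h)) s := by
    intro s
    have h3 := (HasDerivAt.comp_affine he x (3 * h) s).const_mul (1 / 3 : ℂ)
    have h2 := (HasDerivAt.comp_affine he x (2 * h) s).const_mul (3 / 2 : ℂ)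
    have h1 := (HasDerivAt.comp_affine he x h s).const_mul (3 : ℂ)
    have h0 := (hasDerivAt_id s).ofReal_comp.mul_const ((h : ℂ) * e' x)
    refine (((h3.sub h2).add h1).sub h0).congr_deriv ?_
    rw [thirdDiff, show x + 3 * (s * h) = x + s * (3 * h) by ring,
      show x + 2 * (s * h) = x + s * (2 * h) by ring]
    push_cast
    ring
  have hm := Convex.norm_image_sub_le_of_norm_hasDerivWithin_le (C := |h| * ω)
    (fun s _ => (hd s).hasDerivWithinAt) (fun s hs => by
      rw [norm_mul, Complex.norm_real, Real.norm_eq_abs]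
      exact mul_le_mul_of_nonneg_left (hω s hs) (abs_nonneg h)) (convex_Icc (0 : ℝ) 1)
    (Set.left_mem_Icc.2 zero_le_one) (Set.right_mem_Icc.2 zero_le_one)
  simp only [zero_mul, add_zero, one_mul, sub_zero, norm_one, mul_one, Complex.ofReal_one,
    Complex.ofReal_zero] at hm
  have e1 : (h : ℂ) * e' x = (1 / 3 : ℂ) * e (x + 3 * h) + -(3 / 2 * e (x + 2 * h)) +
      3 * e (x + h) + -(11 / 6 * e x) +
      -((1 / 3 : ℂ) * e (x + 3 * h) - 3 / 2 * e (x + 2 * h) + 3 * e (x + h) - h * e' x -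
        (1 / 3 * e x - 3 / 2 * e x + 3 * e x)) := by ring
  calc |h| * ‖e' x‖ = ‖(h : ℂ) * e' x‖ := by
        rw [norm_mul, Complex.norm_real, Real.norm_eq_abs]
    _ ≤ _ := by
        rw [e1]
        refine norm_add_le_of_le (norm_add_le_of_le (norm_add_le_of_le (norm_add_le_of_le ?_ ?_)
          ?_) ?_) ?_
        · rw [norm_mul]; norm_num
        · rw [norm_neg, norm_mul]; norm_num
        · rw [norm_mul]; norm_num
        · rw [norm_neg, norm_mul]; norm_num
        · rw [norm_neg, mul_comm ω]; exact hm

/-- A fourth difference of step 2 is the increment over [y, y + 2] of the third difference, whose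
derivative is the third difference of e'. -/
theorem norm_fourthDiff_le {e e' : ℝ → ℂ} (he : ∀ x, HasDerivAt e (e' x) x) {y ω : ℝ}
    (hω : ∀ s ∈ Set.Icc (0 : ℝ) 2, ‖thirdDiff e' (y + s) 2‖ ≤ ω) :
    ‖e (y + 8) - 4 * e (y + 6) + 6 * e (y + 4) - 4 * e (y + 2) + e y‖ ≤ 2 * ω := by
  have hd : ∀ s : ℝ, HasDerivAt (fun s : ℝ => thirdDiff e (y + s) 2)
      (thirdDiff e' (y + s) 2) s := by
    intro s
    have h : ∀ a : ℝ, HasDerivAt (fun s : ℝ => e (y + s + a)) (e' (y + s + a)) s := by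
      intro a
      have := (he (s + (y + a))).comp_add_const s (y + a)
      rw [show s + (y + a) = y + s + a by ring] at this
      refine this.congr_of_eventuallyEq (Eventually.of_forall fun x => ?_)
      simp only
      congr 1; ring
    have h0 := h 0
    simp only [add_zero] at h0
    exact (((h _).sub ((h _).const_mul 3)).add ((h _).const_mul 3)).sub h0
  have hm := Convex.norm_image_sub_le_of_norm_hasDerivWithin_le
    (fun s _ => (hd s).hasDerivWithinAt) hω (convex_Icc (0 : ℝ) 2)
    (Set.left_mem_Icc.2 zero_le_two) (Set.right_mem_Icc.2 zero_le_two)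
  simp only [thirdDiff] at hm
  norm_num at hm
  rw [mul_comm 2 ω]
  refine le_trans (le_of_eq ?_) hm
  congr 1
  rw [show y + 2 + 6 = y + 8 by ring, show y + 2 + 4 = y + 6 by ring,
    show y + 2 + 2 = y + 4 by ring]
  ring

/-- A function with small third differences of its derivative which is small on a lattice is
small. -/
theorem norm_le_of_lattice_bound {e e' : ℝ → ℂ} (he : ∀ x, HasDerivAt e (e' x) x) {x₀ ω B : ℝ}
    (hω : ∀ y u : ℝ, y ∈ Set.Icc (x₀ - 96) (x₀ + 96) → y + 3 * u ∈ Set.Icc (x₀ - 96) (x₀ + 96) →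
      ‖thirdDiff e' y u‖ ≤ ω)
    (hB : ∀ l : ℤ, -48 ≤ l → l ≤ 48 → ‖e (x₀ + 2 * l)‖ ≤ B) {t : ℝ} (h0 : x₀ ≤ t)
    (h1 : t ≤ x₀ + 2) : ‖e t‖ ≤ 3 * B + 4 * ω := by
  set J := Set.Icc (x₀ - 96) (x₀ + 96) with hJ
  have hB0 : 0 ≤ B := (norm_nonneg _).trans (hB 0 (by norm_num) (by norm_num))
  have hx₀ : x₀ ∈ J := ⟨by linarith, by linarith⟩
  have hω0 : 0 ≤ ω := (norm_nonneg _).trans (hω x₀ 0 hx₀ (by simpa using hx₀))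
  -- A step of length 32 towards the centre keeps x + 3h in J, whose half-length is 96 = 3·32. The
  -- factor is (1/3 + 3/2 + 3 + 11/6)/32 = 5/24.
  have hstep : ∀ E : ℝ, (∀ y ∈ J, ‖e y‖ ≤ E) → ∀ x ∈ J, ‖e' x‖ ≤ 5 / 24 * E + ω := by
    intro E hE x hx
    obtain ⟨h, hh, hmem⟩ : ∃ h : ℝ, |h| = 32 ∧ x + 3 * h ∈ J := by
      rcases le_total x x₀ with hle | hle
      · exact ⟨32, by norm_num, by linarith [hx.1], by linarith⟩
      · exact ⟨-32, by norm_num, by linarith, by linarith [hx.2]⟩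
    have hseg : ∀ s ∈ Set.Icc (0 : ℝ) 1, x + s * (3 * h) ∈ J := by
      intro s hs
      have := (convex_Icc (x₀ - 96) (x₀ + 96)) hx hmem (sub_nonneg.2 hs.2) hs.1 (by ring)
      simp only [smul_eq_mul] at this
      rwa [show (1 - s) * x + s * (x + 3 * h) = x + s * (3 * h) by ring] at this
    have hk := norm_mul_deriv_le he (x := x) (h := h) (ω := ω) fun s hs =>
      hω x (s * h) hx (by rw [show 3 * (s * h) = s * (3 * h) by ring]; exact hseg s hs)
    have p1 := hE _ (hseg (1 / 3) (by norm_num))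
    have p2 := hE _ (hseg (2 / 3) (by norm_num))
    rw [show 1 / 3 * (3 * h) = h by ring] at p1
    rw [show 2 / 3 * (3 * h) = 2 * h by ring] at p2
    have p3 := hE _ hmem
    have p0 := hE _ hx
    rw [hh] at hk
    linarith
  have hval : ∀ M : ℝ, (∀ x ∈ J, ‖e' x‖ ≤ M) → ∀ y ∈ J, ‖e y‖ ≤ B + 2 * M := by
    intro M hM y hy
    have hM0 : 0 ≤ M := (norm_nonneg _).trans (hM x₀ hx₀)
    have f0 := Int.floor_le ((y - x₀) / 2)
    have f1 := Int.lt_floor_add_one ((y - x₀) / 2)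
    set l := ⌊(y - x₀) / 2⌋
    have l0 : -48 ≤ l := Int.le_floor.2 (by push_cast; linarith [hy.1])
    have l1 : l ≤ 48 := by
      have : (l : ℝ) ≤ 48 := by linarith [hy.2]
      exact_mod_cast this
    have l0' : (-48 : ℝ) ≤ l := by exact_mod_cast l0
    have l1' : (l : ℝ) ≤ 48 := by exact_mod_cast l1
    have hz : x₀ + 2 * (l : ℝ) ∈ J := ⟨by linarith, by linarith⟩
    have hm := Convex.norm_image_sub_le_of_norm_hasDerivWithin_le
      (fun s _ => (he s).hasDerivWithinAt) hM (convex_Icc (x₀ - 96) (x₀ + 96)) hz hy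
    have hyz : ‖y - (x₀ + 2 * (l : ℝ))‖ ≤ 2 := by
      rw [Real.norm_eq_abs, abs_le]; constructor <;> linarith
    have e1 : e y = e (x₀ + 2 * (l : ℝ)) + (e y - e (x₀ + 2 * (l : ℝ))) := by ring
    rw [e1]
    refine norm_add_le_of_le (hB l l0 l1) (hm.trans ?_)
    rw [mul_comm]
    exact mul_le_mul_of_nonneg_right hyz hM0
  -- As e' need not be continuous, its boundedness on J comes from that of e; finiteness of M is
  -- what permits absorption.
  obtain ⟨E, hE⟩ := (isCompact_Icc (a := x₀ - 96) (b := x₀ + 96)).exists_bound_of_continuousOn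
    (fun x _ => (he x).continuousAt.continuousWithinAt)
  have hbdd : BddAbove ((fun x => ‖e' x‖) '' J) :=
    ⟨5 / 24 * E + ω, by rintro _ ⟨x, hx, rfl⟩; exact hstep E hE x hx⟩
  set M := sSup ((fun x => ‖e' x‖) '' J)
  have hM : ∀ x ∈ J, ‖e' x‖ ≤ M := fun x hx => le_csSup hbdd ⟨x, hx, rfl⟩
  -- The coefficient 10/24 of M is below one, so M is absorbed and bounded by B and ω. The large
  -- window was chosen for this.
  have hM2 : M ≤ 5 / 24 * (B + 2 * M) + ω := by
    refine csSup_le ⟨_, x₀, hx₀, rfl⟩ ?_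
    rintro _ ⟨x, hx, rfl⟩
    exact hstep _ (hval M hM) x hx
  have := hval M hM t ⟨by linarith, by linarith⟩
  linarith

/-! ### The pointwise error of the sampling series -/

theorem hasDerivAt_eval_ofReal (P : Polynomial ℂ) (x : ℝ) :
    HasDerivAt (fun x : ℝ => P.eval (x : ℂ)) (P.derivative.eval (x : ℂ)) x :=
  (P.hasDerivAt (x : ℂ)).comp_ofReal

theorem thirdDiff_derivative_eq_zero {P : Polynomial ℂ} (hP : P.natDegree ≤ 3) (y u : ℝ) :
    thirdDiff (fun x : ℝ => P.derivative.eval (x : ℂ)) y u = 0 := by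
  have hd : P.derivative.natDegree < 3 :=
    (Polynomial.natDegree_derivative_le P).trans_lt (by omega)
  have h : ∀ x : ℂ, P.derivative.eval x =
      P.derivative.coeff 0 + P.derivative.coeff 1 * x + P.derivative.coeff 2 * x ^ 2 := by
    intro x
    rw [Polynomial.eval_eq_sum_range' hd]
    simp [Finset.sum_range_succ]
  simp only [thirdDiff, h]
  push_cast
  ring

theorem exists_cubic_interpolation (b : ℤ → ℂ) (k : ℤ) : ∃ P : Polynomial ℂ, P.natDegree ≤ 3 ∧
    ∀ j : ℤ, 0 ≤ j → j ≤ 3 → P.eval ((1 / 2 + 2 * ((k + j : ℤ) : ℝ) : ℝ) : ℂ) = b (k + j) := by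
  classical
  obtain ⟨v, hv⟩ : ∃ v : ℤ → ℂ, ∀ j, v j = ((1 / 2 + 2 * ((k + j : ℤ) : ℝ) : ℝ) : ℂ) :=
    ⟨_, fun _ => rfl⟩
  have hinj : Set.InjOn v (Finset.Icc (0 : ℤ) 3) := by
    intro x _ y _ hxy
    rw [hv, hv] at hxy
    have h : (1 / 2 + 2 * ((k + x : ℤ) : ℝ) : ℝ) = 1 / 2 + 2 * ((k + y : ℤ) : ℝ) :=
      Complex.ofReal_injective hxy
    have h' : ((k + x : ℤ) : ℝ) = ((k + y : ℤ) : ℝ) := by linarith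
    have h'' : k + x = k + y := by exact_mod_cast h'
    omega
  refine ⟨Lagrange.interpolate (Finset.Icc (0 : ℤ) 3) v (fun j => b (k + j)), ?_,
    fun j h0 h1 => ?_⟩
  · have := Lagrange.degree_interpolate_lt (fun j => b (k + j)) hinj
    rw [Int.card_Icc] at this
    refine Polynomial.natDegree_le_of_degree_le ?_
    have h4 : ((Polynomial.degree _ : WithBot ℕ) < ((3 + 1 : ℕ) : WithBot ℕ)) := this
    exact Order.le_of_lt_succ h4
  · rw [← hv]
    exact Lagrange.eval_interpolate_at_node (fun j => b (k + j)) hinj (Finset.mem_Icc.2 ⟨h0, h1⟩)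

/-- Reindexing moves the shift into the weight, and |n - k| ≤ |n - j - k| + 3. -/
theorem geomSum_shift_le {q : ℝ≥0∞} (h0 : q ≠ 0) (h1 : q ≤ 1) (k : ℤ) (v : ℤ → ℝ≥0∞) {j : ℤ}
    (hj0 : 0 ≤ j) (hj : j ≤ 3) :
    geomSum q k (fun l => v (l + j)) ≤ (q ^ 3)⁻¹ * geomSum q k v := by
  have hq : q ≠ ⊤ := ne_top_of_le_ne_top ENNReal.one_ne_top h1
  have e : geomSum q k (fun l => v (l + j)) = ∑' n : ℤ, q ^ (n - j - k).natAbs * v n := by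
    rw [geomSum, ← (Equiv.addRight j).tsum_eq fun n : ℤ => q ^ (n - j - k).natAbs * v n]
    simp
  rw [e, geomSum, ← ENNReal.tsum_mul_left]
  refine ENNReal.tsum_le_tsum fun n => ?_
  rw [← mul_assoc]
  refine mul_le_mul_left ?_ _
  rw [← ENNReal.div_eq_inv_mul, ENNReal.le_div_iff_mul_le (Or.inl (pow_ne_zero _ h0))
    (Or.inl (ENNReal.pow_ne_top hq)), ← pow_add]
  exact pow_le_pow_right_of_le_one' h1 (by omega)

theorem le_inv_pow_mul_geomSum {q : ℝ≥0∞} (h0 : q ≠ 0) (h1 : q ≤ 1) (k : ℤ) (v : ℤ → ℝ≥0∞)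
    {l : ℤ} {N : ℕ} (hl : (l - k).natAbs ≤ N) : v l ≤ (q ^ N)⁻¹ * geomSum q k v := by
  have hq : q ≠ ⊤ := ne_top_of_le_ne_top ENNReal.one_ne_top h1
  rw [← ENNReal.div_eq_inv_mul, ENNReal.le_div_iff_mul_le (Or.inl (pow_ne_zero _ h0))
    (Or.inl (ENNReal.pow_ne_top hq)), mul_comm]
  refine (mul_le_mul_left (pow_le_pow_right_of_le_one' h1 hl) _).trans ?_
  exact ENNReal.le_tsum (f := fun l => q ^ (l - k).natAbs * v l) l

theorem enorm_le_of_norm_le_toReal {z : ℂ} {a : ℝ≥0∞} (h : ‖z‖ ≤ a.toReal) :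
    ‖z‖ₑ ≤ a := by
  rw [← ofReal_norm]
  exact ENNReal.ofReal_le_of_le_toReal h

theorem norm_le_toReal_of_enorm_le {z : ℂ} {a : ℝ≥0∞} (ha : a ≠ ⊤) (h : ‖z‖ₑ ≤ a) :
    ‖z‖ ≤ a.toReal := by
  rw [← toReal_enorm]
  exact ENNReal.toReal_mono ha h

theorem enorm_fourthDiff_lattice_le {e e' : ℝ → ℂ} {ω : ℤ → ℝ≥0∞}
    (he : ∀ x, HasDerivAt e (e' x) x)
    (hω : ∀ (l : ℤ) (y u : ℝ), y ∈ Set.Icc (1 / 2 + 2 * (l : ℝ) - 96) (1 / 2 + 2 * (l : ℝ) + 96) →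
      y + 3 * u ∈ Set.Icc (1 / 2 + 2 * (l : ℝ) - 96) (1 / 2 + 2 * (l : ℝ) + 96) →
      ‖thirdDiff e' y u‖ₑ ≤ ω l) {b : ℤ → ℂ} (hb : ∀ l : ℤ, b l = e (1 / 2 + 2 * (l : ℝ))) (l : ℤ) :
    ‖b (l + 4) - 4 * b (l + 3) + 6 * b (l + 2) - 4 * b (l + 1) + b l‖ₑ ≤ 2 * ω l := by
  -- Local moduli may be infinite; the real-valued estimates are applied only at finite ones.
  by_cases hl : ω l = ⊤
  · rw [hl, ENNReal.mul_top two_ne_zero]; exact le_top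
  refine enorm_le_of_norm_le_toReal ?_
  have h := norm_fourthDiff_le he (y := 1 / 2 + 2 * (l : ℝ)) (ω := (ω l).toReal) fun s hs =>
    norm_le_toReal_of_enorm_le hl (hω l _ _ ⟨by linarith [hs.1], by linarith [hs.2]⟩
      ⟨by linarith [hs.1], by linarith [hs.2]⟩)
  rw [ENNReal.toReal_mul, ENNReal.toReal_ofNat]
  have e4 : 1 / 2 + 2 * (l : ℝ) + 8 = 1 / 2 + 2 * ((l + 4 : ℤ) : ℝ) := by push_cast; ring
  have e3 : 1 / 2 + 2 * (l : ℝ) + 6 = 1 / 2 + 2 * ((l + 3 : ℤ) : ℝ) := by push_cast; ring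
  have e2 : 1 / 2 + 2 * (l : ℝ) + 4 = 1 / 2 + 2 * ((l + 2 : ℤ) : ℝ) := by push_cast; ring
  have e1 : 1 / 2 + 2 * (l : ℝ) + 2 = 1 / 2 + 2 * ((l + 1 : ℤ) : ℝ) := by push_cast; ring
  rwa [e4, e3, e2, e1, ← hb, ← hb, ← hb, ← hb, ← hb] at h

theorem enorm_deriv_lattice_le {e e' : ℝ → ℂ} {ω : ℤ → ℝ≥0∞}
    (he : ∀ x, HasDerivAt e (e' x) x)
    (hω : ∀ (l : ℤ) (y u : ℝ), y ∈ Set.Icc (1 / 2 + 2 * (l : ℝ) - 96) (1 / 2 + 2 * (l : ℝ) + 96) →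
      y + 3 * u ∈ Set.Icc (1 / 2 + 2 * (l : ℝ) - 96) (1 / 2 + 2 * (l : ℝ) + 96) →
      ‖thirdDiff e' y u‖ₑ ≤ ω l) {b : ℤ → ℂ} (hb : ∀ l : ℤ, b l = e (1 / 2 + 2 * (l : ℝ))) (l : ℤ) :
    ‖e' (1 / 2 + 2 * (l : ℝ))‖ₑ ≤
      2 * (‖b (l + 3)‖ₑ + ‖b (l + 2)‖ₑ + ‖b (l + 1)‖ₑ + ‖b (l + 0)‖ₑ) + ω l := by
  by_cases hl : ω l = ⊤
  · simp [hl]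
  have h := norm_mul_deriv_le he (x := 1 / 2 + 2 * (l : ℝ)) (h := 2) (ω := (ω l).toReal) fun s hs =>
    norm_le_toReal_of_enorm_le hl (hω l _ _ ⟨by linarith [hs.1], by linarith [hs.2]⟩
      ⟨by linarith [hs.1], by linarith [hs.2]⟩)
  have e3 : 1 / 2 + 2 * (l : ℝ) + 3 * 2 = 1 / 2 + 2 * ((l + 3 : ℤ) : ℝ) := by push_cast; ring
  have e2 : 1 / 2 + 2 * (l : ℝ) + 2 * 2 = 1 / 2 + 2 * ((l + 2 : ℤ) : ℝ) := by push_cast; ring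
  have e1 : 1 / 2 + 2 * (l : ℝ) + 2 = 1 / 2 + 2 * ((l + 1 : ℤ) : ℝ) := by push_cast; ring
  rw [e3, e2, e1, ← hb, ← hb, ← hb, ← hb, abs_two] at h
  rw [add_zero]
  refine enorm_le_of_norm_le_toReal ?_
  rw [ENNReal.toReal_add (by finiteness) hl, ENNReal.toReal_mul,
    ENNReal.toReal_add (by finiteness) (by finiteness),
    ENNReal.toReal_add (by finiteness) (by finiteness),
    ENNReal.toReal_add (by finiteness) (by finiteness)]
  simp only [toReal_enorm, ENNReal.toReal_ofNat]
  linarith [norm_nonneg (b (l + 3)), norm_nonneg (b (l + 2)), norm_nonneg (b (l + 1)),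
    norm_nonneg (b l)]

theorem exists_sampling_error_bound : ∃ C : ℝ≥0∞, C ≠ ⊤ ∧ ∀ (F G : ℝ → ℂ) (ω : ℤ → ℝ≥0∞),
    (∀ x, HasDerivAt F (G x) x) →
    (∀ (l : ℤ) (y u : ℝ), y ∈ Set.Icc (1 / 2 + 2 * (l : ℝ) - 96) (1 / 2 + 2 * (l : ℝ) + 96) →
      y + 3 * u ∈ Set.Icc (1 / 2 + 2 * (l : ℝ) - 96) (1 / 2 + 2 * (l : ℝ) + 96) →
      ‖thirdDiff G y u‖ₑ ≤ ω l) →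
    ∀ (k : ℤ) (t : ℝ), 1 / 2 + 2 * (k : ℝ) ≤ t → t ≤ 1 / 2 + 2 * (k : ℝ) + 2 →
      Summable (hermiteTerm F t) →
      ‖∑' l, hermiteTerm F t l - F t‖ₑ ≤ C * geomSum (ENNReal.ofReal decayRatio) k ω := by
  obtain ⟨K, hK, hΘ⟩ := exists_norm_reconstructionFun_le
  set q := ENNReal.ofReal decayRatio with hq
  have q0 : q ≠ 0 := by rw [hq, Ne, ENNReal.ofReal_eq_zero, not_le]; exact decayRatio_pos
  have q1 : q ≤ 1 := ENNReal.ofReal_le_one.2 (by linarith [decayRatio_lt])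
  have qm : geomMass q ≠ ⊤ := geomMass_ofReal_ne_top decayRatio_pos.le (by linarith [decayRatio_lt])
  have i3 : (q ^ 3)⁻¹ ≠ ⊤ := ENNReal.inv_ne_top.2 (pow_ne_zero _ q0)
  have i48 : (q ^ 48)⁻¹ ≠ ⊤ := ENNReal.inv_ne_top.2 (pow_ne_zero _ q0)
  set D : ℝ≥0∞ := geomMass q ^ 4 * 2 with hD
  have hDt : D ≠ ⊤ := by finiteness
  -- The first summand bounds the series of e (node values, then node derivatives, estimated through
  -- four shifted values); the second bounds e(t) by `norm_le_of_lattice_bound`, which looks at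
  -- nodes up to distance 48.
  refine ⟨ENNReal.ofReal K * (D + (8 * ((q ^ 3)⁻¹ * D) + 1)) + (3 * ((q ^ 48)⁻¹ * D) + 4),
    by finiteness, fun F G ω hF hG k t ht0 ht1 hs => ?_⟩
  set S := geomSum q k ω with hS
  by_cases hSt : S = ⊤
  · rw [hSt, ENNReal.mul_top (by simp)]; exact le_top
  obtain ⟨P, hP3, hPb⟩ := exists_cubic_interpolation (fun l => F (1 / 2 + 2 * (l : ℝ))) k
  obtain ⟨e, he_def⟩ : ∃ e : ℝ → ℂ, e = fun x => F x - P.eval (x : ℂ) := ⟨_, rfl⟩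
  obtain ⟨e', he'_def⟩ : ∃ e' : ℝ → ℂ, e' = fun x : ℝ => G x - P.derivative.eval (x : ℂ) :=
    ⟨_, rfl⟩
  have he : ∀ x, HasDerivAt e (e' x) x := fun x => by
    rw [he_def, he'_def]; exact (hF x).sub (hasDerivAt_eval_ofReal P x)
  have hω : ∀ (l : ℤ) (y u : ℝ),
      y ∈ Set.Icc (1 / 2 + 2 * (l : ℝ) - 96) (1 / 2 + 2 * (l : ℝ) + 96) →
      y + 3 * u ∈ Set.Icc (1 / 2 + 2 * (l : ℝ) - 96) (1 / 2 + 2 * (l : ℝ) + 96) →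
      ‖thirdDiff e' y u‖ₑ ≤ ω l := by
    intro l y u hy hu
    -- P' has degree at most 2, so third differences do not see it.
    have h1 : thirdDiff e' y u = thirdDiff G y u := by
      have := thirdDiff_derivative_eq_zero hP3 y u
      simp only [thirdDiff, he'_def] at this ⊢
      linear_combination -this
    rw [h1]; exact hG l y u hy hu
  obtain ⟨b, hb⟩ : ∃ b : ℤ → ℂ, ∀ l : ℤ, b l = e (1 / 2 + 2 * (l : ℝ)) := ⟨_, fun _ => rfl⟩
  have hb0 : ∀ j : ℤ, 0 ≤ j → j ≤ 3 → b (k + j) = 0 := fun j h0 h1 => by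
    rw [hb, he_def]; simp only; rw [hPb j h0 h1, sub_self]
  have hB : geomSum q k (fun n => ‖b n‖ₑ) ≤ D * S := by
    refine (geomSum_le_fwdDiff_four q (by simpa using hb0 0 le_rfl (by norm_num))
      (hb0 1 (by norm_num) (by norm_num)) (hb0 2 (by norm_num) (by norm_num))
      (hb0 3 (by norm_num) le_rfl)).trans ?_
    rw [hD, mul_assoc]
    refine mul_le_mul_right ?_ _
    rw [hS, geomSum, geomSum, ← ENNReal.tsum_mul_left]
    refine ENNReal.tsum_le_tsum fun n => ?_
    rw [mul_left_comm]
    exact mul_le_mul_right (enorm_fourthDiff_lattice_le he hω hb n) _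
  have hterm : ∀ l, ‖hermiteTerm e t l‖ₑ ≤ ENNReal.ofReal K * (q ^ (l - k).natAbs * (‖b l‖ₑ +
      (2 * (‖b (l + 3)‖ₑ + ‖b (l + 2)‖ₑ + ‖b (l + 1)‖ₑ + ‖b (l + 0)‖ₑ) + ω l))) := by
    intro l
    have hΘ' : ∀ i : Fin 2, ‖Θ i (t - 2 * (l : ℝ))‖ₑ ≤
        ENNReal.ofReal K * q ^ (l - k).natAbs := by
      intro i
      rw [hq, ← ENNReal.ofReal_pow decayRatio_pos.le, ← ENNReal.ofReal_mul hK.le, ← ofReal_norm,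
        show (l - k).natAbs = (k - l).natAbs by omega]
      exact ENNReal.ofReal_le_ofReal (hΘ i (k - l) _ (by push_cast; linarith)
        (by push_cast; linarith))
    rw [hermiteTerm, (he _).deriv, ← hb]
    refine (enorm_add_le _ _).trans ?_
    rw [enorm_mul, enorm_mul, ← mul_assoc, mul_add, mul_comm ‖b l‖ₑ, mul_comm ‖e' _‖ₑ]
    exact add_le_add (mul_le_mul_left (hΘ' 0) _)
      (mul_le_mul' (hΘ' 1) (enorm_deriv_lattice_le he hω hb l))
  have hsum : ∑' l, ‖hermiteTerm e t l‖ₑ ≤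
      ENNReal.ofReal K * (D * S + (2 * (4 * ((q ^ 3)⁻¹ * (D * S))) + S)) := by
    refine (ENNReal.tsum_le_tsum hterm).trans ?_
    rw [ENNReal.tsum_mul_left]
    refine mul_le_mul_right ?_ _
    have hshift : ∀ j : ℤ, 0 ≤ j → j ≤ 3 → geomSum q k (fun l => ‖b (l + j)‖ₑ) ≤
        (q ^ 3)⁻¹ * (D * S) := fun j h0 h1 =>
      (geomSum_shift_le q0 q1 k (fun l => ‖b l‖ₑ) h0 h1).trans (mul_le_mul_right hB _)
    have hsplit : ∑' l : ℤ, q ^ (l - k).natAbs * (‖b l‖ₑ +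
        (2 * (‖b (l + 3)‖ₑ + ‖b (l + 2)‖ₑ + ‖b (l + 1)‖ₑ + ‖b (l + 0)‖ₑ) + ω l)) =
        geomSum q k (fun l => ‖b l‖ₑ) + (2 * (geomSum q k (fun l => ‖b (l + 3)‖ₑ) +
          geomSum q k (fun l => ‖b (l + 2)‖ₑ) + geomSum q k (fun l => ‖b (l + 1)‖ₑ) +
          geomSum q k (fun l => ‖b (l + 0)‖ₑ)) + S) := by
      simp only [hS, geomSum, ← ENNReal.tsum_add, ← ENNReal.tsum_mul_left]
      refine tsum_congr fun l => ?_
      ring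
    rw [hsplit]
    refine add_le_add hB (add_le_add_left (mul_le_mul_right ?_ _) _)
    calc _ ≤ (q ^ 3)⁻¹ * (D * S) + (q ^ 3)⁻¹ * (D * S) + (q ^ 3)⁻¹ * (D * S) +
          (q ^ 3)⁻¹ * (D * S) :=
          add_le_add (add_le_add (add_le_add (hshift 3 (by norm_num) le_rfl)
            (hshift 2 (by norm_num) (by norm_num))) (hshift 1 (by norm_num) (by norm_num)))
            (hshift 0 le_rfl (by norm_num))
      _ = _ := by ring
  have hlocal : ‖e t‖ₑ ≤ 3 * ((q ^ 48)⁻¹ * (D * S)) + 4 * S := by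
    have hωk : ω k ≤ S := by
      have := le_inv_pow_mul_geomSum q0 q1 k ω (l := k) (N := 0) (by simp)
      simpa using this
    have hωt : ω k ≠ ⊤ := ne_top_of_le_ne_top hSt hωk
    have hBt : (q ^ 48)⁻¹ * (D * S) ≠ ⊤ := by finiteness
    have h := norm_le_of_lattice_bound he (x₀ := 1 / 2 + 2 * (k : ℝ)) (ω := S.toReal)
      (B := ((q ^ 48)⁻¹ * (D * S)).toReal)
      (fun y u hy hu => norm_le_toReal_of_enorm_le hSt ((hω k y u hy hu).trans hωk))
      (fun l h0 h1 => norm_le_toReal_of_enorm_le hBt (by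
        have e1 : 1 / 2 + 2 * (k : ℝ) + 2 * l = 1 / 2 + 2 * ((k + l : ℤ) : ℝ) := by
          push_cast; ring
        rw [e1, ← hb]
        exact (le_inv_pow_mul_geomSum q0 q1 k (fun l => ‖b l‖ₑ) (l := k + l) (N := 48)
          (by omega)).trans (mul_le_mul_right hB _))) ht0 ht1
    refine enorm_le_of_norm_le_toReal ?_
    rw [ENNReal.toReal_add (by finiteness) (by finiteness), ENNReal.toReal_mul (a := 3),
      ENNReal.toReal_mul (a := 4), ENNReal.toReal_ofNat, ENNReal.toReal_ofNat]
    exact h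
  -- Cubic reproduction: the contribution of P to the error is zero.
  have hFt : ∑' l, hermiteTerm F t l - F t = ∑' l, hermiteTerm e t l - e t := by
    have hp := hasSum_hermiteTerm_polynomial hP3 t
    have h1 : hermiteTerm e t = fun l => hermiteTerm F t l -
        hermiteTerm (fun x : ℝ => P.eval (x : ℂ)) t l := by
      ext l
      simp only [hermiteTerm, (he _).deriv, (hF _).deriv, (hasDerivAt_eval_ofReal P _).deriv]
      rw [he_def, he'_def]
      ring
    rw [h1, (hs.hasSum.sub hp).tsum_eq, he_def]
    ring
  rw [hFt]
  calc ‖∑' l, hermiteTerm e t l - e t‖ₑ ≤ ‖∑' l, hermiteTerm e t l‖ₑ + ‖e t‖ₑ := enorm_sub_le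
    _ ≤ ENNReal.ofReal K * (D * S + (2 * (4 * ((q ^ 3)⁻¹ * (D * S))) + S)) +
        (3 * ((q ^ 48)⁻¹ * (D * S)) + 4 * S) :=
        add_le_add (enorm_tsum_le_tsum_enorm.trans hsum) hlocal
    _ = _ := by ring

/-! ### The order of approximation -/

theorem measurable_reconstructionFun (i : Fin 2) : Measurable (Θ i) := by
  rw [funext (reconstructionFun_eq_tsum i)]
  refine measurable_tsum_int (fun v => ?_) fun t => (hasSum_reconstructionFun i t).summable
  have h := measurable_cubicBSpline
  fun_prop

theorem measurable_tsum_hermiteTerm {F : ℝ → ℂ} (hs : ∀ t, Summable (hermiteTerm F t)) :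
    Measurable fun t => ∑' l, hermiteTerm F t l := by
  refine measurable_tsum_int (fun l => ?_) hs
  have h := measurable_reconstructionFun
  unfold hermiteTerm
  exact (((h 0).comp (measurable_id.sub_const _)).const_mul _).add
    (((h 1).comp (measurable_id.sub_const _)).const_mul _)

theorem summable_hermiteTerm_of_bounded {F : ℝ → ℂ} {A : ℝ}
    (h0 : ∀ l : ℤ, ‖F (1 / 2 + 2 * (l : ℝ))‖ ≤ A)
    (h1 : ∀ l : ℤ, ‖deriv F (1 / 2 + 2 * (l : ℝ))‖ ≤ A) (t : ℝ) : Summable (hermiteTerm F t) := by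
  have hA : 0 ≤ A := (norm_nonneg _).trans (h0 0)
  have h4 : ∀ l : ℤ, A ≤ A * 4 ^ l.natAbs := fun l =>
    le_mul_of_one_le_right hA (one_le_pow₀ (by norm_num))
  exact (summable_mul_reconstructionFun (fun l => (h0 l).trans (h4 l)) 0 t).add
    (summable_mul_reconstructionFun (fun l => (h1 l).trans (h4 l)) 1 t)

theorem isAdmissible_lattice {W : ℝ} (hW : 0 < W) :
    IsAdmissible fun l : ℤ => W⁻¹ * (1 / 2 + 2 * (l : ℝ)) := by
  have h : ∀ j : ℤ, W⁻¹ * (1 / 2 + 2 * (j : ℝ)) - W⁻¹ * (1 / 2 + 2 * ((j - 1 : ℤ) : ℝ)) =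
      W⁻¹ * 2 := fun j => by push_cast; ring
  exact ⟨W⁻¹ * 2, W⁻¹ * 2, by positivity, fun j => ⟨(h j).ge, (h j).le⟩⟩

/-- Every x lies on the admissible sequence x + ℤ. -/
theorem differentiable_of_mem_lambdaSpace {p : ℝ} {f : ℝ → ℂ} (hf : f ∈ lambdaSpace 2 p) :
    Differentiable ℝ f := by
  intro x
  have hadm : IsAdmissible fun j : ℤ => x + (j : ℝ) := by
    have h : ∀ j : ℤ, x + (j : ℝ) - (x + ((j - 1 : ℤ) : ℝ)) = 1 := fun j => by push_cast; ring
    exact ⟨1, 1, one_pos, fun j => ⟨(h j).ge, (h j).le⟩⟩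
  have h := (hf.2.2 _ hadm).1 0 0 (by norm_num)
  simpa using h

theorem exists_deriv_bound_of_mem_lambdaSpace {p : ℝ} (hp : 1 ≤ p) {f : ℝ → ℂ}
    (hf : f ∈ lambdaSpace 2 p) {W : ℝ} (hW : 0 < W) :
    ∃ A : ℝ, ∀ l : ℤ, ‖deriv f (W⁻¹ * (1 / 2 + 2 * (l : ℝ)))‖ ≤ A := by
  have hs := (hf.2.2 _ (isAdmissible_lattice hW)).2
  have hgap : ∀ j : ℤ, W⁻¹ * (1 / 2 + 2 * (j : ℝ)) - W⁻¹ * (1 / 2 + 2 * ((j - 1 : ℤ) : ℝ)) =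
      W⁻¹ * 2 := fun j => by push_cast; ring
  simp only [hgap, Fin.sum_univ_two, Fin.val_zero, Fin.val_one, iteratedDeriv_zero,
    iteratedDeriv_one] at hs
  have hnn : ∀ j : ℤ, 0 ≤ ‖f (W⁻¹ * (1 / 2 + 2 * (j : ℝ)))‖ ^ p * (W⁻¹ * 2) +
      ‖deriv f (W⁻¹ * (1 / 2 + 2 * (j : ℝ)))‖ ^ p * (W⁻¹ * 2) := fun j => by positivity
  set S := ∑' j : ℤ, (‖f (W⁻¹ * (1 / 2 + 2 * (j : ℝ)))‖ ^ p * (W⁻¹ * 2) +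
      ‖deriv f (W⁻¹ * (1 / 2 + 2 * (j : ℝ)))‖ ^ p * (W⁻¹ * 2)) with hS
  refine ⟨(S * W / 2) ^ p⁻¹, fun l => ?_⟩
  have hp0 : 0 < p := by linarith
  have h1 := hs.le_tsum l fun j _ => hnn j
  have h2 : 0 ≤ ‖f (W⁻¹ * (1 / 2 + 2 * (l : ℝ)))‖ ^ p * (W⁻¹ * 2) := by positivity
  have h3 : ‖deriv f (W⁻¹ * (1 / 2 + 2 * (l : ℝ)))‖ ^ p ≤ S * W / 2 := by
    have h4 : ‖deriv f (W⁻¹ * (1 / 2 + 2 * (l : ℝ)))‖ ^ p * (W⁻¹ * 2) ≤ S := by linarith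
    rw [← le_div_iff₀ (by positivity)] at h4
    refine h4.trans_eq ?_
    field_simp
  rw [Real.le_rpow_inv_iff_of_pos (norm_nonneg _)
    ((Real.rpow_nonneg (norm_nonneg _) _).trans h3) hp0]
  exact h3

theorem summable_hermiteTerm_of_mem_lambdaSpace {p : ℝ} (hp : 1 ≤ p) {f : ℝ → ℂ}
    (hf : f ∈ lambdaSpace 2 p) {W : ℝ} (hW : 0 < W) (t : ℝ) :
    Summable (hermiteTerm (fun x => f (W⁻¹ * x)) t) := by
  obtain ⟨M, hM⟩ := hf.2.1
  obtain ⟨A, hA⟩ := exists_deriv_bound_of_mem_lambdaSpace hp hf hW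
  refine summable_hermiteTerm_of_bounded (F := fun x => f (W⁻¹ * x))
    (A := max M (W⁻¹ * A))
    (fun l => (hM _).trans (le_max_left _ _)) (fun l => le_trans ?_ (le_max_right _ _)) t
  rw [deriv_comp_mul_left, norm_smul, Real.norm_of_nonneg (by positivity)]
  exact mul_le_mul_of_nonneg_left (hA l) (by positivity)

/-! ### From the pointwise error to the averaged modulus. -/

theorem fwdDiff_iterate_three (g : ℝ → ℂ) (h t : ℝ) :
    ((fwdDiff h)^[3] g) t = thirdDiff g t h := by
  simp only [Function.iterate_succ, Function.iterate_zero, Function.comp_apply, id_eq, fwdDiff,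
    thirdDiff]
  rw [show t + h + h = t + 2 * h by ring, show t + 2 * h + h = t + 3 * h by ring]
  ring

theorem enorm_thirdDiff_le_localModulus (g : ℝ → ℂ) {x δ t h : ℝ}
    (ht : t ∈ Set.Icc (x - 3 * δ / 2) (x + 3 * δ / 2))
    (hh : t + 3 * h ∈ Set.Icc (x - 3 * δ / 2) (x + 3 * δ / 2)) :
    ‖thirdDiff g t h‖ₑ ≤ localModulus 3 g x δ := by
  rw [← fwdDiff_iterate_three, localModulus]
  simp only [Nat.cast_ofNat]
  exact le_iSup₂_of_le t h (le_iSup₂_of_le ht hh le_rfl)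

/-- The smallest local modulus over the `l`-th cell of the scaled sampling lattice. -/
noncomputable def cellModulus (g : ℝ → ℂ) (W : ℝ) (l : ℤ) : ℝ≥0∞ :=
  ⨅ z ∈ Set.Ico (W⁻¹ * (1 / 2) + l * (W⁻¹ * 2)) (W⁻¹ * (1 / 2) + (l + 1) * (W⁻¹ * 2)),
    localModulus 3 g z (66 * W⁻¹)

theorem enorm_thirdDiff_scaled_le (g : ℝ → ℂ) {W : ℝ} (hW : 1 ≤ W) (l : ℤ) (y u : ℝ)
    (hy : y ∈ Set.Icc (1 / 2 + 2 * (l : ℝ) - 96) (1 / 2 + 2 * (l : ℝ) + 96))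
    (hu : y + 3 * u ∈ Set.Icc (1 / 2 + 2 * (l : ℝ) - 96) (1 / 2 + 2 * (l : ℝ) + 96)) :
    ‖thirdDiff (fun x => (W⁻¹ : ℝ) • g (W⁻¹ * x)) y u‖ₑ ≤ cellModulus g W l := by
  have hi : 0 < W⁻¹ := inv_pos.2 (by linarith)
  have hi1 : W⁻¹ ≤ 1 := inv_le_one_of_one_le₀ hW
  rw [cellModulus]
  refine le_iInf₂ fun z hz => ?_
  have e1 : thirdDiff (fun x => (W⁻¹ : ℝ) • g (W⁻¹ * x)) y u =
      (W⁻¹ : ℝ) • thirdDiff g (W⁻¹ * y) (W⁻¹ * u) := by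
    simp only [thirdDiff, Complex.real_smul]
    rw [show W⁻¹ * (y + 3 * u) = W⁻¹ * y + 3 * (W⁻¹ * u) by ring,
      show W⁻¹ * (y + 2 * u) = W⁻¹ * y + 2 * (W⁻¹ * u) by ring, mul_add W⁻¹ y u]
    ring
  -- The scaled window reaches 96/W from the node and z lies within 2/W of it, so radius 98/W
  -- suffices; δ = 66/W gives 3δ/2 = 99/W.
  have hmem : ∀ s ∈ Set.Icc (1 / 2 + 2 * (l : ℝ) - 96) (1 / 2 + 2 * (l : ℝ) + 96),
      W⁻¹ * s ∈ Set.Icc (z - 3 * (66 * W⁻¹) / 2) (z + 3 * (66 * W⁻¹) / 2) := by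
    intro s hs
    have h1 := mul_le_mul_of_nonneg_left hs.1 hi.le
    have h2 := mul_le_mul_of_nonneg_left hs.2 hi.le
    constructor <;> nlinarith [hz.1, hz.2]
  rw [e1, enorm_smul]
  -- The chain rule factor W⁻¹ is simply bounded by one.
  refine (mul_le_mul' (b := 1) ?_ (enorm_thirdDiff_le_localModulus g (hmem y hy)
    (by have := hmem _ hu; rwa [mul_add, mul_left_comm W⁻¹ 3 u] at this))).trans_eq (one_mul _)
  rw [← ofReal_norm, Real.norm_of_nonneg hi.le]
  exact ENNReal.ofReal_le_one.2 hi1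

theorem eLpNorm_rpow_eq_lintegral {ε : Type*} [TopologicalSpace ε] [ContinuousENorm ε]
    (f : ℝ → ε) {p : ℝ} (hp : 0 < p) :
    eLpNorm f (ENNReal.ofReal p) volume ^ p = ∫⁻ x, ‖f x‖ₑ ^ p := by
  rw [eLpNorm_eq_lintegral_rpow_enorm_toReal (by simpa using hp) ENNReal.ofReal_ne_top,
    ENNReal.toReal_ofReal hp.le, ← ENNReal.rpow_mul, one_div, inv_mul_cancel₀ hp.ne',
    ENNReal.rpow_one]

/-- Taking the infimum over a cell makes a lower step function for the modulus, so its sum is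
dominated by the integral without any measurability of the modulus. -/
theorem tsum_cellModulus_rpow_le (g : ℝ → ℂ) {W p : ℝ} (hW : 0 < W) (hp : 0 < p) :
    ∑' l : ℤ, ENNReal.ofReal (W⁻¹ * 2) * cellModulus g W l ^ p ≤
      tauModulus 3 g (66 * W⁻¹) p ^ p := by
  rw [tauModulus, eLpNorm_rpow_eq_lintegral _ hp,
    lintegral_eq_tsum_Ico (W⁻¹ * (1 / 2)) (p := W⁻¹ * 2) (by positivity)]
  refine ENNReal.tsum_le_tsum fun l => ?_
  have h := setLIntegral_mono' (μ := volume) (f := fun _ => cellModulus g W l ^ p)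
    (g := fun x => ‖localModulus 3 g x (66 * W⁻¹)‖ₑ ^ p)
    (measurableSet_Ico (a := W⁻¹ * (1 / 2) + l * (W⁻¹ * 2))
      (b := W⁻¹ * (1 / 2) + (l + 1) * (W⁻¹ * 2))) fun x hx => by
    rw [enorm_eq_self]
    exact ENNReal.rpow_le_rpow (iInf₂_le x hx) hp.le
  rw [setLIntegral_const, Real.volume_Ico, mul_comm] at h
  refine le_trans (le_of_eq ?_) h
  congr 2
  ring

theorem geomSum_eq_geomConv (q : ℝ≥0∞) (k : ℤ) (v : ℤ → ℝ≥0∞) :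
    geomSum q k v = geomConv q v k :=
  tsum_congr fun n => by rw [show (n - k).natAbs = (k - n).natAbs by omega]

/-- The error of the sampling operator in `L^p` is controlled by the averaged modulus of the
derivative. -/
theorem exists_eLpNorm_sampling_error_le : ∃ C : ℝ≥0∞, C ≠ ⊤ ∧ ∀ p : ℝ, 1 ≤ p →
    ∀ f ∈ lambdaSpace 2 p, ∀ W : ℝ, 1 ≤ W →
      eLpNorm (fun t => samplingOperator cubicBSpline (1 / 2) 2 W f t - f t) (ENNReal.ofReal p)
        volume ≤ C * tauModulus 3 (deriv f) (66 * W⁻¹) p := by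
  obtain ⟨C, hC, hb⟩ := exists_sampling_error_bound
  set q := ENNReal.ofReal decayRatio
  have qm : geomMass q ≠ ⊤ := geomMass_ofReal_ne_top decayRatio_pos.le (by linarith [decayRatio_lt])
  refine ⟨C * geomMass q, by finiteness, fun p hp f hf W hW => ?_⟩
  have hW0 : 0 < W := by linarith
  have hp0 : 0 < p := by linarith
  have hd := differentiable_of_mem_lambdaSpace hf
  set τ := tauModulus 3 (deriv f) (66 * W⁻¹) p with hτ
  have hF : ∀ x, HasDerivAt (fun x => f (W⁻¹ * x)) ((W⁻¹ : ℝ) • deriv f (W⁻¹ * x)) x := fun x => by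
    have h1 : HasDerivAt (fun x : ℝ => W⁻¹ * x) W⁻¹ x := by
      simpa using (hasDerivAt_id x).const_mul W⁻¹
    exact (hd (W⁻¹ * x)).hasDerivAt.scomp x h1
  have hpt : ∀ (k : ℤ), ∀ t ∈ Set.Ico (W⁻¹ * (1 / 2) + k * (W⁻¹ * 2))
      (W⁻¹ * (1 / 2) + (k + 1) * (W⁻¹ * 2)),
      ‖samplingOperator cubicBSpline (1 / 2) 2 W f t - f t‖ₑ ≤
        C * geomConv q (cellModulus (deriv f) W) k := by
    intro k t ht
    have e1 : W⁻¹ * (1 / 2) + k * (W⁻¹ * 2) = W⁻¹ * (1 / 2 + 2 * (k : ℝ)) := by ring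
    have e2 : W⁻¹ * (1 / 2) + (k + 1) * (W⁻¹ * 2) = W⁻¹ * (1 / 2 + 2 * (k : ℝ) + 2) := by ring
    rw [e1, e2] at ht
    have h0 : 1 / 2 + 2 * (k : ℝ) ≤ W * t := (inv_mul_le_iff₀ hW0).1 ht.1
    have h1 : W * t ≤ 1 / 2 + 2 * (k : ℝ) + 2 := ((lt_inv_mul_iff₀ hW0).1 ht.2).le
    have h := hb _ _ (cellModulus (deriv f) W) hF
      (fun l y u => enorm_thirdDiff_scaled_le (deriv f) hW l y u) k (W * t) h0 h1
      (summable_hermiteTerm_of_mem_lambdaSpace hp hf hW0 (W * t))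
    rw [inv_mul_cancel_left₀ hW0.ne', geomSum_eq_geomConv] at h
    rw [samplingOperator, tsum_congr fun l => samplingTerm_eq_hermiteTerm W f t l]
    exact h
  -- The p-th power of the norm splits over the cells, on each of which the pointwise bound is
  -- constant; Young's inequality then sums them.
  rw [← ENNReal.rpow_le_rpow_iff hp0, eLpNorm_rpow_eq_lintegral _ hp0,
    lintegral_eq_tsum_Ico (W⁻¹ * (1 / 2)) (p := W⁻¹ * 2) (by positivity)]
  have hcell : ∀ k : ℤ, ∫⁻ t in Set.Ico (W⁻¹ * (1 / 2) + k * (W⁻¹ * 2))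
      (W⁻¹ * (1 / 2) + (k + 1) * (W⁻¹ * 2)),
      ‖samplingOperator cubicBSpline (1 / 2) 2 W f t - f t‖ₑ ^ p ≤
      ENNReal.ofReal (W⁻¹ * 2) * C ^ p * geomConv q (cellModulus (deriv f) W) k ^ p := by
    intro k
    refine (setLIntegral_mono' measurableSet_Ico fun t ht =>
      ENNReal.rpow_le_rpow (hpt k t ht) hp0.le).trans_eq ?_
    rw [setLIntegral_const, Real.volume_Ico, ENNReal.mul_rpow_of_nonneg _ _ hp0.le, mul_comm,
      ← mul_assoc]
    congr 3
    ring
  calc _ ≤ ∑' k : ℤ, ENNReal.ofReal (W⁻¹ * 2) * C ^ p *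
          geomConv q (cellModulus (deriv f) W) k ^ p := ENNReal.tsum_le_tsum hcell
    _ ≤ ENNReal.ofReal (W⁻¹ * 2) * C ^ p * (geomMass q ^ (p - 1) *
          (geomMass q * ∑' l, cellModulus (deriv f) W l ^ p)) := by
        rw [ENNReal.tsum_mul_left]
        exact mul_le_mul_right (tsum_geomConv_rpow_le q _ hp) _
    _ = C ^ p * (geomMass q ^ (p - 1) * geomMass q ^ (1 : ℝ)) *
          ∑' l, ENNReal.ofReal (W⁻¹ * 2) * cellModulus (deriv f) W l ^ p := by
        rw [ENNReal.tsum_mul_left, ENNReal.rpow_one]; ring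
    _ = (C * geomMass q) ^ p *
          ∑' l, ENNReal.ofReal (W⁻¹ * 2) * cellModulus (deriv f) W l ^ p := by
        rw [← ENNReal.rpow_add_of_nonneg _ _ (by linarith) zero_le_one, sub_add_cancel,
          ENNReal.mul_rpow_of_nonneg _ _ hp0.le]
    _ ≤ (C * geomMass q) ^ p * τ ^ p :=
        mul_le_mul_right (tsum_cellModulus_rpow_le (deriv f) hW0 hp0) _
    _ = _ := (ENNReal.mul_rpow_of_nonneg _ _ hp0.le).symm

theorem measurable_samplingOperator {p : ℝ} (hp : 1 ≤ p) {f : ℝ → ℂ} (hf : f ∈ lambdaSpace 2 p)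
    {W : ℝ} (hW : 0 < W) : Measurable (samplingOperator cubicBSpline (1 / 2) 2 W f) := by
  have h := (measurable_tsum_hermiteTerm
    (summable_hermiteTerm_of_mem_lambdaSpace hp hf hW)).comp (measurable_const_mul W)
  refine (congrArg Measurable (funext fun t => ?_)).mp h
  exact (tsum_congr fun l => samplingTerm_eq_hermiteTerm W f t l).symm

theorem sampling_error_order {p α : ℝ} (hp : 1 ≤ p) {f : ℝ → ℂ} (hf : f ∈ lambdaSpace 2 p)
    (hτ : ∃ K : ℝ, ∀ᶠ δ in 𝓝[>] (0 : ℝ),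
      tauModulus 3 (deriv f) δ p ≤ ENNReal.ofReal (K * δ ^ α)) :
    ∃ C : ℝ, ∀ᶠ W : ℝ in atTop,
      MemLp (fun t => samplingOperator cubicBSpline (1 / 2) 2 W f t - f t)
          (ENNReal.ofReal p) volume ∧
      eLpNorm (fun t => samplingOperator cubicBSpline (1 / 2) 2 W f t - f t)
          (ENNReal.ofReal p) volume ≤ ENNReal.ofReal (C * W ^ (-α)) := by
  obtain ⟨C, hC, hb⟩ := exists_eLpNorm_sampling_error_le
  obtain ⟨K, hK⟩ := hτ
  have hlim : Tendsto (fun W : ℝ => 66 * W⁻¹) atTop (𝓝[>] 0) := by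
    rw [tendsto_nhdsWithin_iff]
    refine ⟨by simpa using tendsto_inv_atTop_zero.const_mul (66 : ℝ), ?_⟩
    filter_upwards [eventually_gt_atTop 0] with W hW
    simp only [Set.mem_Ioi]; positivity
  -- The modulus is evaluated at δ = 66/W, so K δ^α = K·66^α·W^{-α}.
  refine ⟨C.toReal * (K * 66 ^ α), ?_⟩
  filter_upwards [hlim.eventually hK, eventually_ge_atTop 1] with W hWK hW
  have hW0 : 0 < W := by linarith
  have h : eLpNorm (fun t => samplingOperator cubicBSpline (1 / 2) 2 W f t - f t)
      (ENNReal.ofReal p) volume ≤ ENNReal.ofReal (C.toReal * (K * 66 ^ α) * W ^ (-α)) := by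
    refine (hb p hp f hf W hW).trans ((mul_le_mul_right hWK _).trans_eq ?_)
    rw [Real.mul_rpow (by norm_num) (by positivity), Real.inv_rpow hW0.le, ← Real.rpow_neg hW0.le,
      mul_assoc, ENNReal.ofReal_mul ENNReal.toReal_nonneg, ENNReal.ofReal_toReal hC, mul_assoc K]
  refine ⟨⟨?_, h.trans_lt ENNReal.ofReal_lt_top⟩, h⟩
  exact ((measurable_samplingOperator hp hf hW0).sub hf.1).aestronglyMeasurable

theorem mainTheorem11 :
    -- the determinant of the symbol, and its non-vanishing on the unit circle
    (∀ t : ℝ, ∀ w : ℂ, w = Complex.exp (2 * Real.pi * Complex.I * (t : ℂ)) →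
      (symbolMatrix cubicBSpline (1 / 2) 2 t).det = w / 64 * (-3 + 38 * w - 3 * w ^ 2) ∧
      (symbolMatrix cubicBSpline (1 / 2) 2 t).det ≠ 0) ∧
    -- `1/2 + 2ℤ` is a complete interpolation set of order 1
    IsCompleteInterpolationSet cubicBSpline 1 (fun l : ℤ => 1 / 2 + 2 * (l : ℝ)) ∧
    -- the explicit, geometrically decaying coefficients
    (0 < decayRatio ∧ decayRatio < 1) ∧
    (∀ v : ℤ,
      invSymbolCoeff cubicBSpline (1 / 2) 2 0 0 v =
        ((8 * decayRatio / (3 * (1 - decayRatio ^ 2)) *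
          (5 * decayRatio ^ (v + 1).natAbs - decayRatio ^ v.natAbs) : ℝ) : ℂ) ∧
      invSymbolCoeff cubicBSpline (1 / 2) 2 1 0 v =
        ((8 * decayRatio / (3 * (1 - decayRatio ^ 2)) *
          (5 * decayRatio ^ (v + 1).natAbs - decayRatio ^ (v + 2).natAbs) : ℝ) : ℂ) ∧
      invSymbolCoeff cubicBSpline (1 / 2) 2 0 1 v =
        ((-(4 * decayRatio / (9 * (1 - decayRatio ^ 2))) *
          (23 * decayRatio ^ (v + 1).natAbs + decayRatio ^ v.natAbs) : ℝ) : ℂ) ∧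
      invSymbolCoeff cubicBSpline (1 / 2) 2 1 1 v =
        ((4 * decayRatio / (9 * (1 - decayRatio ^ 2)) *
          (23 * decayRatio ^ (v + 1).natAbs + decayRatio ^ (v + 2).natAbs) : ℝ) : ℂ)) ∧
    (∃ C : ℝ, ∀ j i : Fin 2, ∀ v : ℤ,
      ‖invSymbolCoeff cubicBSpline (1 / 2) 2 j i v‖ ≤ C * decayRatio ^ v.natAbs) ∧
    -- the reconstruction functions
    (∀ t : ℝ,
      HasSum (fun v : ℤ =>
        ((8 * decayRatio / (3 * (1 - decayRatio ^ 2)) : ℝ) : ℂ) *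
          (((5 * decayRatio ^ (v + 1).natAbs - decayRatio ^ v.natAbs : ℝ) : ℂ) *
              cubicBSpline (t - 2 * (v : ℝ)) +
            ((5 * decayRatio ^ (v + 1).natAbs - decayRatio ^ (v + 2).natAbs : ℝ) : ℂ) *
              cubicBSpline (t - 2 * (v : ℝ) - 1)))
        (reconstructionFun cubicBSpline (1 / 2) 2 0 t) ∧
      HasSum (fun v : ℤ =>
        ((-(4 * decayRatio / (9 * (1 - decayRatio ^ 2))) : ℝ) : ℂ) *
          (((23 * decayRatio ^ (v + 1).natAbs + decayRatio ^ v.natAbs : ℝ) : ℂ) *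
              cubicBSpline (t - 2 * (v : ℝ)) -
            ((23 * decayRatio ^ (v + 1).natAbs + decayRatio ^ (v + 2).natAbs : ℝ) : ℂ) *
              cubicBSpline (t - 2 * (v : ℝ) - 1)))
        (reconstructionFun cubicBSpline (1 / 2) 2 1 t)) ∧
    -- the sampling formula on `V(Q₄)`
    (∀ f ∈ shiftInvariantSpace cubicBSpline, ∀ t : ℝ,
      HasSum (fun l : ℤ =>
        f (1 / 2 + 2 * (l : ℝ)) * reconstructionFun cubicBSpline (1 / 2) 2 0 (t - 2 * (l : ℝ)) +
        deriv f (1 / 2 + 2 * (l : ℝ)) *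
          reconstructionFun cubicBSpline (1 / 2) 2 1 (t - 2 * (l : ℝ)))
        (f t)) ∧
    -- reproduction of polynomials of degree at most 3
    ReproducesPolynomials cubicBSpline (1 / 2) 2 3 ∧
    -- the order of approximation
    (∀ p α : ℝ, 1 ≤ p → 0 < α → ∀ f ∈ lambdaSpace 2 p,
      (∀ i : Fin 2, ∃ K : ℝ, ∀ᶠ δ in 𝓝[>] (0 : ℝ),
        tauModulus 3 (iteratedDeriv i f) δ p ≤ ENNReal.ofReal (K * δ ^ α)) →
      (∀ W : ℝ, 1 ≤ W → ∀ t : ℝ, Summable (samplingTerm cubicBSpline (1 / 2) 2 W f t)) ∧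
      ∃ C : ℝ, ∀ᶠ W : ℝ in atTop,
        MemLp (fun t => samplingOperator cubicBSpline (1 / 2) 2 W f t - f t)
            (ENNReal.ofReal p) volume ∧
        eLpNorm (fun t => samplingOperator cubicBSpline (1 / 2) 2 W f t - f t)
            (ENNReal.ofReal p) volume ≤ ENNReal.ofReal (C * W ^ (-α))) 
:= by
  have hr := decayRatio_pos
  refine ⟨?_, isCompleteInterpolationSet_cubicBSpline, ⟨hr, by linarith [decayRatio_lt]⟩,
    fun v => ?_, ?_, fun t => ⟨?_, ?_⟩, fun f hf t => hasSum_hermiteTerm_of_mem hf t,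
    reproducesPolynomials_cubicBSpline, fun p α hp _ f hf hτ => ⟨fun W hW t => ?_, ?_⟩⟩
  · intro t w hw
    have hw' : w = expChar 1 t := by rw [hw, expChar]; simp
    rw [hw']
    exact ⟨det_symbolMatrix t, det_symbolMatrix_ne_zero t⟩
  · simp only [invSymbolCoeff_eq, dualCoeff_zero_zero, dualCoeff_one_zero, dualCoeff_zero_one,
      dualCoeff_one_one, and_self]
  · obtain ⟨C, -, hC⟩ := exists_norm_dualCoeff_le
    refine ⟨C, fun j i v => ?_⟩
    rw [invSymbolCoeff_eq, Complex.norm_real]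
    exact hC j i v
  · refine (congrArg (fun f => HasSum f _) (funext fun v => ?_)).mp (hasSum_reconstructionFun 0 t)
    rw [dualCoeff_zero_zero, dualCoeff_one_zero]
    push_cast
    ring
  · refine (congrArg (fun f => HasSum f _) (funext fun v => ?_)).mp (hasSum_reconstructionFun 1 t)
    rw [dualCoeff_zero_one, dualCoeff_one_one]
    push_cast
    ring
  · rw [funext fun l => samplingTerm_eq_hermiteTerm W f t l]
    exact summable_hermiteTerm_of_mem_lambdaSpace hp hf (by linarith) _
  · have h1 := hτ 1
    simp only [Fin.val_one, iteratedDeriv_one] at h1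
    exact sampling_error_order hp hf h1
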